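/- Let $G$ be a smooth real Lie group (finite-dimensional, or more generally modelled on a Banach space) with Lie algebra $\mathfrak g=T_1G$, and for $n\ge 0$ let $J^nG$ be the group of $n$-jets $j^nc$ at $0$ of smooth curves $c:\mathbb R\to G$, with multiplication $(j^nc)(j^nb)=j^n(cb)$. Let $\delta^rc=c'c^{-1}:\mathbb R\to\mathfrak g$ denote the right logarithmic derivative. The right trivialization $$J^nG\to G\times\mathfrak g^n,\qquad j^nc\mapsto\big(c(0),(\delta^rc)(0),(\delta^rc)'(0),\dots,(\delta^rc)^{(n-1)}(0)\big)$$ is a well-defined bijection, and with the group structure transported along it the product manifold $G\times\mathfrak g^n$ is a Lie group, again denoted $J^nG$; let $J^n\mathfrak g$ be its Lie algebra, identified as a vector space with $T_{(1,0)}(G\times\mathfrak g^n)=\mathfrak g\times\mathfrak g^n$. For $m\ge1$ let $\mathcal P_m$ be the set of partitions $\lambda=\lambda_1|\dots|\lambda_\ell$ of $\{1,\dots,m\}$ into nonempty blocks, ordered by increasing greatest element (anti-lexicographically); put $\ell=\ell(\lambda)$ and $i_r=|\lambda_r|$. For $i_1,\dots,i_\ell\ge1$ put $N_{(i_1,\dots,i_\ell)}=\prod_{r=2}^{\ell}\binom{i_1+\dots+i_r-1}{i_r-1}$.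 Let $k\ge1$. (1) The maps $\iota(v)=(1,0,\dots,0,v)$ and $\pi(g,x_1,\dots,x_k)=(g,x_1,\dots,x_{k-1})$ (the jet projection) form an abelian Lie group extension $\mathfrak g\xrightarrow{\ \iota\ }J^kG\xrightarrow{\ \pi\ }J^{k-1}G$, with smooth section $s(g,x_1,\dots,x_{k-1})=(g,x_1,\dots,x_{k-1},0)$: the maps $\iota$, $\pi$ are smooth homomorphisms forming a short exact sequence, and $(b,v)\mapsto\iota(v)s(b)$ is a diffeomorphism $J^{k-1}G\times\mathfrak g\to J^kG$. The induced action of $J^{k-1}G$ on $\mathfrak g$ is the smooth action $(g,x)\cdot v=\mathrm{Ad}_gv$, that is, $a\,\iota(v)\,a^{-1}=\iota(\pi(a)\cdot v)$ for $a\in J^kG$. The extension is characterized by the smooth group $2$-cocycle $$c_k\big((g,x_1,\dots,x_{k-1}),(h,y_1,\dots,y_{k-1})\big)=\sum_{\lambda\in\mathcal P_k\setminus\{12\dots k\}}\mathrm{ad}_{x_{i_{\ell-1}}}\cdots\mathrm{ad}_{x_{i_1}}\mathrm{Ad}_g\,y_{i_\ell}=\sum_{\ell=2}^{k}\ \sum_{i_1+\dots+i_\ell=k}N_{(i_1,\dots,i_\ell)}\,\mathrm{ad}_{x_{i_{\ell-1}}}\cdots\mathrm{ad}_{x_{i_1}}\mathrm{Ad}_g\,y_{i_\ell},$$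 that is, $s(a)s(b)=\iota(c_k(a,b))\,s(ab)$ for all $a,b\in J^{k-1}G$. (2) The derivatives of $\iota$ and $\pi$ at the identity form an abelian extension of Lie algebras $\mathfrak g\to J^k\mathfrak g\to J^{k-1}\mathfrak g$ (with $\mathfrak g$ regarded as an abelian Lie algebra). For its linear section $\tau$, the derivative of $s$ at the identity, the induced action of $J^{k-1}\mathfrak g$ on $\mathfrak g$ is $(\xi,x_1,\dots,x_{k-1})\cdot v=[\xi,v]$, and its Lie algebra $2$-cocycle is $$\sigma_k\big((\xi,x_1,\dots,x_{k-1}),(\eta,y_1,\dots,y_{k-1})\big)=\sum_{i=1}^{k-1}\binom ki[x_i,y_{k-i}],$$ that is, $[\tau X,\tau Y]=\tau[X,Y]+d\iota(\sigma_k(X,Y))$ for all $X,Y\in J^{k-1}\mathfrak g$. -/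

import Mathlib

open scoped Manifold ContDiff

/-! ### Smooth curves and their jets -/

section Jets

variable (E : Type*) [NormedAddCommGroup E] [NormedSpace ℝ E]
  (G : Type*) [TopologicalSpace G] [ChartedSpace E G]

/-- Smooth curves `ℝ → G`. If `G` is a Lie group, they form a group under pointwise
multiplication. -/
abbrev SmoothCurve : Type _ := C^∞⟮𝓘(ℝ, ℝ), ℝ; 𝓘(ℝ, E), G⟯

variable {E G}

/-- Two curves have the same `k`-jet at `0`: they have the same value at `0`, and in the preferred
chart at this point all their derivatives at `0` up to order `k` agree. -/
def SameJet (k : ℕ) (c b : SmoothCurve E G) : Prop :=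
  c 0 = b 0 ∧ ∀ n ≤ k,
    iteratedDeriv n (fun t : ℝ => extChartAt 𝓘(ℝ, E) (c 0) (c t)) 0 =
      iteratedDeriv n (fun t : ℝ => extChartAt 𝓘(ℝ, E) (c 0) (b t)) 0

theorem SameJet.equivalence (k : ℕ) : Equivalence (SameJet (E := E) (G := G) k) where
  refl _ := ⟨rfl, fun _ _ => rfl⟩
  symm h := ⟨h.1.symm, fun n hn => by rw [← h.1]; exact (h.2 n hn).symm⟩
  trans h h' := ⟨h.1.trans h'.1, fun n hn => (h.2 n hn).trans (by
    have := h'.2 n hn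
    rwa [← h.1] at this)⟩

theorem iteratedDeriv_comp_congr {E₁ E₂ : Type*} [NormedAddCommGroup E₁] [NormedSpace ℝ E₁]
    [NormedAddCommGroup E₂] [NormedSpace ℝ E₂] {F : E₁ → E₂} {u v : ℝ → E₁} {k : ℕ}
    (h0 : u 0 = v 0) (hF : ContDiffAt ℝ k F (u 0)) (hu : ContDiffAt ℝ k u 0)
    (hv : ContDiffAt ℝ k v 0)
    (h : ∀ n ≤ k, iteratedFDeriv ℝ n u 0 = iteratedFDeriv ℝ n v 0) {n : ℕ} (hn : n ≤ k) :
    iteratedDeriv n (F ∘ u) 0 = iteratedDeriv n (F ∘ v) 0 := by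
  have hn' : (n : ℕ∞ω) ≤ k := by exact_mod_cast hn
  have key : iteratedFDeriv ℝ n (F ∘ u) 0 = iteratedFDeriv ℝ n (F ∘ v) 0 := by
    rw [iteratedFDeriv_comp hF hu hn', iteratedFDeriv_comp (h0 ▸ hF) hv hn', h0]
    unfold FormalMultilinearSeries.taylorComp
    refine Finset.sum_congr rfl fun p _ => ?_
    unfold FormalMultilinearSeries.compAlongOrderedFinpartition
    congr 1
    funext m
    exact h _ ((p.partSize_le m).trans hn)
  simp only [iteratedDeriv_eq_iteratedFDeriv, key]

variable [Group G] [LieGroup 𝓘(ℝ, E) ∞ G]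

theorem SameJet.mul {k : ℕ} {c c' b b' : SmoothCurve E G} (hc : SameJet k c c')
    (hb : SameJet k b b') : SameJet k (c * b) (c' * b') := by
  refine ⟨by simp [hc.1, hb.1], fun n hn => ?_⟩
  set φ := extChartAt 𝓘(ℝ, E) (c 0) with hφ
  set ψ := extChartAt 𝓘(ℝ, E) (b 0) with hψ
  set χ := extChartAt 𝓘(ℝ, E) (c 0 * b 0) with hχ
  let F : E × E → E := fun p => χ (φ.symm p.1 * ψ.symm p.2)
  have hcoord : ∀ (x : G) (f : SmoothCurve E G), f 0 = x →
      ContDiffAt ℝ ∞ (fun t : ℝ => extChartAt 𝓘(ℝ, E) x (f t)) 0 := by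
    intro x f hf
    refine ContMDiffAt.contDiffAt ?_
    have h1 : ContMDiffAt 𝓘(ℝ, E) 𝓘(ℝ, E) ∞ (extChartAt 𝓘(ℝ, E) x) (f 0) := by
      rw [hf]; exact contMDiffAt_extChartAt
    exact h1.comp (0 : ℝ) f.contMDiff.contMDiffAt
  have hev : ∀ (f g : SmoothCurve E G), f 0 = c 0 → g 0 = b 0 →
      (fun t : ℝ => χ ((f * g) t)) =ᶠ[nhds 0] F ∘ fun t => (φ (f t), ψ (g t)) := by
    intro f g hf hg
    have e1 : ∀ᶠ t in nhds (0 : ℝ), f t ∈ φ.source :=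
      f.contMDiff.continuous.continuousAt.eventually_mem (by
        rw [hf]; exact extChartAt_source_mem_nhds _)
    have e2 : ∀ᶠ t in nhds (0 : ℝ), g t ∈ ψ.source :=
      g.contMDiff.continuous.continuousAt.eventually_mem (by
        rw [hg]; exact extChartAt_source_mem_nhds _)
    filter_upwards [e1, e2] with t h1 h2
    simp [F, φ.left_inv h1, ψ.left_inv h2]
  have hF : ContDiffAt ℝ ∞ F (φ (c 0), ψ (b 0)) := by
    refine ContMDiffAt.contDiffAt ?_
    have s1 : ContMDiffAt 𝓘(ℝ, E) 𝓘(ℝ, E) ∞ φ.symm (φ (c 0)) :=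
      (contMDiffOn_extChartAt_symm (c 0)).contMDiffAt (extChartAt_target_mem_nhds _)
    have s2 : ContMDiffAt 𝓘(ℝ, E) 𝓘(ℝ, E) ∞ ψ.symm (ψ (b 0)) :=
      (contMDiffOn_extChartAt_symm (b 0)).contMDiffAt (extChartAt_target_mem_nhds _)
    have s3 : ContMDiffAt 𝓘(ℝ, E × E) 𝓘(ℝ, E) ∞
        (fun p : E × E => φ.symm p.1 * ψ.symm p.2) (φ (c 0), ψ (b 0)) :=
      ContMDiffAt.mul
        (s1.comp (φ (c 0), ψ (b 0)) (contDiff_fst.contMDiff.contMDiffAt (f := Prod.fst)))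
        (s2.comp (φ (c 0), ψ (b 0)) (contDiff_snd.contMDiff.contMDiffAt (f := Prod.snd)))
    have s4 : ContMDiffAt 𝓘(ℝ, E) 𝓘(ℝ, E) ∞ χ (φ.symm (φ (c 0)) * ψ.symm (ψ (b 0))) := by
      rw [hφ, hψ, extChartAt_to_inv, extChartAt_to_inv]
      exact contMDiffAt_extChartAt
    exact ContMDiffAt.comp (φ (c 0), ψ (b 0)) s4 s3
  have hk : ((k : ℕ) : ℕ∞ω) ≤ ∞ := by exact_mod_cast le_top
  have hfd : ∀ {f g : ℝ → E} {m : ℕ}, iteratedDeriv m f 0 = iteratedDeriv m g 0 →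
      iteratedFDeriv ℝ m f 0 = iteratedFDeriv ℝ m g 0 := by
    intro f g m h
    simp only [iteratedFDeriv_eq_equiv_comp, Function.comp, h]
  have hc0 := (hcoord _ c rfl).of_le hk
  have hc1 := (hcoord _ c' hc.1.symm).of_le hk
  have hb0 := (hcoord _ b rfl).of_le hk
  have hb1 := (hcoord _ b' hb.1.symm).of_le hk
  have hl := (hev c b rfl rfl).iteratedDeriv_eq n
  have hr := (hev c' b' hc.1.symm hb.1.symm).iteratedDeriv_eq n
  change iteratedDeriv n (fun t : ℝ => χ ((c * b) t)) 0
    = iteratedDeriv n (fun t : ℝ => χ ((c' * b') t)) 0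
  rw [hl, hr]
  refine iteratedDeriv_comp_congr (k := k) (by simp [hc.1, hb.1]) (hF.of_le hk)
    (hc0.prodMk hb0) (hc1.prodMk hb1) (fun m hm => ?_) hn
  have hm' : (m : ℕ∞ω) ≤ k := by exact_mod_cast hm
  rw [iteratedFDeriv_prodMk hc0 hb0 hm', iteratedFDeriv_prodMk hc1 hb1 hm',
    hfd (hc.2 m hm), hfd (hb.2 m hm)]

variable (E G) in
/-- Equality of `k`-jets at `0` is compatible with the pointwise multiplication of curves. -/
noncomputable def jetCon (k : ℕ) : Con (SmoothCurve E G) where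
  r := SameJet k
  iseqv := SameJet.equivalence k
  mul' := SameJet.mul

variable (E G) in
/-- `J^k G`: the group of `k`-jets at `0` of smooth curves in `G`, with multiplication
`(j^k c) (j^k b) = j^k (c b)`. -/
abbrev Jet (k : ℕ) : Type _ := (jetCon E G k).Quotient

/-- The `k`-jet `j^k c` at `0` of a smooth curve `c`. -/
noncomputable def jet (k : ℕ) (c : SmoothCurve E G) : Jet E G k := (c : (jetCon E G k).Quotient)

end Jets

/-! ### The Lie algebra `𝔤` and the right trivialization

The Lie algebra `𝔤 = T₁G` of `G` has the model space `E` as underlying normed space. -/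

section RightTrivialization

variable {E : Type*} [NormedAddCommGroup E] [NormedSpace ℝ E]
  {G : Type*} [TopologicalSpace G] [ChartedSpace E G] [Group G]

variable (G) in
/-- The adjoint action `ad_x y = [x, y]` of `𝔤` on itself. -/
noncomputable def ad (x y : E) : E :=
  Bracket.bracket (L := GroupLieAlgebra 𝓘(ℝ, E) G) (M := GroupLieAlgebra 𝓘(ℝ, E) G) x y

variable (E) in
/-- The adjoint action `Ad_g` of `G` on `𝔤`: the derivative at `1` of conjugation by `g`. -/
noncomputable def Ad (g : G) : E →L[ℝ] E :=
  mfderiv 𝓘(ℝ, E) 𝓘(ℝ, E) (fun h : G => g * h * g⁻¹) 1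

/-- The right logarithmic derivative `δʳc = c' c⁻¹ : ℝ → 𝔤` of a curve in `G`. -/
noncomputable def rightLogDeriv (c : ℝ → G) (t : ℝ) : E :=
  mfderiv 𝓘(ℝ, ℝ) 𝓘(ℝ, E) (fun s : ℝ => c s * (c t)⁻¹) t (1 : ℝ)

variable (E G) in
/-- The right trivialized jet bundle `G × 𝔤^n`. -/
abbrev TrivJet (n : ℕ) : Type _ := G × (Fin n → E)

variable (E) in
/-- The model of the product manifold `G × 𝔤^n`. -/
noncomputable abbrev trivJetModel (n : ℕ) :
    ModelWithCorners ℝ (E × (Fin n → E)) (ModelProd E (Fin n → E)) :=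
  𝓘(ℝ, E).prod 𝓘(ℝ, Fin n → E)

/-- The right trivialization of the `n`-jet of a curve `c`:
`(c(0), (δʳc)(0), (δʳc)'(0), …, (δʳc)^{(n-1)}(0))`. -/
noncomputable def rightTriv (n : ℕ) (c : SmoothCurve E G) : TrivJet E G n :=
  (c 0, fun j => iteratedDeriv j (rightLogDeriv (c : ℝ → G)) 0)

/-- The component `x_i`, `1 ≤ i ≤ n`, of `x = (x_1, …, x_n)`. -/
def jetComp {n : ℕ} (x : Fin n → E) (i : ℕ) : E :=
  if h : 1 ≤ i ∧ i ≤ n then x ⟨i - 1, by omega⟩ else 0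

/-- The projection `(g, x_1, …, x_{k+1}) ↦ (g, x_1, …, x_k)`. -/
def truncate (k : ℕ) (a : TrivJet E G (k + 1)) : TrivJet E G k := (a.1, Fin.init a.2)

variable (G) in
/-- The inclusion `v ↦ (1, 0, …, 0, v)` of `𝔤` into `G × 𝔤^{k+1}`. -/
def topInclusion (k : ℕ) (v : E) : TrivJet E G (k + 1) := (1, Fin.snoc (0 : Fin k → E) v)

/-- The section `(g, x_1, …, x_k) ↦ (g, x_1, …, x_k, 0)`. -/
def zeroSection (k : ℕ) (a : TrivJet E G k) : TrivJet E G (k + 1) :=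
  (a.1, Fin.snoc a.2 (0 : E))

/-! ### The cocycles -/

/-- `ad_{x_{i_{ℓ-1}}} ⋯ ad_{x_{i_1}} Ad_g y_{i_ℓ}` for a list `(i_1, …, i_ℓ)` of block sizes. -/
noncomputable def cocycleTerm {k : ℕ} (a b : TrivJet E G k) (i : List ℕ) : E :=
  i.dropLast.foldl (fun z r => ad G (jetComp a.2 r) z) (Ad E a.1 (jetComp b.2 (i.getLastD 0)))

/-- The group cocycle `c_{k+1}` on `G × 𝔤^k`: the sum over all partitions `λ = λ_1|…|λ_ℓ` of a set
with `k + 1` elements other than the partition into a single block, the blocks being ordered by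
increasing greatest element (that is, anti-lexicographically). -/
noncomputable def groupCocycle (k : ℕ) (a b : TrivJet E G k) : E :=
  ∑ p : OrderedFinpartition (k + 1) with p.length ≠ 1, cocycleTerm a b (List.ofFn p.partSize)

/-- `N_{(i_1, …, i_ℓ)} = ∏_{r=2}^ℓ binom(i_1 + ⋯ + i_r - 1, i_r - 1)`; the factor for `i_r` has
index `r - 1`. -/
def partitionNumber (i : List ℕ) : ℕ :=
  ∏ r ∈ Finset.Ico 1 i.length, ((i.take (r + 1)).sum - 1).choose (i.getD r 0 - 1)

variable (G) in
/-- The action `(ξ, x) · v = [ξ, v]` on `𝔤` of the Lie algebra `𝔤 × 𝔤^k` of `G × 𝔤^k`. -/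
noncomputable def lieAction (k : ℕ) (X : E × (Fin k → E)) (v : E) : E := ad G X.1 v

variable (G) in
/-- The Lie algebra cocycle `σ_{k+1}((ξ, x), (η, y)) = ∑_{i=1}^k binom(k+1, i) [x_i, y_{k+1-i}]` on
the Lie algebra `𝔤 × 𝔤^k` of `G × 𝔤^k`. -/
noncomputable def lieCocycle (k : ℕ) (X Y : E × (Fin k → E)) : E :=
  ∑ i ∈ Finset.Icc 1 k, (k + 1).choose i • ad G (jetComp X.2 i) (jetComp Y.2 (k + 1 - i))

end RightTrivialization

/-! ### Abelian extensions with a prescribed cocycle -/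

/-- The extension `S` of groups `V → A → B`, with `V` a (normed) vector space, is an extension of
Lie groups for which `s` is a smooth section, and the induced action of `B` on `V` and the
`V`-valued `2`-cocycle associated with `s` are `ρ` and `c`. -/
structure IsAbelianLieGroupExtension
    {V : Type*} [NormedAddCommGroup V] [NormedSpace ℝ V]
    {EA : Type*} [NormedAddCommGroup EA] [NormedSpace ℝ EA] {HA : Type*} [TopologicalSpace HA]
    (IA : ModelWithCorners ℝ EA HA)
    {EB : Type*} [NormedAddCommGroup EB] [NormedSpace ℝ EB] {HB : Type*} [TopologicalSpace HB]
    (IB : ModelWithCorners ℝ EB HB)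
    {A : Type*} [TopologicalSpace A] [ChartedSpace HA A] [Group A]
    {B : Type*} [TopologicalSpace B] [ChartedSpace HB B] [Group B]
    (S : GroupExtension (Multiplicative V) A B) (s : B → A)
    (ρ : B → V →L[ℝ] V) (c : B → B → V) : Prop where
  contMDiff_inl : ContMDiff 𝓘(ℝ, V) IA ∞ (fun v : V => S.inl (Multiplicative.ofAdd v))
  contMDiff_rightHom : ContMDiff IA IB ∞ S.rightHom
  contMDiff_section : ContMDiff IB IA ∞ s
  rightHom_section : ∀ b, S.rightHom (s b) = b
  /-- `A` is, through `s`, diffeomorphic to `B × V` over `B`. -/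
  trivialization : ∃ D : (B × V) ≃ₘ^∞⟮IB.prod 𝓘(ℝ, V), IA⟯ A,
    ∀ b v, D (b, v) = S.inl (Multiplicative.ofAdd v) * s b
  /-- `ρ` is a smooth action of the group `B`, induced by conjugation in `A`. -/
  action_one : ∀ v, ρ 1 v = v
  action_mul : ∀ a b v, ρ (a * b) v = ρ a (ρ b v)
  contMDiff_action : ContMDiff (IB.prod 𝓘(ℝ, V)) 𝓘(ℝ, V) ∞ (fun q : B × V => ρ q.1 q.2)
  conj_inl : ∀ (a : A) (v : V), a * S.inl (Multiplicative.ofAdd v) * a⁻¹ =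
    S.inl (Multiplicative.ofAdd (ρ (S.rightHom a) v))
  /-- `c` is a smooth group `2`-cocycle, the factor set of the section `s`. -/
  contMDiff_cocycle : ContMDiff (IB.prod IB) 𝓘(ℝ, V) ∞ (fun q : B × B => c q.1 q.2)
  cocycle : ∀ a b d, c a b + c (a * b) d = ρ a (c b d) + c a (b * d)
  section_mul : ∀ a b, s a * s b = S.inl (Multiplicative.ofAdd (c a b)) * s (a * b)

/-- `N → L → M` is an extension of Lie algebras with abelian `N`, for which `τ` is a linear section,
and the induced action of `M` on `N` and the `N`-valued `2`-cocycle associated with `τ` are `ρ` and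
`σ`. -/
structure IsAbelianLieAlgebraExtension {N L M : Type*}
    [LieRing N] [LieAlgebra ℝ N] [LieRing L] [LieAlgebra ℝ L] [LieRing M] [LieAlgebra ℝ M]
    (ι : N →ₗ⁅ℝ⁆ L) (π : L →ₗ⁅ℝ⁆ M) (τ : M →ₗ[ℝ] L)
    (ρ : M → N → N) (σ : M → M → N) : Prop where
  isLieAbelian : IsLieAbelian N
  isExtension : LieAlgebra.IsExtension ι π
  proj_section : ∀ X, π (τ X) = X
  /-- `ρ` is a representation of `M`, induced by the bracket of `L`. -/
  action_linear : ∀ X, IsLinearMap ℝ (ρ X)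
  linear_action : ∀ v, IsLinearMap ℝ (fun X => ρ X v)
  action_bracket : ∀ X Y v, ρ ⁅X, Y⁆ v = ρ X (ρ Y v) - ρ Y (ρ X v)
  bracket_incl : ∀ X v, ⁅τ X, ι v⁆ = ι (ρ X v)
  /-- `σ` is a Lie algebra `2`-cocycle, the one given by the section `τ`. -/
  cocycle_linear_right : ∀ X, IsLinearMap ℝ (σ X)
  cocycle_linear_left : ∀ Y, IsLinearMap ℝ (fun X => σ X Y)
  cocycle_self : ∀ X, σ X X = 0
  cocycle : ∀ X Y Z, ρ X (σ Y Z) + ρ Y (σ Z X) + ρ Z (σ X Y) =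
    σ ⁅X, Y⁆ Z + σ ⁅Y, Z⁆ X + σ ⁅Z, X⁆ Y
  bracket_section : ∀ X Y, ⁅τ X, τ Y⁆ = τ ⁅X, Y⁆ + ι (σ X Y)

/-- A smooth real Lie group is smooth enough to have a Lie algebra. -/
instance leInfty_minSmoothness_three : ENat.LEInfty (minSmoothness ℝ 3) :=
  ⟨by rw [minSmoothness_of_isRCLikeNormedField]; exact ENat.LEInfty.out⟩

section PartitionCount

theorem List.modify_append_of_lt {α : Type*} (f : α → α) {l l' : List α} {r : ℕ}
    (hr : r < l.length) : (l ++ l').modify r f = l.modify r f ++ l' := by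
  induction l generalizing r with
  | nil => simp at hr
  | cons a l ih => cases r with
    | zero => simp
    | succ r => simpa using ih (by simpa using hr)

theorem List.modify_concat_length {α : Type*} (f : α → α) (l : List α) (a : α) :
    (l ++ [a]).modify l.length f = l ++ [f a] := by
  induction l with
  | nil => simp
  | cons b l ih => simpa using ih

theorem List.sum_modify_pred {l : List ℕ} {r : ℕ} (hr : 1 ≤ l.getD r 0) :
    (l.modify r Nat.pred).sum + 1 = l.sum := by
  induction l generalizing r with
  | nil => simp at hr
  | cons a l ih => cases r with
    | zero => simp at hr ⊢; omega
    | succ r => have := ih (r := r) (by simpa using hr); simp; omega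

theorem partitionNumber_nil : partitionNumber [] = 1 := by simp [partitionNumber]

theorem partitionNumber_concat (l : List ℕ) (j : ℕ) :
    partitionNumber (l ++ [j]) = (l.sum + j - 1).choose (j - 1) * partitionNumber l := by
  rcases Nat.eq_zero_or_pos l.length with h | h
  · obtain rfl := List.length_eq_zero_iff.1 h
    simp [partitionNumber]
  · unfold partitionNumber
    rw [List.length_append, List.length_singleton, Finset.prod_Ico_succ_top (by omega), mul_comm]
    congr 1
    · simp [List.take_of_length_le]
    · refine Finset.prod_congr rfl fun r hr => ?_
      rw [Finset.mem_Ico] at hr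
      rw [List.take_append_of_le_length (by omega), List.getD_append _ _ _ _ hr.2]

/-- The partitions of `{0, …, n}` with given block sizes are obtained by adding `0` to a partition
of `{1, …, n}`, either as a new block or to an old block. -/
theorem partitionNumber_eq_add {l : List ℕ} (hl : l ≠ []) (hpos : ∀ i ∈ l, 0 < i) :
    partitionNumber l = (if l.head hl = 1 then partitionNumber l.tail else 0) +
      ∑ r ∈ Finset.range l.length,
        if 2 ≤ l.getD r 0 then partitionNumber (l.modify r Nat.pred) else 0 := by
  induction l using List.reverseRecOn with
  | nil => exact absurd rfl hl
  | append_singleton l j ih =>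
    have hj : 0 < j := hpos j (by simp)
    rcases eq_or_ne l [] with rfl | hl'
    · rcases Nat.lt_or_ge 1 j with h | h
      · have h1 : j ≠ 1 := by omega
        have h2 : 2 ≤ j := h
        have : partitionNumber [j] = 1 := by simp [partitionNumber]
        have : partitionNumber [j - 1] = 1 := by simp [partitionNumber]
        simp [*]
      · obtain rfl : j = 1 := by omega
        simp [partitionNumber]
    · have ih := ih hl' fun i hi => hpos i (by simp [hi])
      have hsum : 0 < l.sum := by
        obtain ⟨a, l', rfl⟩ := List.exists_cons_of_ne_nil hl'
        have := hpos a (by simp)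
        simp; omega
      have key : (l.sum + j - 1).choose (j - 1) = (l.sum + j - 2).choose (j - 1) +
          if 2 ≤ j then (l.sum + j - 2).choose (j - 2) else 0 := by
        split_ifs with h
        · obtain ⟨i, rfl⟩ := Nat.exists_eq_add_of_le h
          rw [show l.sum + (2 + i) - 1 = (l.sum + i) + 1 by omega,
            show 2 + i - 1 = i + 1 by omega, show l.sum + (2 + i) - 2 = l.sum + i by omega,
            show 2 + i - 2 = i by omega, Nat.choose_succ_succ, add_comm]
        · obtain rfl : j = 1 := by omega
          simp
      rw [partitionNumber_concat, key, add_mul, List.length_append, List.length_singleton,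
        Finset.sum_range_succ, ← add_assoc]
      congr 1
      · rw [ih, mul_add, Finset.mul_sum]
        congr 1
        · rw [List.head_append_of_ne_nil hl', List.tail_append_of_ne_nil hl']
          split_ifs with h
          · rw [partitionNumber_concat]
            congr 2
            obtain ⟨a, l', rfl⟩ := List.exists_cons_of_ne_nil hl'
            simp only [List.head_cons] at h
            simp [h]; omega
          · simp
        · refine Finset.sum_congr rfl fun r hr => ?_
          rw [Finset.mem_range] at hr
          rw [List.getD_append _ _ _ _ hr]
          split_ifs with h
          · rw [List.modify_append_of_lt _ hr]
            rw [partitionNumber_concat]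
            have := List.sum_modify_pred (l := l) (r := r) (by omega)
            congr 2
            omega
          · simp
      · rw [List.getD_append_right _ _ _ _ le_rfl]
        simp only [Nat.sub_self, List.getD_cons_zero]
        split_ifs with h
        · rw [List.modify_concat_length]
          rw [partitionNumber_concat]
          simp only [Nat.pred_eq_sub_one]
          congr 2
          omega
        · simp

theorem sum_orderedFinpartition_succ {M : Type*} [AddCommMonoid M] (n : ℕ) (f : List ℕ → M) :
    ∑ p : OrderedFinpartition (n + 1), f (List.ofFn p.partSize) =
      ∑ p : OrderedFinpartition n, (f (1 :: List.ofFn p.partSize) +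
        ∑ r ∈ Finset.range (List.ofFn p.partSize).length,
          f ((List.ofFn p.partSize).modify r Nat.succ)) := by
  rw [← (OrderedFinpartition.extendEquiv n).sum_comp, Fintype.sum_sigma]
  refine Finset.sum_congr rfl fun p _ => ?_
  rw [Fintype.sum_option, List.length_ofFn, Finset.sum_range]
  congr 1
  · exact congrArg f (List.ofFn_cons 1 p.partSize)
  · refine Finset.sum_congr rfl fun r _ => congrArg f ?_
    change List.ofFn (Function.update p.partSize r (p.partSize r + 1)) = _
    refine List.ext_getElem (by simp) fun i h1 h2 => ?_
    simp only [List.getElem_ofFn, List.getElem_modify, Function.update_apply, Fin.ext_iff]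
    split_ifs with h h' h'
    · subst h; rfl
    · omega
    · omega
    · rfl

theorem List.modify_succ_eq_iff {m l : List ℕ} {r : ℕ} (hr : r < l.length) :
    m.modify r Nat.succ = l ↔ 1 ≤ l.getD r 0 ∧ m = l.modify r Nat.pred := by
  induction l generalizing m r with
  | nil => simp at hr
  | cons b l ih =>
    rcases m with _ | ⟨a, m⟩
    · cases r <;> simp
    cases r with
    | zero => simp; grind
    | succ r => simp [ih (m := m) (r := r) (by simpa using hr)]; tauto

theorem List.sum_range_modify_succ_eq (m l : List ℕ) :
    ∑ r ∈ Finset.range m.length, (if m.modify r Nat.succ = l then (1 : ℕ) else 0) =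
      ∑ r ∈ Finset.range l.length,
        if 1 ≤ l.getD r 0 ∧ m = l.modify r Nat.pred then (1 : ℕ) else 0 := by
  by_cases h : m.length = l.length
  · rw [h]
    refine Finset.sum_congr rfl fun r hr => ?_
    exact if_congr (List.modify_succ_eq_iff (Finset.mem_range.1 hr)) rfl rfl
  · rw [Finset.sum_eq_zero fun r _ => if_neg ?_, Finset.sum_eq_zero fun r _ => if_neg ?_]
    · rintro ⟨-, h'⟩
      exact h (by simp [h'])
    · intro h'
      exact h (by simp [← h'])

theorem List.forall_mem_modify_pred_pos {l : List ℕ} {r : ℕ} (hr : 1 ≤ l.getD r 0) :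
    (∀ i ∈ l.modify r Nat.pred, 0 < i) ↔ (∀ i ∈ l, 0 < i) ∧ 2 ≤ l.getD r 0 := by
  induction l generalizing r with
  | nil => simp at hr
  | cons a l ih => cases r with
    | zero => simp at hr ⊢; constructor <;> rintro ⟨h1, h2⟩ <;> refine ⟨?_, ?_⟩ <;> grind
    | succ r => simp [ih (r := r) (by simpa using hr)]; tauto

theorem card_orderedFinpartition_ofFn_eq (n : ℕ) (l : List ℕ) :
    Finset.card {p : OrderedFinpartition n | List.ofFn p.partSize = l} =
      if (∀ i ∈ l, 0 < i) ∧ l.sum = n then partitionNumber l else 0 := by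
  induction n generalizing l with
  | zero =>
    rw [Finset.card_filter, Fintype.sum_unique]
    have h0 : List.ofFn (default : OrderedFinpartition 0).partSize = [] := rfl
    rw [h0]
    rcases l with _ | ⟨a, l⟩
    · simp [partitionNumber_nil]
    · rw [if_neg (by simp), if_neg]
      rintro ⟨h1, h2⟩
      have := h1 a (by simp)
      simp at h2
      omega
  | succ n ih =>
    rw [Finset.card_filter,
      sum_orderedFinpartition_succ n (fun l' => if l' = l then (1 : ℕ) else 0),
      Finset.sum_add_distrib]
    by_cases hl : l = []
    · subst hl
      simp [List.ofFn_eq_nil_iff]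
    have e1 : ∑ p : OrderedFinpartition n, (if 1 :: List.ofFn p.partSize = l then (1 : ℕ) else 0) =
        if l.head hl = 1 then
          (if (∀ i ∈ l.tail, 0 < i) ∧ l.tail.sum = n then partitionNumber l.tail else 0)
            else 0 := by
      obtain ⟨a, l, rfl⟩ := List.exists_cons_of_ne_nil hl
      rw [← ih, Finset.card_filter]
      simp only [List.cons.injEq, List.head_cons, List.tail_cons]
      by_cases h : a = 1
      · subst h
        simp only [true_and, if_true]
        rfl
      · simp [h, Ne.symm h]
    have e2 : ∑ p : OrderedFinpartition n, ∑ r ∈ Finset.range (List.ofFn p.partSize).length,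
          (if (List.ofFn p.partSize).modify r Nat.succ = l then (1 : ℕ) else 0) =
        ∑ r ∈ Finset.range l.length, if 1 ≤ l.getD r 0 then
          (if (∀ i ∈ l.modify r Nat.pred, 0 < i) ∧ (l.modify r Nat.pred).sum = n then
            partitionNumber (l.modify r Nat.pred) else 0) else 0 := by
      simp only [← ih, Finset.card_filter, List.sum_range_modify_succ_eq]
      rw [Finset.sum_comm]
      refine Finset.sum_congr rfl fun r _ => ?_
      by_cases h : 1 ≤ l.getD r 0
      · simp only [h, true_and, if_true]
      · simp only [h, false_and, if_false, Finset.sum_const_zero]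
    have t1 : (l.head hl = 1 ∧ (∀ i ∈ l.tail, 0 < i) ∧ l.tail.sum = n) ↔
        ((∀ i ∈ l, 0 < i) ∧ l.sum = n + 1) ∧ l.head hl = 1 := by
      obtain ⟨a, l, rfl⟩ := List.exists_cons_of_ne_nil hl
      simp only [List.head_cons, List.tail_cons, List.mem_cons, forall_eq_or_imp, List.sum_cons]
      constructor
      · rintro ⟨rfl, h, h'⟩
        exact ⟨⟨⟨one_pos, h⟩, by omega⟩, rfl⟩
      · rintro ⟨⟨⟨-, h⟩, h'⟩, rfl⟩
        exact ⟨rfl, h, by omega⟩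
    have t2 : ∀ r, (1 ≤ l.getD r 0 ∧
        (∀ i ∈ l.modify r Nat.pred, 0 < i) ∧ (l.modify r Nat.pred).sum = n) ↔
        ((∀ i ∈ l, 0 < i) ∧ l.sum = n + 1) ∧ 2 ≤ l.getD r 0 := by
      intro r
      constructor
      · rintro ⟨h, h1, h2⟩
        rw [List.forall_mem_modify_pred_pos h] at h1
        have := List.sum_modify_pred h
        exact ⟨⟨h1.1, by omega⟩, h1.2⟩
      · rintro ⟨⟨h1, h2⟩, h⟩
        have h' : 1 ≤ l.getD r 0 := by omega
        have := List.sum_modify_pred h'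
        exact ⟨h', (List.forall_mem_modify_pred_pos h').2 ⟨h1, h⟩, by omega⟩
    simp only [← ite_and] at e1 e2
    rw [e1, e2]
    simp only [t1, t2]
    by_cases H : (∀ i ∈ l, 0 < i) ∧ l.sum = n + 1
    · rw [if_pos H, partitionNumber_eq_add hl H.1]
      congr 1
      · exact if_congr (and_iff_right H) rfl rfl
      · exact Finset.sum_congr rfl fun r _ => if_congr (and_iff_right H) rfl rfl
    · rw [if_neg H, if_neg fun h => H h.1, zero_add]
      exact Finset.sum_eq_zero fun r _ => if_neg fun h => H h.1

theorem OrderedFinpartition.sum_partSize {n : ℕ} (p : OrderedFinpartition n) :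
    ∑ i, p.partSize i = n := by
  simpa using Fintype.card_congr p.equivSigma

theorem sum_orderedFinpartition {M : Type*} [AddCommMonoid M] (n : ℕ) (f : List ℕ → M) :
    ∑ p : OrderedFinpartition n, f (List.ofFn p.partSize) =
      ∑ c : Composition n, partitionNumber c.blocks • f c.blocks := by
  let φ : OrderedFinpartition n → Composition n := fun p =>
    ⟨List.ofFn p.partSize, by simpa using fun a => p.partSize_pos a,
      by rw [List.sum_ofFn, p.sum_partSize]⟩
  rw [← Finset.sum_fiberwise (s := Finset.univ) (g := φ)]
  refine Finset.sum_congr rfl fun c _ => ?_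
  rw [← (if_pos ⟨fun i hi => c.blocks_pos hi, c.blocks_sum⟩ :
    (if (∀ i ∈ c.blocks, 0 < i) ∧ c.blocks.sum = n then partitionNumber c.blocks else 0) = _),
    ← card_orderedFinpartition_ofFn_eq, ← Finset.sum_const]
  have : ∀ p : OrderedFinpartition n, φ p = c ↔ List.ofFn p.partSize = c.blocks := fun p => by
    rw [Composition.ext_iff]
  simp only [this]
  refine Finset.sum_congr rfl fun p hp => ?_
  rw [(Finset.mem_filter.1 hp).2]

end PartitionCount

section Derivation

open VectorField Set Filter Topology

variable {E : Type*} [NormedAddCommGroup E] [NormedSpace ℝ E]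
  {H : Type*} [TopologicalSpace H] (I : ModelWithCorners ℝ E H)
  {M : Type*} [TopologicalSpace M] [ChartedSpace H M]
  {E' : Type*} [NormedAddCommGroup E'] [NormedSpace ℝ E']
  {H' : Type*} [TopologicalSpace H'] (I' : ModelWithCorners ℝ E' H')
  {M' : Type*} [TopologicalSpace M'] [ChartedSpace H' M']
  {E'' : Type*} [NormedAddCommGroup E''] [NormedSpace ℝ E'']
  {H'' : Type*} [TopologicalSpace H''] (I'' : ModelWithCorners ℝ E'' H'')
  {M'' : Type*} [TopologicalSpace M''] [ChartedSpace H'' M'']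
  {F : Type*} [NormedAddCommGroup F] [NormedSpace ℝ F]

/-- The derivative of a map between manifolds, as a map between the model vector spaces. -/
noncomputable def tderiv (f : M → M') (x : M) : E →L[ℝ] E' := mfderiv I I' f x

variable {I I' I''}

theorem tderiv_comp {g : M' → M''} {f : M → M'} {x : M} (hg : MDifferentiableAt I' I'' g (f x))
    (hf : MDifferentiableAt I I' f x) :
    tderiv I I'' (g ∘ f) x = (tderiv I' I'' g (f x)).comp (tderiv I I' f x) :=
  mfderiv_comp x hg hf

theorem tderiv_comp_apply {g : M' → M''} {f : M → M'} {x : M}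
    (hg : MDifferentiableAt I' I'' g (f x)) (hf : MDifferentiableAt I I' f x) (v : E) :
    tderiv I I'' (g ∘ f) x v = tderiv I' I'' g (f x) (tderiv I I' f x v) := by
  rw [tderiv_comp hg hf]; rfl

theorem tderiv_comp_of_eq {g : M' → M''} {f : M → M'} {x : M} {y : M'}
    (hg : MDifferentiableAt I' I'' g y) (hf : MDifferentiableAt I I' f x) (hy : f x = y) :
    tderiv I I'' (g ∘ f) x = (tderiv I' I'' g y).comp (tderiv I I' f x) := by
  subst hy; exact tderiv_comp hg hf

theorem Filter.EventuallyEq.tderiv_eq {f f₁ : M → M'} {x : M} (h : f₁ =ᶠ[𝓝 x] f) :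
    tderiv I I' f₁ x = tderiv I I' f x := h.mfderiv_eq

theorem tderiv_eq_fderiv (f : E → F) (x : E) : tderiv 𝓘(ℝ, E) 𝓘(ℝ, F) f x = fderiv ℝ f x :=
  mfderiv_eq_fderiv

theorem tderiv_id (x : M) : tderiv I I id x = ContinuousLinearMap.id ℝ E := mfderiv_id

theorem tderiv_const (c : M') (x : M) : tderiv I I' (fun _ => c) x = 0 := mfderiv_const

theorem tderiv_extChartAt_self [IsManifold I 1 M] (x : M) :
    tderiv I 𝓘(ℝ, E) (extChartAt I x) x = ContinuousLinearMap.id ℝ E := mfderiv_extChartAt_self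

theorem eventuallyEq_comp_symm_comp_extChartAt {X : Type*} (g : M → X) (x : M) :
    g =ᶠ[𝓝 x] (g ∘ (extChartAt I x).symm) ∘ extChartAt I x := by
  filter_upwards [extChartAt_source_mem_nhds (I := I) x] with y hy
  simp only [Function.comp_apply, (extChartAt I x).left_inv hy]

variable [I.Boundaryless]

theorem mdifferentiableAt_extChartAt_symm [IsManifold I 1 M] {x : M} {u : E}
    (hu : u ∈ (extChartAt I x).target) :
    MDifferentiableAt 𝓘(ℝ, E) I (extChartAt I x).symm u := by
  have := mdifferentiableWithinAt_extChartAt_symm (I := I) hu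
  rwa [I.range_eq_univ, mdifferentiableWithinAt_univ] at this

theorem isInvertible_mfderiv_extChartAt_symm [IsManifold I 1 M] {x : M} {u : E}
    (hu : u ∈ (extChartAt I x).target) :
    (tderiv 𝓘(ℝ, E) I (extChartAt I x).symm u).IsInvertible := by
  have := isInvertible_mfderivWithin_extChartAt_symm (I := I) hu
  rwa [I.range_eq_univ, mfderivWithin_univ] at this

theorem tderiv_extChartAt_symm_self [IsManifold I 1 M] (x : M) :
    tderiv 𝓘(ℝ, E) I (extChartAt I x).symm (extChartAt I x x) = ContinuousLinearMap.id ℝ E := by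
  have := mfderivWithin_range_extChartAt_symm (I := I) (x := x)
  rwa [I.range_eq_univ, mfderivWithin_univ] at this

theorem tderiv_eq_fderiv_comp_extChartAt_symm [IsManifold I 1 M] {f : M → F} {x : M}
    (hf : MDifferentiableAt I 𝓘(ℝ, F) f x) :
    tderiv I 𝓘(ℝ, F) f x = fderiv ℝ (f ∘ (extChartAt I x).symm) (extChartAt I x x) := by
  rw [← tderiv_eq_fderiv, tderiv_comp_of_eq hf
    (mdifferentiableAt_extChartAt_symm (mem_extChartAt_target x)) (extChartAt_to_inv x),
    tderiv_extChartAt_symm_self, ContinuousLinearMap.comp_id]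

theorem contMDiffAt_comp_extChartAt_symm [IsManifold I ∞ M] {f : M → F} {x : M}
    (hf : ContMDiffAt I 𝓘(ℝ, F) ∞ f x) :
    ContDiffAt ℝ ∞ (f ∘ (extChartAt I x).symm) (extChartAt I x x) := by
  refine ContMDiffAt.contDiffAt ?_
  refine ContMDiffAt.comp_of_eq hf ?_ (extChartAt_to_inv x)
  exact (contMDiffOn_extChartAt_symm x).contMDiffAt (extChartAt_target_mem_nhds x)

variable (I) in
/-- A vector field read in the chart at `x`. -/
noncomputable def chartField (x : M) (V : Π x : M, TangentSpace I x) (u : E) : E :=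
  (tderiv 𝓘(ℝ, E) I (extChartAt I x).symm u).inverse (V ((extChartAt I x).symm u))

theorem chartField_eq_mpullbackWithin (x : M) (V : Π x : M, TangentSpace I x) :
    chartField I x V = mpullbackWithin 𝓘(ℝ, E) I (extChartAt I x).symm V (range I) := by
  rw [I.range_eq_univ, mpullbackWithin_univ]
  rfl

theorem mlieBracket_eq_lieBracket_chartField [IsManifold I 1 M]
    (V W : Π x : M, TangentSpace I x) (x : M) :
    mlieBracket I V W x =
      lieBracket ℝ (chartField I x V) (chartField I x W) (extChartAt I x x) := by
  have h : (tderiv I 𝓘(ℝ, E) (extChartAt I x) x).inverse = ContinuousLinearMap.id ℝ E := by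
    rw [tderiv_extChartAt_self, ContinuousLinearMap.inverse_id]
  have h1 : mlieBracket I V W x = (tderiv I 𝓘(ℝ, E) (extChartAt I x) x).inverse
      (lieBracketWithin ℝ (mpullbackWithin 𝓘(ℝ, E) I (extChartAt I x).symm V (range I) : E → E)
      (mpullbackWithin 𝓘(ℝ, E) I (extChartAt I x).symm W (range I) : E → E)
      ((extChartAt I x).symm ⁻¹' univ ∩ range I) (extChartAt I x x)) := rfl
  rw [h1, h, preimage_univ, univ_inter, ← chartField_eq_mpullbackWithin,
    ← chartField_eq_mpullbackWithin, I.range_eq_univ, lieBracketWithin_univ]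
  rfl

theorem differentiableAt_chartField [CompleteSpace E] [IsManifold I 2 M]
    {V : Π x : M, TangentSpace I x} {x : M}
    (hV : MDifferentiableAt I I.tangent (fun y => (⟨y, V y⟩ : TangentBundle I M)) x) :
    DifferentiableAt ℝ (chartField I x V) (extChartAt I x x) := by
  have : DifferentiableWithinAt ℝ
      (mpullbackWithin 𝓘(ℝ, E) I (extChartAt I x).symm V (range I) : E → E)
      ((extChartAt I x).symm ⁻¹' univ ∩ range I) (extChartAt I x x) :=
    MDifferentiableWithinAt.differentiableWithinAt_mpullbackWithin_vectorField
      (V := V) (s := univ) (x := x) (I := I) hV.mdifferentiableWithinAt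
  rwa [preimage_univ, univ_inter, ← chartField_eq_mpullbackWithin, I.range_eq_univ,
    differentiableWithinAt_univ] at this

theorem eventually_tderiv_apply_eq [IsManifold I ∞ M] {f : M → F} {x : M}
    (hf : ContMDiffAt I 𝓘(ℝ, F) ∞ f x) (V : Π x : M, TangentSpace I x) :
    (fun y => tderiv I 𝓘(ℝ, F) f y (V y)) ∘ (extChartAt I x).symm =ᶠ[𝓝 (extChartAt I x x)]
      fun u => fderiv ℝ (f ∘ (extChartAt I x).symm) u
        (chartField I x V u) := by
  have h1 : ∀ᶠ y in 𝓝 x, MDifferentiableAt I 𝓘(ℝ, F) f y :=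
    ((contMDiffAt_iff_contMDiffAt_nhds (n := 1) (by simp)).1 (hf.of_le ENat.LEInfty.out)).mono
      fun y hy => hy.mdifferentiableAt one_ne_zero
  have h2 : Tendsto (extChartAt I x).symm (𝓝 (extChartAt I x x)) (𝓝 x) := by
    simpa [ContinuousAt] using continuousAt_extChartAt_symm (I := I) x
  filter_upwards [extChartAt_target_mem_nhds (I := I) x, h2.eventually h1] with u hu hfu
  rw [← tderiv_eq_fderiv, tderiv_comp hfu (mdifferentiableAt_extChartAt_symm hu)]
  unfold chartField
  obtain ⟨A, hA⟩ := isInvertible_mfderiv_extChartAt_symm (I := I) hu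
  rw [← hA, ContinuousLinearMap.inverse_equiv]
  exact congrArg (tderiv I 𝓘(ℝ, F) f _) (A.apply_symm_apply _).symm

theorem differentiableAt_fderiv_chartField [CompleteSpace E] [IsManifold I ∞ M] {f : M → F} {x : M}
    (hf : ContMDiffAt I 𝓘(ℝ, F) ∞ f x) {V : Π x : M, TangentSpace I x}
    (hV : MDifferentiableAt I I.tangent (fun y => (⟨y, V y⟩ : TangentBundle I M)) x) :
    DifferentiableAt ℝ (fun u => fderiv ℝ (f ∘ (extChartAt I x).symm) u (chartField I x V u))
      (extChartAt I x x) := by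
  have : IsManifold I 2 M := IsManifold.of_le (n := ∞) ENat.LEInfty.out
  refine DifferentiableAt.clm_apply ?_ (differentiableAt_chartField hV)
  exact ((contMDiffAt_comp_extChartAt_symm hf).fderiv_right (m := 1)
    (by rw [one_add_one_eq_two]; exact ENat.LEInfty.out)).differentiableAt one_ne_zero

theorem mdifferentiableAt_tderiv_apply [CompleteSpace E] [IsManifold I ∞ M] {f : M → F} {x : M}
    (hf : ContMDiffAt I 𝓘(ℝ, F) ∞ f x) {V : Π x : M, TangentSpace I x}
    (hV : MDifferentiableAt I I.tangent (fun y => (⟨y, V y⟩ : TangentBundle I M)) x) :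
    MDifferentiableAt I 𝓘(ℝ, F) (fun y => tderiv I 𝓘(ℝ, F) f y (V y)) x := by
  refine MDifferentiableAt.congr_of_eventuallyEq ?_
    (eventuallyEq_comp_symm_comp_extChartAt (I := I) _ x)
  refine MDifferentiableAt.comp x (I' := 𝓘(ℝ, E)) ?_
    (mdifferentiableAt_extChartAt (mem_chart_source H x))
  exact (differentiableAt_fderiv_chartField hf hV).mdifferentiableAt.congr_of_eventuallyEq
    (eventually_tderiv_apply_eq hf V)

theorem tderiv_tderiv_apply_eq [CompleteSpace E] [IsManifold I ∞ M] {f : M → F} {x : M}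
    (hf : ContMDiffAt I 𝓘(ℝ, F) ∞ f x) {V : Π x : M, TangentSpace I x}
    (hV : MDifferentiableAt I I.tangent (fun y => (⟨y, V y⟩ : TangentBundle I M)) x) :
    tderiv I 𝓘(ℝ, F) (fun y => tderiv I 𝓘(ℝ, F) f y (V y)) x =
      fderiv ℝ (fun u => fderiv ℝ (f ∘ (extChartAt I x).symm) u (chartField I x V u))
        (extChartAt I x x) := by
  rw [tderiv_eq_fderiv_comp_extChartAt_symm (mdifferentiableAt_tderiv_apply hf hV)]
  exact (eventually_tderiv_apply_eq hf V).fderiv_eq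

/-- The derivative of a function along a Lie bracket is the commutator of its derivatives. -/
theorem tderiv_mlieBracket [CompleteSpace E] [IsManifold I ∞ M] {f : M → F} {x : M}
    (hf : ContMDiffAt I 𝓘(ℝ, F) ∞ f x) {V W : Π x : M, TangentSpace I x}
    (hV : MDifferentiableAt I I.tangent (fun y => (⟨y, V y⟩ : TangentBundle I M)) x)
    (hW : MDifferentiableAt I I.tangent (fun y => (⟨y, W y⟩ : TangentBundle I M)) x) :
    tderiv I 𝓘(ℝ, F) f x (mlieBracket I V W x) =
      tderiv I 𝓘(ℝ, F) (fun y => tderiv I 𝓘(ℝ, F) f y (W y)) x (V x) -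
      tderiv I 𝓘(ℝ, F) (fun y => tderiv I 𝓘(ℝ, F) f y (V y)) x (W x) := by
  have : IsManifold I 2 M := IsManifold.of_le (n := ∞) ENat.LEInfty.out
  have h0 : ∀ V : Π x : M, TangentSpace I x,
      chartField I x V (extChartAt I x x) = V x := by
    intro V
    change (tderiv 𝓘(ℝ, E) I (extChartAt I x).symm (extChartAt I x x)).inverse
      (V ((extChartAt I x).symm (extChartAt I x x)) : E) = V x
    rw [tderiv_extChartAt_symm_self, ContinuousLinearMap.inverse_id]
    have : ∀ y, y = x → (V y : E) = V x := fun y hy => by subst hy; rfl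
    exact this _ (extChartAt_to_inv x)
  rw [tderiv_tderiv_apply_eq hf hV, tderiv_tderiv_apply_eq hf hW,
    mlieBracket_eq_lieBracket_chartField,
    tderiv_eq_fderiv_comp_extChartAt_symm (hf.mdifferentiableAt (by simp))]
  have := fderiv_apply_lieBracket (contMDiffAt_comp_extChartAt_symm hf)
    (by rw [minSmoothness_of_isRCLikeNormedField]; exact ENat.LEInfty.out)
    (differentiableAt_chartField hW) (differentiableAt_chartField hV)
  refine this.trans ?_
  rw [h0, h0]

end Derivation

section SmoothDerivative

open Set Filter Topology

variable {E : Type*} [NormedAddCommGroup E] [NormedSpace ℝ E]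
  {H : Type*} [TopologicalSpace H] {I : ModelWithCorners ℝ E H}
  {M : Type*} [TopologicalSpace M] [ChartedSpace H M] [IsManifold I ∞ M]
  {E' : Type*} [NormedAddCommGroup E'] [NormedSpace ℝ E']
  {H' : Type*} [TopologicalSpace H'] {I' : ModelWithCorners ℝ E' H'}
  {M' : Type*} [TopologicalSpace M'] [ChartedSpace H' M'] [IsManifold I' ∞ M']
  {EN : Type*} [NormedAddCommGroup EN] [NormedSpace ℝ EN]
  {HN : Type*} [TopologicalSpace HN] {J : ModelWithCorners ℝ EN HN}
  {N : Type*} [TopologicalSpace N] [ChartedSpace HN N] [IsManifold J ∞ N]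

theorem tderiv_extChartAt_of_eq {x y : M} (h : y = x) :
    tderiv I 𝓘(ℝ, E) (extChartAt I x) y = ContinuousLinearMap.id ℝ E := by
  subst h
  have : IsManifold I 1 M := IsManifold.of_le (n := ∞) ENat.LEInfty.out
  exact tderiv_extChartAt_self _

variable [I.Boundaryless]

/-- Smooth dependence of a derivative on parameters, at points where the preferred charts have the
identity as derivative. -/
theorem contMDiffAt_tderiv {f : N → M → M'} {g : N → M} {x₀ : N}
    (hf : ContMDiffAt (J.prod I) I' ∞ (Function.uncurry f) (x₀, g x₀)) (hg : ContMDiffAt J I ∞ g x₀)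
    (h1 : ∀ᶠ x in 𝓝 x₀, tderiv 𝓘(ℝ, E) I (extChartAt I (g x₀)).symm (extChartAt I (g x₀) (g x)) =
      ContinuousLinearMap.id ℝ E)
    (h2 : ∀ᶠ x in 𝓝 x₀, tderiv I' 𝓘(ℝ, E') (extChartAt I' (f x₀ (g x₀))) (f x (g x)) =
      ContinuousLinearMap.id ℝ E') :
    ContMDiffAt J 𝓘(ℝ, E →L[ℝ] E') ∞ (fun x => tderiv I I' (f x) (g x)) x₀ := by
  have : IsManifold I 1 M := IsManifold.of_le (n := ∞) ENat.LEInfty.out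
  have : IsManifold I' 1 M' := IsManifold.of_le (n := ∞) ENat.LEInfty.out
  have key := ContMDiffAt.mfderiv (m := ∞) f g hf hg (by simp)
  refine key.congr_of_eventuallyEq ?_
  have hs : ∀ᶠ x in 𝓝 x₀, g x ∈ (chartAt H (g x₀)).source :=
    hg.continuousAt.eventually_mem ((chartAt H (g x₀)).open_source.mem_nhds (mem_chart_source H _))
  have hfg : ContinuousAt (fun x => f x (g x)) x₀ :=
    ContinuousAt.comp_of_eq (f := fun x => (x, g x)) (x := x₀) hf.continuousAt
      (continuousAt_id.prodMk hg.continuousAt) rfl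
  have ht : ∀ᶠ x in 𝓝 x₀, f x (g x) ∈ (chartAt H' (f x₀ (g x₀))).source :=
    hfg.eventually_mem ((chartAt H' _).open_source.mem_nhds (mem_chart_source H' _))
  filter_upwards [h1, h2, hs, ht] with x h1 h2 hs ht
  rw [inTangentCoordinates_eq_mfderiv_comp hs ht, I.range_eq_univ, mfderivWithin_univ]
  change _ = (tderiv I' 𝓘(ℝ, E') (extChartAt I' (f x₀ (g x₀))) (f x (g x))).comp
    ((tderiv I I' (f x) (g x)).comp (tderiv 𝓘(ℝ, E) I _ _))
  rw [h1, h2]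
  rfl

theorem tderiv_extChartAt_symm_of_eq {x y : M} (h : y = x) :
    tderiv 𝓘(ℝ, E) I (extChartAt I x).symm (extChartAt I x y) = ContinuousLinearMap.id ℝ E := by
  subst h
  have : IsManifold I 1 M := IsManifold.of_le (n := ∞) ENat.LEInfty.out
  exact tderiv_extChartAt_symm_self _

theorem tderiv_extChartAt_model (x y : E) :
    tderiv 𝓘(ℝ, E) 𝓘(ℝ, E) (extChartAt 𝓘(ℝ, E) x) y = ContinuousLinearMap.id ℝ E := by
  rw [extChartAt_model_space_eq_id]
  exact tderiv_id y

theorem tderiv_extChartAt_symm_model (x y : E) :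
    tderiv 𝓘(ℝ, E) 𝓘(ℝ, E) (extChartAt 𝓘(ℝ, E) x).symm y = ContinuousLinearMap.id ℝ E := by
  rw [extChartAt_model_space_eq_id]
  exact tderiv_id y

theorem fderiv_fderiv_partial_comm {F : Type*} [NormedAddCommGroup F] [NormedSpace ℝ F]
    {m : E × E' → F} {e : E} {e' : E'} (hm : ContDiffAt ℝ 2 m (e, e')) (X : E') (Y : E) :
    fderiv ℝ (fun v => fderiv ℝ (fun u => m (u, v)) e Y) e' X =
      fderiv ℝ (fun u => fderiv ℝ (fun v => m (u, v)) e' X) e Y := by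
  have hd : ∀ᶠ p in 𝓝 (e, e'), DifferentiableAt ℝ m p :=
    ((contMDiffAt_iff_contMDiffAt_nhds (n := 1) (by simp)).1
      (hm.of_le one_le_two).contMDiffAt).mono fun p hp => hp.contDiffAt.differentiableAt one_ne_zero
  have h1 : (fun v => fderiv ℝ (fun u => m (u, v)) e Y) =ᶠ[𝓝 e'] fun v =>
      fderiv ℝ m (e, v) (Y, 0) := by
    have : Tendsto (fun v => (e, v)) (𝓝 e') (𝓝 (e, e')) :=
      (continuous_const.prodMk continuous_id).tendsto e'
    filter_upwards [this.eventually hd] with v hv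
    have := HasFDerivAt.comp (f := fun u => (u, v)) e hv.hasFDerivAt (hasFDerivAt_prodMk_left e v)
    rw [show fderiv ℝ (fun u => m (u, v)) e = _ from this.fderiv]
    simp
  have h2 : (fun u => fderiv ℝ (fun v => m (u, v)) e' X) =ᶠ[𝓝 e] fun u =>
      fderiv ℝ m (u, e') (0, X) := by
    have : Tendsto (fun u => (u, e')) (𝓝 e) (𝓝 (e, e')) :=
      (continuous_id.prodMk continuous_const).tendsto e
    filter_upwards [this.eventually hd] with u hu
    have := HasFDerivAt.comp (f := fun v => (u, v)) e' hu.hasFDerivAt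
      (hasFDerivAt_prodMk_right u e')
    rw [show fderiv ℝ (fun v => m (u, v)) e' = _ from this.fderiv]
    simp
  have hdd : HasFDerivAt (fderiv ℝ m) (fderiv ℝ (fderiv ℝ m) (e, e')) (e, e') :=
    ((hm.fderiv_right (m := 1) (by rw [one_add_one_eq_two])).differentiableAt
      one_ne_zero).hasFDerivAt
  have e1 := (HasFDerivAt.comp (f := fun v => (e, v)) e' hdd
    (hasFDerivAt_prodMk_right e e')).clm_apply
    (hasFDerivAt_const ((Y, 0) : E × E') e')
  have e2 := (HasFDerivAt.comp (f := fun u => (u, e')) e hdd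
    (hasFDerivAt_prodMk_left e e')).clm_apply
    (hasFDerivAt_const ((0, X) : E × E') e)
  rw [h1.fderiv_eq, h2.fderiv_eq, show fderiv ℝ (fun v => fderiv ℝ m (e, v) (Y, 0)) e' = _ from
    e1.fderiv, show fderiv ℝ (fun u => fderiv ℝ m (u, e') (0, X)) e = _ from e2.fderiv]
  simpa using (hm.isSymmSndFDerivAt (by simp)).eq (0, X) (Y, 0)

end SmoothDerivative

section LieGroupBracket

open Set Filter Topology

variable {E : Type*} [NormedAddCommGroup E] [NormedSpace ℝ E]
  {H : Type*} [TopologicalSpace H] (I : ModelWithCorners ℝ E H)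
  (G : Type*) [TopologicalSpace G] [ChartedSpace H G] [Group G]
  {E' : Type*} [NormedAddCommGroup E'] [NormedSpace ℝ E']
  {H' : Type*} [TopologicalSpace H'] (I' : ModelWithCorners ℝ E' H')
  (G' : Type*) [TopologicalSpace G'] [ChartedSpace H' G'] [Group G']
  {F : Type*} [NormedAddCommGroup F] [NormedSpace ℝ F]

/-- The Lie bracket of the Lie algebra of `G`, on the model vector space. -/
noncomputable def groupBracket (X Y : E) : E :=
  Bracket.bracket (L := GroupLieAlgebra I G) (M := GroupLieAlgebra I G) X Y

variable {I G I' G'}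

theorem ContMDiffAt.eventually_mdifferentiableAt {M : Type*} [TopologicalSpace M] [ChartedSpace H M]
    [IsManifold I ∞ M] {f : M → F} {x : M} (hf : ContMDiffAt I 𝓘(ℝ, F) ∞ f x) :
    ∀ᶠ y in 𝓝 x, MDifferentiableAt I 𝓘(ℝ, F) f y :=
  have : IsManifold I 1 M := IsManifold.of_le (n := ∞) ENat.LEInfty.out
  ((contMDiffAt_iff_contMDiffAt_nhds (n := 1) (by simp)).1 (hf.of_le ENat.LEInfty.out)).mono
    fun _ hy => hy.mdifferentiableAt one_ne_zero

variable [LieGroup I ∞ G] [LieGroup I' ∞ G']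

theorem mdifferentiableAt_mul_left' (a b : G) : MDifferentiableAt I I (fun b => a * b) b :=
  (contMDiff_mul_left (I := I) (n := ∞) (a := a)).mdifferentiableAt (by simp)

theorem tderiv_comp_mul_left {f : G → F} {a : G} (hf : MDifferentiableAt I 𝓘(ℝ, F) f a) (Y : E) :
    tderiv I 𝓘(ℝ, F) (fun b => f (a * b)) 1 Y =
      tderiv I 𝓘(ℝ, F) f a (mulInvariantVectorField (I := I) (G := G) Y a) := by
  have := tderiv_comp_of_eq (f := fun b => a * b) (x := 1) hf (mdifferentiableAt_mul_left' a 1)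
    (mul_one a)
  exact DFunLike.congr_fun this Y

theorem eventually_tderiv_comp_mul_left {f : G → F} (hf : ContMDiffAt I 𝓘(ℝ, F) ∞ f 1) (Y : E) :
    (fun a => tderiv I 𝓘(ℝ, F) (fun b => f (a * b)) 1 Y) =ᶠ[𝓝 1]
      fun a => tderiv I 𝓘(ℝ, F) f a (mulInvariantVectorField (I := I) (G := G) Y a) := by
  filter_upwards [hf.eventually_mdifferentiableAt] with a ha
  exact tderiv_comp_mul_left ha Y

variable [I.Boundaryless] [I'.Boundaryless] [CompleteSpace E] [CompleteSpace E']

theorem mdifferentiableAt_tderiv_comp_mul_left {f : G → F} (hf : ContMDiffAt I 𝓘(ℝ, F) ∞ f 1)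
    (Y : E) :
    MDifferentiableAt I 𝓘(ℝ, F) (fun a => tderiv I 𝓘(ℝ, F) (fun b => f (a * b)) 1 Y) 1 := by
  refine MDifferentiableAt.congr_of_eventuallyEq ?_ (eventually_tderiv_comp_mul_left hf Y)
  exact mdifferentiableAt_tderiv_apply hf (mdifferentiableAt_mulInvariantVectorField _)

theorem tderiv_groupBracket {f : G → F} (hf : ContMDiffAt I 𝓘(ℝ, F) ∞ f 1) (X Y : E) :
    tderiv I 𝓘(ℝ, F) f 1 (groupBracket I G X Y) =
      tderiv I 𝓘(ℝ, F) (fun a => tderiv I 𝓘(ℝ, F) (fun b => f (a * b)) 1 Y) 1 X -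
      tderiv I 𝓘(ℝ, F) (fun a => tderiv I 𝓘(ℝ, F) (fun b => f (a * b)) 1 X) 1 Y := by
  have h0 : ∀ Z : E, (mulInvariantVectorField (I := I) (G := G) Z 1 : E) = Z := by
    intro Z
    have : (fun b : G => 1 * b) = id := by ext; simp
    change tderiv I I (fun b : G => 1 * b) 1 Z = Z
    rw [this, tderiv_id]
    rfl
  have := tderiv_mlieBracket hf
    (mdifferentiableAt_mulInvariantVectorField (I := I) (G := G) (g := 1) X)
    (mdifferentiableAt_mulInvariantVectorField (I := I) (G := G) (g := 1) Y)
  rw [(eventually_tderiv_comp_mul_left hf X).tderiv_eq,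
    (eventually_tderiv_comp_mul_left hf Y).tderiv_eq]
  rw [h0, h0] at this
  exact this

/-- The derivative of a smooth homomorphism of Lie groups is a homomorphism of Lie algebras. -/
theorem tderiv_monoidHom_groupBracket (φ : G →* G') (hφ : ContMDiff I I' ∞ φ) (X Y : E) :
    tderiv I I' φ 1 (groupBracket I G X Y) =
      groupBracket I' G' (tderiv I I' φ 1 X) (tderiv I I' φ 1 Y) := by
  have : IsManifold I' 1 G' := IsManifold.of_le (n := ∞) ENat.LEInfty.out
  let f : G' → E' := fun x => extChartAt I' (1 : G') x
  have hf : ContMDiffAt I' 𝓘(ℝ, E') ∞ f 1 := contMDiffAt_extChartAt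
  have hf' : ContMDiffAt I' 𝓘(ℝ, E') ∞ f (φ 1) := by rwa [map_one]
  have hφ1 : MDifferentiableAt I I' φ 1 := hφ.mdifferentiableAt (by simp)
  have hfφ : ContMDiffAt I 𝓘(ℝ, E') ∞ (f ∘ φ) 1 := hf'.comp 1 hφ.contMDiffAt
  have h1 : tderiv I' 𝓘(ℝ, E') f (φ 1) = ContinuousLinearMap.id ℝ E' :=
    tderiv_extChartAt_of_eq (map_one φ)
  have h1' : tderiv I' 𝓘(ℝ, E') f 1 = ContinuousLinearMap.id ℝ E' := tderiv_extChartAt_self 1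
  have h2 : ∀ Z : E, tderiv I 𝓘(ℝ, E') (f ∘ φ) 1 Z = tderiv I I' φ 1 Z := fun Z => by
    rw [tderiv_comp (hf'.mdifferentiableAt (by simp)) hφ1, h1]; rfl
  have h3 : ∀ Z W : E, tderiv I 𝓘(ℝ, E') (fun a => tderiv I 𝓘(ℝ, E')
      (fun b => (f ∘ φ) (a * b)) 1 W) 1 Z = tderiv I' 𝓘(ℝ, E') (fun a => tderiv I' 𝓘(ℝ, E')
      (fun b => f (a * b)) 1 (tderiv I I' φ 1 W)) 1 (tderiv I I' φ 1 Z) := by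
    intro Z W
    set h : G' → E' := fun a => tderiv I' 𝓘(ℝ, E') (fun b => f (a * b)) 1 (tderiv I I' φ 1 W)
    have hh : MDifferentiableAt I' 𝓘(ℝ, E') h 1 := mdifferentiableAt_tderiv_comp_mul_left hf _
    have : (fun a => tderiv I 𝓘(ℝ, E') (fun b => (f ∘ φ) (a * b)) 1 W) =ᶠ[𝓝 1] h ∘ φ := by
      have ht : Tendsto φ (𝓝 1) (𝓝 1) := by
        simpa [ContinuousAt] using hφ.continuous.continuousAt (x := 1)
      filter_upwards [ht.eventually hf.eventually_mdifferentiableAt] with a ha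
      have e : (fun b => (f ∘ φ) (a * b)) = (fun b' => f (φ a * b')) ∘ φ := by
        ext b; simp
      rw [e, tderiv_comp_of_eq (y := 1) ?_ hφ1 (map_one φ)]
      · rfl
      · refine MDifferentiableAt.comp_of_eq (g := f) (y := φ a) 1 ha
          (mdifferentiableAt_mul_left' _ _) (mul_one _)
    rw [this.tderiv_eq, tderiv_comp_of_eq hh hφ1 (map_one φ)]
    rfl
  rw [← h2, tderiv_groupBracket hfφ, h3, h3, ← tderiv_groupBracket hf, h1']
  rfl

end LieGroupBracket

section ProductRule

variable {E : Type*} [NormedAddCommGroup E] [NormedSpace ℝ E]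
  {H : Type*} [TopologicalSpace H] {I : ModelWithCorners ℝ E H} [I.Boundaryless]
  {M : Type*} [TopologicalSpace M] [ChartedSpace H M] [IsManifold I ∞ M]
  {F : Type*} [NormedAddCommGroup F] [NormedSpace ℝ F]
  {F' : Type*} [NormedAddCommGroup F'] [NormedSpace ℝ F']

theorem differentiableAt_comp_extChartAt_symm {f : M → F} {x : M}
    (hf : MDifferentiableAt I 𝓘(ℝ, F) f x) :
    DifferentiableAt ℝ (f ∘ (extChartAt I x).symm) (extChartAt I x x) := by
  have : IsManifold I 1 M := IsManifold.of_le (n := ∞) ENat.LEInfty.out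
  refine MDifferentiableAt.differentiableAt ?_
  exact MDifferentiableAt.comp_of_eq _ hf
    (mdifferentiableAt_extChartAt_symm (mem_extChartAt_target x)) (extChartAt_to_inv x)

theorem tderiv_clm_apply {A : M → F →L[ℝ] F'} {v : M → F} {x : M}
    (hA : MDifferentiableAt I 𝓘(ℝ, F →L[ℝ] F') A x) (hv : MDifferentiableAt I 𝓘(ℝ, F) v x) (X : E) :
    tderiv I 𝓘(ℝ, F') (fun y => A y (v y)) x X =
      tderiv I 𝓘(ℝ, F →L[ℝ] F') A x X (v x) + A x (tderiv I 𝓘(ℝ, F) v x X) := by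
  have : IsManifold I 1 M := IsManifold.of_le (n := ∞) ENat.LEInfty.out
  have hA' := differentiableAt_comp_extChartAt_symm hA
  have hv' := differentiableAt_comp_extChartAt_symm hv
  rw [tderiv_eq_fderiv_comp_extChartAt_symm hA, tderiv_eq_fderiv_comp_extChartAt_symm hv,
    tderiv_eq_fderiv_comp_extChartAt_symm (hA.clm_apply hv)]
  have := (hA'.hasFDerivAt.clm_apply hv'.hasFDerivAt).fderiv
  refine (DFunLike.congr_fun this X).trans ?_
  simp [add_comm]

theorem tderiv_clm_apply_const {A : M → F →L[ℝ] F'} {x : M}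
    (hA : MDifferentiableAt I 𝓘(ℝ, F →L[ℝ] F') A x) (v : F) (X : E) :
    tderiv I 𝓘(ℝ, F') (fun y => A y v) x X = tderiv I 𝓘(ℝ, F →L[ℝ] F') A x X v := by
  rw [tderiv_clm_apply hA mdifferentiableAt_const, tderiv_const]
  simp

end ProductRule

section Adjoint

open Set Filter Topology

variable {E : Type*} [NormedAddCommGroup E] [NormedSpace ℝ E]
  {G : Type*} [TopologicalSpace G] [ChartedSpace E G] [Group G] [LieGroup 𝓘(ℝ, E) ∞ G]

theorem contMDiff_Ad : ContMDiff 𝓘(ℝ, E) 𝓘(ℝ, E →L[ℝ] E) ∞ (Ad E : G → E →L[ℝ] E) := by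
  intro g
  have hG : IsManifold 𝓘(ℝ, E) ∞ G := inferInstance
  refine contMDiffAt_tderiv (f := fun g h : G => g * h * g⁻¹) (g := fun _ : G => (1 : G)) ?_
    contMDiffAt_const ?_ ?_
  · have h1 : ContMDiff (𝓘(ℝ, E).prod 𝓘(ℝ, E)) 𝓘(ℝ, E) ∞ fun p : G × G => p.1 * p.2 * p.1⁻¹ :=
      (contMDiff_fst.mul contMDiff_snd).mul contMDiff_fst.inv
    exact h1.contMDiffAt
  · exact Eventually.of_forall fun _ => tderiv_extChartAt_symm_of_eq rfl
  · exact Eventually.of_forall fun _ => tderiv_extChartAt_of_eq (by simp)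

theorem contMDiff_conj (g : G) :
    ContMDiff 𝓘(ℝ, E) 𝓘(ℝ, E) ∞ (fun h : G => g * h * g⁻¹) :=
  (contMDiff_const.mul contMDiff_id).mul contMDiff_const

omit [LieGroup 𝓘(ℝ, E) ∞ G] in
theorem Ad_eq_tderiv (g : G) : Ad E g = tderiv 𝓘(ℝ, E) 𝓘(ℝ, E) (fun h : G => g * h * g⁻¹) 1 := rfl

omit [LieGroup 𝓘(ℝ, E) ∞ G] in
theorem Ad_one : Ad E (1 : G) = ContinuousLinearMap.id ℝ E := by
  have : (fun h : G => 1 * h * 1⁻¹) = id := by ext; simp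
  rw [Ad_eq_tderiv, this, tderiv_id]

theorem tderiv_comp_conj {E' : Type*} [NormedAddCommGroup E'] [NormedSpace ℝ E']
    {H' : Type*} [TopologicalSpace H'] {I' : ModelWithCorners ℝ E' H'}
    {M : Type*} [TopologicalSpace M] [ChartedSpace H' M] (f : G → M)
    (hf : MDifferentiableAt 𝓘(ℝ, E) I' f 1) (g : G) :
    tderiv 𝓘(ℝ, E) I' (fun h => f (g * h * g⁻¹)) 1 = (tderiv 𝓘(ℝ, E) I' f 1).comp (Ad E g) :=
  tderiv_comp_of_eq (f := fun h => g * h * g⁻¹) hf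
    ((contMDiff_conj g).mdifferentiableAt (by simp)) (by simp)

theorem Ad_mul (g h : G) : Ad E (g * h) = (Ad E g).comp (Ad E h) := by
  have := tderiv_comp_conj (E := E) (fun k => g * k * g⁻¹)
    ((contMDiff_conj g).mdifferentiableAt (by simp)) h
  rw [← Ad_eq_tderiv] at this
  rw [← this, Ad_eq_tderiv]
  congr 1
  ext k
  group

variable (E G) in
/-- The adjoint representation of the Lie algebra, as the derivative of `Ad`. -/
noncomputable def adL : E →L[ℝ] E →L[ℝ] E := tderiv 𝓘(ℝ, E) 𝓘(ℝ, E →L[ℝ] E) (Ad E : G → E →L[ℝ] E) 1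

theorem contMDiffAt_mul_left_param {F : Type*} [NormedAddCommGroup F] [NormedSpace ℝ F] {f : G → F}
    (hf : ContMDiffAt 𝓘(ℝ, E) 𝓘(ℝ, F) ∞ f 1) :
    ContMDiffAt 𝓘(ℝ, E) 𝓘(ℝ, E →L[ℝ] F) ∞ (fun a =>
      tderiv 𝓘(ℝ, E) 𝓘(ℝ, F) (fun h => f (h * a)) 1) 1 := by
  have hG : IsManifold 𝓘(ℝ, E) ∞ G := inferInstance
  refine contMDiffAt_tderiv (f := fun a h : G => f (h * a)) (g := fun _ : G => (1 : G)) ?_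
    contMDiffAt_const ?_ ?_
  · have h1 : ContMDiff (𝓘(ℝ, E).prod 𝓘(ℝ, E)) 𝓘(ℝ, E) ∞ fun p : G × G => p.2 * p.1 :=
      contMDiff_snd.mul contMDiff_fst
    exact ContMDiffAt.comp_of_eq hf h1.contMDiffAt (by simp)
  · exact Eventually.of_forall fun _ => tderiv_extChartAt_symm_of_eq rfl
  · exact Eventually.of_forall fun _ => tderiv_extChartAt_model _ _

theorem contMDiffAt_extChartAt_symm (x : G) :
    ContMDiffAt 𝓘(ℝ, E) 𝓘(ℝ, E) ∞ (extChartAt 𝓘(ℝ, E) x).symm (extChartAt 𝓘(ℝ, E) x x) :=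
  (contMDiffOn_extChartAt_symm x).contMDiffAt (extChartAt_target_mem_nhds x)

/-- Symmetry of the mixed second derivative of `(h, a) ↦ f (h a)`. -/
theorem tderiv_tderiv_mul_comm {F : Type*} [NormedAddCommGroup F] [NormedSpace ℝ F] {f : G → F}
    (hf : ContMDiffAt 𝓘(ℝ, E) 𝓘(ℝ, F) ∞ f 1) [CompleteSpace E] (X Y : E) :
    tderiv 𝓘(ℝ, E) 𝓘(ℝ, F) (fun a => tderiv 𝓘(ℝ, E) 𝓘(ℝ, F) (fun h => f (h * a)) 1 Y) 1 X =
      tderiv 𝓘(ℝ, E) 𝓘(ℝ, F) (fun h => tderiv 𝓘(ℝ, E) 𝓘(ℝ, F) (fun a => f (h * a)) 1 X) 1 Y := by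
  have hG : IsManifold 𝓘(ℝ, E) ∞ G := inferInstance
  have hG1 : IsManifold 𝓘(ℝ, E) 1 G := IsManifold.of_le (n := ∞) ENat.LEInfty.out
  set φ := extChartAt 𝓘(ℝ, E) (1 : G) with hφ
  let m : E × E → F := fun p => f (φ.symm p.1 * φ.symm p.2)
  have hs : φ.symm (φ 1) = 1 := extChartAt_to_inv _
  have hm : ContDiffAt ℝ ∞ m (φ 1, φ 1) := by
    refine ContMDiffAt.contDiffAt ?_
    have s1 := contMDiffAt_extChartAt_symm (E := E) (1 : G)
    refine ContMDiffAt.comp_of_eq (g := f) hf (ContMDiffAt.mul (I := 𝓘(ℝ, E))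
      (s1.comp (φ 1, φ 1) (contDiff_fst.contMDiff.contMDiffAt (f := Prod.fst)))
      (s1.comp (φ 1, φ 1) (contDiff_snd.contMDiff.contMDiffAt (f := Prod.snd)))) ?_
    simp [hs]
  have hc : Tendsto φ.symm (𝓝 (φ 1)) (𝓝 1) := by
    have := (contMDiffAt_extChartAt_symm (E := E) (1 : G)).continuousAt
    rwa [ContinuousAt, ← hφ, hs] at this
  have hd := hc.eventually hf.eventually_mdifferentiableAt
  have e1 : (fun a => tderiv 𝓘(ℝ, E) 𝓘(ℝ, F) (fun h => f (h * a)) 1 Y) ∘ φ.symm =ᶠ[𝓝 (φ 1)]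
      fun v => fderiv ℝ (fun u => m (u, v)) (φ 1) Y := by
    filter_upwards [hd] with v hv
    rw [Function.comp_apply, tderiv_eq_fderiv_comp_extChartAt_symm]
    · rfl
    · exact MDifferentiableAt.comp_of_eq (g := f) 1 hv
        ((contMDiff_mul_right (I := 𝓘(ℝ, E)) (n := ∞)).mdifferentiableAt (by simp)) (one_mul _)
  have e2 : (fun h => tderiv 𝓘(ℝ, E) 𝓘(ℝ, F) (fun a => f (h * a)) 1 X) ∘ φ.symm =ᶠ[𝓝 (φ 1)]
      fun u => fderiv ℝ (fun v => m (u, v)) (φ 1) X := by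
    filter_upwards [hd] with v hv
    rw [Function.comp_apply, tderiv_eq_fderiv_comp_extChartAt_symm]
    · rfl
    · exact MDifferentiableAt.comp_of_eq (g := f) 1 hv (mdifferentiableAt_mul_left' _ _) (mul_one _)
  have hR := ((contMDiffAt_mul_left_param hf).mdifferentiableAt (by simp)).clm_apply
    (mdifferentiableAt_const (c := Y))
  rw [tderiv_eq_fderiv_comp_extChartAt_symm hR, tderiv_eq_fderiv_comp_extChartAt_symm
    (mdifferentiableAt_tderiv_comp_mul_left hf X), e1.fderiv_eq, e2.fderiv_eq]
  exact fderiv_fderiv_partial_comm (hm.of_le ENat.LEInfty.out) X Y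

/-- The derivative of `Ad` at the identity is `ad`. -/
theorem adL_apply [CompleteSpace E] (X Y : E) : adL E G X Y = ad G X Y := by
  have hG : IsManifold 𝓘(ℝ, E) ∞ G := inferInstance
  have hG1 : IsManifold 𝓘(ℝ, E) 1 G := IsManifold.of_le (n := ∞) ENat.LEInfty.out
  let f : G → E := fun x => extChartAt 𝓘(ℝ, E) (1 : G) x
  have hf : ContMDiffAt 𝓘(ℝ, E) 𝓘(ℝ, E) ∞ f 1 := contMDiffAt_extChartAt
  have h1 : tderiv 𝓘(ℝ, E) 𝓘(ℝ, E) f 1 = ContinuousLinearMap.id ℝ E := tderiv_extChartAt_self 1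
  let R : G → E →L[ℝ] E := fun a => tderiv 𝓘(ℝ, E) 𝓘(ℝ, E) (fun h => f (h * a)) 1
  have hR : ContMDiffAt 𝓘(ℝ, E) 𝓘(ℝ, E →L[ℝ] E) ∞ R 1 := contMDiffAt_mul_left_param hf
  have hR1 : R 1 = ContinuousLinearMap.id ℝ E := by simp only [R, mul_one]; exact h1
  have h2 : (fun a => tderiv 𝓘(ℝ, E) 𝓘(ℝ, E) (fun b => f (a * b)) 1 Y) =ᶠ[𝓝 1]
      fun a => R a (Ad E a Y) := by
    filter_upwards [hf.eventually_mdifferentiableAt] with a ha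
    have hRa : MDifferentiableAt 𝓘(ℝ, E) 𝓘(ℝ, E) (fun h => f (h * a)) 1 :=
      MDifferentiableAt.comp_of_eq (g := f) 1 ha
        ((contMDiff_mul_right (I := 𝓘(ℝ, E)) (n := ∞)).mdifferentiableAt (by simp)) (one_mul _)
    have := tderiv_comp_conj (fun h => f (h * a)) hRa a
    simp only [inv_mul_cancel_right] at this
    rw [this]
    rfl
  have hRd : MDifferentiableAt 𝓘(ℝ, E) 𝓘(ℝ, E →L[ℝ] E) R 1 := hR.mdifferentiableAt (by simp)
  have hAd : MDifferentiableAt 𝓘(ℝ, E) 𝓘(ℝ, E →L[ℝ] E) (Ad E : G → E →L[ℝ] E) 1 :=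
    contMDiff_Ad.mdifferentiableAt (by simp)
  have h3 : tderiv 𝓘(ℝ, E) 𝓘(ℝ, E) (fun a => R a (Ad E a Y)) 1 X =
      tderiv 𝓘(ℝ, E) 𝓘(ℝ, E) (fun a => R a Y) 1 X + adL E G X Y := by
    rw [tderiv_clm_apply hRd (hAd.clm_apply mdifferentiableAt_const), tderiv_clm_apply_const hRd,
      tderiv_clm_apply_const hAd, hR1, Ad_one]
    rfl
  have := tderiv_groupBracket hf X Y
  rw [h1, h2.tderiv_eq, h3, tderiv_tderiv_mul_comm hf X Y, add_sub_cancel_left] at this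
  exact this.symm

end Adjoint

section JetEq

open Set Filter Topology

variable {E F F' : Type*} [NormedAddCommGroup E] [NormedSpace ℝ E] [NormedAddCommGroup F]
  [NormedSpace ℝ F] [NormedAddCommGroup F'] [NormedSpace ℝ F']

/-- The curves `u` and `v` have the same derivatives at `0` of all orders less than `n`. -/
def JetEq (n : ℕ) (u v : ℝ → F) : Prop :=
  ∀ j < n, iteratedDeriv j u 0 = iteratedDeriv j v 0

theorem JetEq.refl (n : ℕ) (u : ℝ → F) : JetEq n u u := fun _ _ => rfl

theorem JetEq.symm {n : ℕ} {u v : ℝ → F} (h : JetEq n u v) : JetEq n v u :=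
  fun j hj => (h j hj).symm

theorem JetEq.trans {n : ℕ} {u v w : ℝ → F} (h : JetEq n u v) (h' : JetEq n v w) : JetEq n u w :=
  fun j hj => (h j hj).trans (h' j hj)

theorem Filter.EventuallyEq.jetEq {u v : ℝ → F} (h : u =ᶠ[𝓝 0] v) (n : ℕ) : JetEq n u v :=
  fun j _ => h.iteratedDeriv_eq j

theorem JetEq.iteratedFDeriv_eq {n : ℕ} {u v : ℝ → F} (h : JetEq n u v) {j : ℕ} (hj : j < n) :
    iteratedFDeriv ℝ j u 0 = iteratedFDeriv ℝ j v 0 := by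
  simp only [iteratedFDeriv_eq_equiv_comp, Function.comp, h j hj]

theorem JetEq.comp {n : ℕ} {u v : ℝ → F} (h : JetEq n u v) {f : F → F'}
    (hf : ContDiffAt ℝ ∞ f (u 0)) (hu : ContDiffAt ℝ ∞ u 0) (hv : ContDiffAt ℝ ∞ v 0) :
    JetEq n (fun t => f (u t)) (fun t => f (v t)) := by
  intro j hj
  obtain ⟨k, rfl⟩ : ∃ k, n = k + 1 := ⟨n - 1, by omega⟩
  have hk : ((k : ℕ) : ℕ∞ω) ≤ ∞ := by exact_mod_cast le_top
  exact iteratedDeriv_comp_congr (k := k) (by simpa using h 0 (by omega)) (hf.of_le hk)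
    (hu.of_le hk) (hv.of_le hk) (fun m hm => h.iteratedFDeriv_eq (by omega)) (by omega)

theorem JetEq.prodMk {n : ℕ} {u v : ℝ → F} {u' v' : ℝ → F'} (h : JetEq n u v) (h' : JetEq n u' v')
    (hu : ContDiffAt ℝ ∞ u 0) (hv : ContDiffAt ℝ ∞ v 0) (hu' : ContDiffAt ℝ ∞ u' 0)
    (hv' : ContDiffAt ℝ ∞ v' 0) : JetEq n (fun t => (u t, u' t)) (fun t => (v t, v' t)) := by
  intro j hj
  have hk : ((j : ℕ) : ℕ∞ω) ≤ ∞ := by exact_mod_cast le_top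
  simp only [iteratedDeriv_eq_iteratedFDeriv]
  rw [iteratedFDeriv_prodMk (hu.of_le hk) (hu'.of_le hk) le_rfl,
    iteratedFDeriv_prodMk (hv.of_le hk) (hv'.of_le hk) le_rfl, h.iteratedFDeriv_eq hj,
    h'.iteratedFDeriv_eq hj]

theorem JetEq.clm_apply {n : ℕ} {A B : ℝ → F →L[ℝ] F'} {u v : ℝ → F} (h : JetEq n A B)
    (h' : JetEq n u v) (hA : ContDiffAt ℝ ∞ A 0) (hB : ContDiffAt ℝ ∞ B 0)
    (hu : ContDiffAt ℝ ∞ u 0) (hv : ContDiffAt ℝ ∞ v 0) :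
    JetEq n (fun t => A t (u t)) (fun t => B t (v t)) :=
  (h.prodMk h' hA hB hu hv).comp (f := fun p : (F →L[ℝ] F') × F => p.1 p.2)
    (contDiff_fst.clm_apply contDiff_snd).contDiffAt (hA.prodMk hu) (hB.prodMk hv)

theorem JetEq.deriv {n : ℕ} {u v : ℝ → F} (h : JetEq (n + 1) u v) :
    JetEq n (deriv u) (deriv v) := fun j hj => by
  rw [← iteratedDeriv_succ', ← iteratedDeriv_succ']
  exact h _ (by omega)

theorem JetEq.of_deriv {n : ℕ} {u v : ℝ → F} (h0 : u 0 = v 0)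
    (h : JetEq n (_root_.deriv u) (_root_.deriv v)) : JetEq (n + 1) u v := by
  rintro (_ | j) hj
  · simpa
  · rw [iteratedDeriv_succ', iteratedDeriv_succ']
    exact h _ (by omega)

/-- The curve `t ↦ (t ^ k / k!) w`. -/
noncomputable def monomialCurve (k : ℕ) (w : F) (t : ℝ) : F := (t ^ k / (k.factorial : ℝ)) • w

theorem contDiff_monomialCurve (k : ℕ) (w : F) : ContDiff ℝ ∞ (monomialCurve k w) := by
  unfold monomialCurve
  fun_prop

theorem deriv_monomialCurve_succ (k : ℕ) (w : F) :
    deriv (monomialCurve (k + 1) w) = monomialCurve k w := by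
  ext t
  have : HasDerivAt (fun t : ℝ => t ^ (k + 1) / ((k + 1).factorial : ℝ))
      (((k + 1 : ℕ) : ℝ) * t ^ k / ((k + 1).factorial : ℝ)) t := by
    simpa using (hasDerivAt_pow (k + 1) t).div_const ((k + 1).factorial : ℝ)
  unfold monomialCurve
  rw [(this.smul_const w).deriv]
  congr 1
  rw [Nat.factorial_succ]
  push_cast
  field_simp

theorem iteratedDeriv_monomialCurve (k j : ℕ) (w : F) :
    iteratedDeriv j (monomialCurve k w) 0 = if j = k then w else 0 := by
  induction k generalizing j with
  | zero =>
    have : monomialCurve 0 w = fun _ => w := by ext; simp [monomialCurve]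
    rw [this]
    cases j <;> simp [iteratedDeriv_const]
  | succ k ih =>
    cases j with
    | zero => simp [monomialCurve]
    | succ j => rw [iteratedDeriv_succ', deriv_monomialCurve_succ, ih]; simp

theorem contDiffAt_natCast {u : ℝ → F} {n : ℕ} {t : ℝ} (hu : ContDiffAt ℝ ∞ u t) :
    ContDiffAt ℝ n u t := hu.of_le (by exact_mod_cast le_top)

/-- A formal solution, up to a given order, of the differential equation `u' = A(u) X`. -/
theorem exists_jetEq_deriv (n : ℕ) {e : E} {A : E → F →L[ℝ] E} (hA : ContDiffAt ℝ ∞ A e) {X : ℝ → F}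
    (hX : ContDiff ℝ ∞ X) :
    ∃ u : ℝ → E, ContDiff ℝ ∞ u ∧ u 0 = e ∧ JetEq n (deriv u) (fun t => A (u t) (X t)) := by
  induction n with
  | zero => exact ⟨fun _ => e, contDiff_const, rfl, fun j hj => absurd hj (by omega)⟩
  | succ n ih =>
    obtain ⟨u, hu, hu0, h⟩ := ih
    set w := iteratedDeriv n (fun t => A (u t) (X t)) 0 - iteratedDeriv (n + 1) u 0
    have hm := contDiff_monomialCurve (n + 1) w
    have hv : ContDiff ℝ ∞ (u + monomialCurve (n + 1) w) := hu.add hm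
    have hder : ∀ j, iteratedDeriv j (u + monomialCurve (n + 1) w) 0 =
        iteratedDeriv j u 0 + if j = n + 1 then w else 0 := fun j => by
      rw [iteratedDeriv_add (contDiffAt_natCast hu.contDiffAt) (contDiffAt_natCast hm.contDiffAt),
        iteratedDeriv_monomialCurve]
    have hj : JetEq (n + 1) u (u + monomialCurve (n + 1) w) := fun j hj => by
      rw [hder, if_neg (by omega), add_zero]
    have hAu : JetEq (n + 1) (fun t => A (u t) (X t))
        (fun t => A ((u + monomialCurve (n + 1) w) t) (X t)) := by
      have h0 : (u + monomialCurve (n + 1) w) 0 = e := by simpa [hu0] using (hj 0 (by omega)).symm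
      exact (hj.comp (hu0 ▸ hA) hu.contDiffAt hv.contDiffAt).clm_apply (JetEq.refl _ X)
        (ContDiffAt.comp (0 : ℝ) (hu0 ▸ hA) hu.contDiffAt)
        (ContDiffAt.comp (0 : ℝ) (h0 ▸ hA) hv.contDiffAt) hX.contDiffAt hX.contDiffAt
    refine ⟨_, hv, by simpa [hu0] using (hj 0 (by omega)).symm, fun j hjn => ?_⟩
    rw [← hAu j hjn, ← iteratedDeriv_succ', hder]
    split_ifs with hjn'
    · obtain rfl : j = n := by omega
      simp [w]
    · rw [add_zero, iteratedDeriv_succ', h j (by omega)]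

end JetEq

section RightTrivialization

open Set Filter Topology

variable {E : Type*} [NormedAddCommGroup E] [NormedSpace ℝ E]
  {G : Type*} [TopologicalSpace G] [ChartedSpace E G] [Group G] [LieGroup 𝓘(ℝ, E) ∞ G]

omit [LieGroup 𝓘(ℝ, E) ∞ G] in
theorem rightLogDeriv_eq_tderiv (c : ℝ → G) (t : ℝ) : (rightLogDeriv c t : E) =
    tderiv 𝓘(ℝ, ℝ) 𝓘(ℝ, E) (fun s => c s * (c t)⁻¹) t (1 : ℝ) := rfl

theorem contDiff_rightLogDeriv (c : SmoothCurve E G) :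
    ContDiff ℝ ∞ (rightLogDeriv (c : ℝ → G) : ℝ → E) := by
  have hG : IsManifold 𝓘(ℝ, E) ∞ G := inferInstance
  rw [contDiff_iff_contDiffAt]
  intro t₀
  refine ContMDiffAt.contDiffAt ?_
  have : ContMDiffAt 𝓘(ℝ, ℝ) 𝓘(ℝ, ℝ →L[ℝ] E) ∞
      (fun t => tderiv 𝓘(ℝ, ℝ) 𝓘(ℝ, E) (fun s => c s * (c t)⁻¹) t) t₀ := by
    refine contMDiffAt_tderiv (f := fun t s => c s * (c t)⁻¹) (g := fun t => t) ?_ contMDiffAt_id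
      (Eventually.of_forall fun _ => tderiv_extChartAt_symm_model _ _)
      (Eventually.of_forall fun _ => tderiv_extChartAt_of_eq (by simp))
    have h1 : ContMDiff (𝓘(ℝ, ℝ).prod 𝓘(ℝ, ℝ)) 𝓘(ℝ, E) ∞ fun p : ℝ × ℝ => c p.2 * (c p.1)⁻¹ :=
      (c.contMDiff.comp contMDiff_snd).mul (c.contMDiff.comp contMDiff_fst).inv
    exact h1.contMDiffAt
  exact this.clm_apply contMDiffAt_const

/-- The right Maurer-Cartan form of `G` in the chart at `x`. -/
noncomputable def chartMC (x : G) (w : E) : E →L[ℝ] E :=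
  tderiv 𝓘(ℝ, E) 𝓘(ℝ, E)
    (fun z => (extChartAt 𝓘(ℝ, E) x).symm z * ((extChartAt 𝓘(ℝ, E) x).symm w)⁻¹) w

/-- The inverse of the right Maurer-Cartan form of `G` in the chart at `x`. -/
noncomputable def chartMCInv (x : G) (w : E) : E →L[ℝ] E :=
  tderiv 𝓘(ℝ, E) 𝓘(ℝ, E)
    (fun h : G => extChartAt 𝓘(ℝ, E) x (h * (extChartAt 𝓘(ℝ, E) x).symm w)) 1

theorem contDiffAt_chartMC (x : G) : ContDiffAt ℝ ∞ (chartMC x) (extChartAt 𝓘(ℝ, E) x x) := by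
  have hG : IsManifold 𝓘(ℝ, E) ∞ G := inferInstance
  refine ContMDiffAt.contDiffAt ?_
  set φ := extChartAt 𝓘(ℝ, E) x
  refine contMDiffAt_tderiv (f := fun w z => φ.symm z * (φ.symm w)⁻¹) (g := fun w => w) ?_
    contMDiffAt_id (Eventually.of_forall fun _ => tderiv_extChartAt_symm_model _ _)
    (Eventually.of_forall fun _ => tderiv_extChartAt_of_eq (by simp))
  have s1 := contMDiffAt_extChartAt_symm (E := E) x
  exact ContMDiffAt.mul (I := 𝓘(ℝ, E))
      (ContMDiffAt.comp (φ x, φ x) s1 contMDiffAt_snd)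
      (ContMDiffAt.comp (φ x, φ x) s1 contMDiffAt_fst).inv

theorem contDiffAt_chartMCInv (x : G) :
    ContDiffAt ℝ ∞ (chartMCInv x) (extChartAt 𝓘(ℝ, E) x x) := by
  have hG : IsManifold 𝓘(ℝ, E) ∞ G := inferInstance
  refine ContMDiffAt.contDiffAt ?_
  set φ := extChartAt 𝓘(ℝ, E) x with hφ
  refine contMDiffAt_tderiv (f := fun w h => φ (h * φ.symm w)) (g := fun _ => (1 : G)) ?_
    contMDiffAt_const (Eventually.of_forall fun _ => tderiv_extChartAt_symm_of_eq rfl)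
    (Eventually.of_forall fun _ => tderiv_extChartAt_model _ _)
  have s1 := contMDiffAt_extChartAt_symm (E := E) x
  refine ContMDiffAt.comp_of_eq (g := φ) (y := x) contMDiffAt_extChartAt
    (ContMDiffAt.mul (I := 𝓘(ℝ, E)) contMDiffAt_snd
      (ContMDiffAt.comp (φ x, (1 : G)) s1 contMDiffAt_fst)) ?_
  simp only [one_mul]
  exact extChartAt_to_inv x

theorem chartMC_comp_chartMCInv (x : G) {w : E} (hw : w ∈ (extChartAt 𝓘(ℝ, E) x).target) :
    (chartMC x w).comp (chartMCInv x w) = ContinuousLinearMap.id ℝ E := by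
  have hG : IsManifold 𝓘(ℝ, E) 1 G := IsManifold.of_le (n := ∞) ENat.LEInfty.out
  unfold chartMC chartMCInv
  set φ := extChartAt 𝓘(ℝ, E) x with hφ
  have hs : φ.symm w ∈ φ.source := φ.map_target hw
  have h1 : MDifferentiableAt 𝓘(ℝ, E) 𝓘(ℝ, E) (fun z => φ.symm z * (φ.symm w)⁻¹) w :=
    MDifferentiableAt.comp w (g := fun g : G => g * (φ.symm w)⁻¹)
      ((contMDiff_mul_right (I := 𝓘(ℝ, E)) (n := ∞)).mdifferentiableAt (by simp))
      (mdifferentiableAt_extChartAt_symm hw)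
  have h2 : MDifferentiableAt 𝓘(ℝ, E) 𝓘(ℝ, E) (fun h : G => φ (h * φ.symm w)) 1 :=
    MDifferentiableAt.comp_of_eq (g := φ) 1
      (mdifferentiableAt_extChartAt (by simpa [hφ] using hs))
      ((contMDiff_mul_right (I := 𝓘(ℝ, E)) (n := ∞)).mdifferentiableAt (by simp)) (one_mul _)
  rw [← tderiv_comp_of_eq h1 h2 (by simp [φ.right_inv hw]), ← tderiv_id (I := 𝓘(ℝ, E)) (1 : G)]
  refine EventuallyEq.tderiv_eq ?_
  have : ContinuousAt (fun h : G => h * φ.symm w) 1 :=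
    (contMDiff_mul_right (I := 𝓘(ℝ, E)) (n := ∞)).continuous.continuousAt
  filter_upwards [this.eventually_mem (s := φ.source) (by
    rw [one_mul]; exact extChartAt_source_mem_nhds' (I := 𝓘(ℝ, E)) hs)] with h hh
  simp only [Function.comp_apply, id]
  rw [φ.left_inv hh, mul_inv_cancel_right]

theorem contMDiffAt_chart_comp (x : G) (c : SmoothCurve E G) {t : ℝ}
    (ht : c t ∈ (extChartAt 𝓘(ℝ, E) x).source) :
    ContDiffAt ℝ ∞ (fun s => extChartAt 𝓘(ℝ, E) x (c s)) t := by
  refine ContMDiffAt.contDiffAt ?_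
  exact ContMDiffAt.comp t (contMDiffAt_extChartAt' (by simpa using ht)) c.contMDiff.contMDiffAt

theorem rightLogDeriv_eq_chartMC (x : G) (c : SmoothCurve E G) {t : ℝ}
    (ht : c t ∈ (extChartAt 𝓘(ℝ, E) x).source) :
    rightLogDeriv (c : ℝ → G) t = chartMC x (extChartAt 𝓘(ℝ, E) x (c t))
      (deriv (fun s => extChartAt 𝓘(ℝ, E) x (c s)) t) := by
  have hG : IsManifold 𝓘(ℝ, E) 1 G := IsManifold.of_le (n := ∞) ENat.LEInfty.out
  have hu := contMDiffAt_chart_comp x c ht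
  unfold chartMC
  set φ := extChartAt 𝓘(ℝ, E) x with hφ
  have hw := φ.map_source ht
  have h1 : MDifferentiableAt 𝓘(ℝ, E) 𝓘(ℝ, E)
      (fun z => φ.symm z * (φ.symm (φ (c t)))⁻¹) (φ (c t)) :=
    MDifferentiableAt.comp (φ (c t)) (g := fun g : G => g * (φ.symm (φ (c t)))⁻¹)
      ((contMDiff_mul_right (I := 𝓘(ℝ, E)) (n := ∞)).mdifferentiableAt (by simp))
      (mdifferentiableAt_extChartAt_symm hw)
  have h2 : MDifferentiableAt 𝓘(ℝ, ℝ) 𝓘(ℝ, E) (fun s => φ (c s)) t :=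
    hu.contMDiffAt.mdifferentiableAt (by simp)
  have hev : (fun s => c s * (c t)⁻¹) =ᶠ[𝓝 t]
      (fun z => φ.symm z * (φ.symm (φ (c t)))⁻¹) ∘ (fun s => φ (c s)) := by
    filter_upwards [c.contMDiff.continuous.continuousAt.eventually_mem
      (extChartAt_source_mem_nhds' (I := 𝓘(ℝ, E)) ht)] with s hs
    simp only [Function.comp_apply]
    rw [φ.left_inv hs, φ.left_inv ht]
  rw [rightLogDeriv_eq_tderiv, hev.tderiv_eq, tderiv_comp (f := fun s => φ (c s)) h1 h2,
    tderiv_eq_fderiv, ← fderiv_apply_one_eq_deriv]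
  rfl

theorem deriv_chart_eq_chartMCInv (x : G) (c : SmoothCurve E G) {t : ℝ}
    (ht : c t ∈ (extChartAt 𝓘(ℝ, E) x).source) :
    deriv (fun s => extChartAt 𝓘(ℝ, E) x (c s)) t =
      chartMCInv x (extChartAt 𝓘(ℝ, E) x (c t)) (rightLogDeriv (c : ℝ → G) t) := by
  have hG : IsManifold 𝓘(ℝ, E) 1 G := IsManifold.of_le (n := ∞) ENat.LEInfty.out
  unfold chartMCInv
  set φ := extChartAt 𝓘(ℝ, E) x with hφ
  rw [φ.left_inv ht, rightLogDeriv_eq_tderiv]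
  have h1 : MDifferentiableAt 𝓘(ℝ, E) 𝓘(ℝ, E) (fun h : G => φ (h * c t)) 1 :=
    MDifferentiableAt.comp_of_eq (g := φ) 1
      (mdifferentiableAt_extChartAt (by simpa [hφ] using ht))
      ((contMDiff_mul_right (I := 𝓘(ℝ, E)) (n := ∞)).mdifferentiableAt (by simp)) (one_mul _)
  have h2 : MDifferentiableAt 𝓘(ℝ, ℝ) 𝓘(ℝ, E) (fun s => c s * (c t)⁻¹) t :=
    (c.contMDiff.mul contMDiff_const).mdifferentiableAt (by simp)
  have e : (fun s => φ (c s)) = (fun h : G => φ (h * c t)) ∘ fun s => c s * (c t)⁻¹ := by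
    ext s; simp
  rw [← fderiv_apply_one_eq_deriv, ← tderiv_eq_fderiv, e, tderiv_comp_of_eq h1 h2 (by simp)]
  rfl

end RightTrivialization

section JetEquiv

open Set Filter Topology

variable {E : Type*} [NormedAddCommGroup E] [NormedSpace ℝ E]
  {G : Type*} [TopologicalSpace G] [ChartedSpace E G] [Group G] [LieGroup 𝓘(ℝ, E) ∞ G]

omit [Group G] [LieGroup 𝓘(ℝ, E) ∞ G] in
theorem sameJet_iff {n : ℕ} {c b : SmoothCurve E G} :
    SameJet n c b ↔ c 0 = b 0 ∧ JetEq (n + 1) (fun t => extChartAt 𝓘(ℝ, E) (c 0) (c t))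
      (fun t => extChartAt 𝓘(ℝ, E) (c 0) (b t)) :=
  and_congr_right fun _ => forall_congr' fun _ => imp_congr Nat.lt_succ_iff.symm Iff.rfl

omit [LieGroup 𝓘(ℝ, E) ∞ G] in
theorem rightTriv_eq_iff {n : ℕ} {c b : SmoothCurve E G} :
    rightTriv n c = rightTriv n b ↔
      c 0 = b 0 ∧ JetEq n (rightLogDeriv (c : ℝ → G) : ℝ → E) (rightLogDeriv (b : ℝ → G)) := by
  simp only [rightTriv, Prod.mk.injEq, funext_iff, JetEq, Fin.forall_iff]

omit [Group G] [LieGroup 𝓘(ℝ, E) ∞ G] in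
theorem eventually_mem_source (c : SmoothCurve E G) :
    ∀ᶠ t in 𝓝 (0 : ℝ), c t ∈ (extChartAt 𝓘(ℝ, E) (c 0)).source :=
  c.contMDiff.continuous.continuousAt.eventually_mem (extChartAt_source_mem_nhds _)

theorem eventually_rightLogDeriv_eq (c : SmoothCurve E G) : (rightLogDeriv (c : ℝ → G) : ℝ → E)
    =ᶠ[𝓝 0] fun t => chartMC (c 0) (extChartAt 𝓘(ℝ, E) (c 0) (c t))
      (deriv (fun s => extChartAt 𝓘(ℝ, E) (c 0) (c s)) t) := by
  filter_upwards [eventually_mem_source c] with t ht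
  exact rightLogDeriv_eq_chartMC _ c ht

theorem eventually_deriv_chart_eq (c : SmoothCurve E G) :
    deriv (fun s => extChartAt 𝓘(ℝ, E) (c 0) (c s)) =ᶠ[𝓝 0]
      fun t => chartMCInv (c 0) (extChartAt 𝓘(ℝ, E) (c 0) (c t))
        (rightLogDeriv (c : ℝ → G) t) := by
  filter_upwards [eventually_mem_source c] with t ht
  exact deriv_chart_eq_chartMCInv _ c ht

theorem ContDiffAt.deriv_infty {F : Type*} [NormedAddCommGroup F] [NormedSpace ℝ F] {u : ℝ → F}
    {t : ℝ} (hu : ContDiffAt ℝ ∞ u t) : ContDiffAt ℝ ∞ (deriv u) t := by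
  rw [show deriv u = fun t => fderiv ℝ u t 1 from funext fun t => fderiv_apply_one_eq_deriv.symm]
  exact (hu.fderiv_right (m := ∞) (by simp)).clm_apply contDiffAt_const

theorem ContDiffAt.comp_curve {F F' : Type*} [NormedAddCommGroup F] [NormedSpace ℝ F]
    [NormedAddCommGroup F'] [NormedSpace ℝ F'] {f : F → F'} {u : ℝ → F} {e : F}
    (hf : ContDiffAt ℝ ∞ f e) (hu : ContDiffAt ℝ ∞ u 0) (h : u 0 = e) :
    ContDiffAt ℝ ∞ (fun t => f (u t)) 0 := by
  subst h
  exact ContDiffAt.comp (0 : ℝ) hf hu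

/-- Curves with the same right trivialization of their jet have the same jet, and conversely. -/
theorem sameJet_iff_rightTriv_eq (n : ℕ) (c b : SmoothCurve E G) :
    SameJet n c b ↔ rightTriv n c = rightTriv n b := by
  rw [sameJet_iff, rightTriv_eq_iff]
  refine and_congr_right fun h0 => ?_
  have hs : ∀ d : SmoothCurve E G, d 0 ∈ (extChartAt 𝓘(ℝ, E) (d 0)).source := fun d =>
    mem_extChartAt_source _
  have hc := contMDiffAt_chart_comp (c 0) c (hs c)
  have hb := contMDiffAt_chart_comp (c 0) b (t := 0) (by rw [h0]; exact hs b)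
  have ec := eventually_rightLogDeriv_eq c
  have eb := eventually_rightLogDeriv_eq b
  have ec' := eventually_deriv_chart_eq c
  have eb' := eventually_deriv_chart_eq b
  rw [← h0] at eb eb'
  have hδc := (contDiff_rightLogDeriv c).contDiffAt (x := 0)
  have hδb := (contDiff_rightLogDeriv b).contDiffAt (x := 0)
  have hMC := contDiffAt_chartMC (E := E) (c 0)
  have hMCI := contDiffAt_chartMCInv (E := E) (c 0)
  set u := fun t => extChartAt 𝓘(ℝ, E) (c 0) (c t) with hu
  set v := fun t => extChartAt 𝓘(ℝ, E) (c 0) (b t) with hv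
  have huv : u 0 = v 0 := by simp [hu, hv, h0]
  constructor
  · intro h
    refine (ec.jetEq n).trans (JetEq.trans ?_ (eb.jetEq n).symm)
    have h' : JetEq n u v := fun j hj => h j (by omega)
    exact (h'.comp hMC hc hb).clm_apply h.deriv (hMC.comp_curve hc rfl)
      (hMC.comp_curve hb huv.symm) hc.deriv_infty hb.deriv_infty
  · intro h
    have : ∀ m ≤ n, JetEq (m + 1) u v := by
      intro m hm
      induction m with
      | zero =>
        intro j hj
        obtain rfl : j = 0 := by omega
        simpa using huv
      | succ m ih =>
        refine JetEq.of_deriv huv ?_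
        refine (ec'.jetEq _).trans (JetEq.trans ?_ (eb'.jetEq _).symm)
        have h' : JetEq (m + 1) (rightLogDeriv (c : ℝ → G) : ℝ → E) (rightLogDeriv (b : ℝ → G)) :=
          fun j hj => h j (by omega)
        exact ((ih (by omega)).comp hMCI hc hb).clm_apply h' (hMCI.comp_curve hc rfl)
          (hMCI.comp_curve hb huv.symm) hδc hδb
    exact this n le_rfl

omit [Group G] in
/-- A curve in the chart at `x` extends, after shrinking, to a global smooth curve. -/
theorem exists_smoothCurve_eventuallyEq [IsManifold 𝓘(ℝ, E) ∞ G] (x : G) {u : ℝ → E}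
    (hu : ContDiff ℝ ∞ u) (hu0 : u 0 = extChartAt 𝓘(ℝ, E) x x) :
    ∃ c : SmoothCurve E G, c 0 = x ∧ (fun t => extChartAt 𝓘(ℝ, E) x (c t)) =ᶠ[𝓝 0] u := by
  set φ := extChartAt 𝓘(ℝ, E) x with hφ
  obtain ⟨r, hr, hball⟩ := Metric.mem_nhds_iff.1 (extChartAt_target_mem_nhds (I := 𝓘(ℝ, E)) x)
  obtain ⟨δ, hδ, hδu⟩ := Metric.continuousAt_iff.1 (hu.continuous.continuousAt (x := 0)) r hr
  let χ : ContDiffBump (0 : ℝ) := ⟨δ / 2, δ, by positivity, by linarith⟩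
  let v : ℝ → E := fun t => φ x + χ t • (u t - φ x)
  have hv : ContDiff ℝ ∞ v := contDiff_const.add (χ.contDiff.smul (hu.sub contDiff_const))
  have hmem : ∀ t, v t ∈ φ.target := by
    intro t
    apply hball
    rw [Metric.mem_ball, dist_eq_norm, ← hφ]
    simp only [v, add_sub_cancel_left, norm_smul, Real.norm_eq_abs, abs_of_nonneg χ.nonneg]
    by_cases ht : dist t 0 < δ
    · have := hδu ht
      rw [hu0, dist_eq_norm] at this
      calc χ t * ‖u t - φ x‖ ≤ 1 * ‖u t - φ x‖ := by gcongr; exact χ.le_one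
        _ < r := by simpa using this
    · rw [χ.zero_of_le_dist (not_lt.1 ht), zero_mul]
      exact hr
  have hcv : ContMDiff 𝓘(ℝ, ℝ) 𝓘(ℝ, E) ∞ (fun t => φ.symm (v t)) := by
    rw [← contMDiffOn_univ]
    exact (contMDiffOn_extChartAt_symm x).comp hv.contMDiff.contMDiffOn fun t _ => hmem t
  refine ⟨⟨_, hcv⟩, ?_, ?_⟩
  · change φ.symm (v 0) = x
    simp only [v, hu0, sub_self, smul_zero, add_zero]
    exact extChartAt_to_inv x
  · filter_upwards [χ.eventuallyEq_one] with t ht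
    change φ (φ.symm (v t)) = u t
    rw [φ.right_inv (hmem t)]
    simp only [v]
    rw [ht]
    simp

theorem rightTriv_surjective (n : ℕ) :
    Function.Surjective (rightTriv n : SmoothCurve E G → TrivJet E G n) := by
  rintro ⟨x, y⟩
  have hG : IsManifold 𝓘(ℝ, E) ∞ G := inferInstance
  set X : ℝ → E := fun t => ∑ j, monomialCurve (j : Fin n) (y j) t with hX_def
  have hX : ContDiff ℝ ∞ X := ContDiff.sum fun j _ => contDiff_monomialCurve _ _
  have hXj : ∀ j : Fin n, iteratedDeriv j X 0 = y j := by
    intro j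
    rw [hX_def, iteratedDeriv_fun_sum fun i _ =>
      contDiffAt_natCast (contDiff_monomialCurve _ _).contDiffAt]
    simp [iteratedDeriv_monomialCurve, ← Fin.ext_iff]
  have hA := contDiffAt_chartMCInv (E := E) x
  have hB := contDiffAt_chartMC (E := E) x
  obtain ⟨u, hu, hu0, h⟩ := exists_jetEq_deriv n hA hX
  obtain ⟨c, rfl, hc⟩ := exists_smoothCurve_eventuallyEq x hu hu0
  refine ⟨c, Prod.ext rfl (funext fun j => ?_)⟩
  refine Eq.trans ?_ (hXj j)
  have key : JetEq n (rightLogDeriv (c : ℝ → G)) X := by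
    refine ((eventually_rightLogDeriv_eq c).jetEq n).trans ?_
    have e1 : (fun t => chartMC (c 0) (extChartAt 𝓘(ℝ, E) (c 0) (c t))
        (deriv (fun s => extChartAt 𝓘(ℝ, E) (c 0) (c s)) t)) =ᶠ[𝓝 0]
        fun t => chartMC (c 0) (u t) (deriv u t) := by
      filter_upwards [hc, hc.deriv] with t h1 h2
      rw [h1, h2]
    refine (e1.jetEq n).trans ?_
    have hBu : ContDiffAt ℝ ∞ (fun t => chartMC (c 0) (u t)) 0 :=
      hB.comp_curve hu.contDiffAt hu0
    have hAu : ContDiffAt ℝ ∞ (fun t => chartMCInv (c 0) (u t) (X t)) 0 :=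
      (hA.comp_curve hu.contDiffAt hu0).clm_apply hX.contDiffAt
    refine ((JetEq.refl n _).clm_apply h hBu hBu hu.contDiffAt.deriv_infty hAu).trans ?_
    refine EventuallyEq.jetEq ?_ n
    filter_upwards [hu.continuous.continuousAt.eventually_mem
      (hu0 ▸ extChartAt_target_mem_nhds (I := 𝓘(ℝ, E)) (c 0))] with t ht
    exact DFunLike.congr_fun (chartMC_comp_chartMCInv (c 0) ht) (X t)
  exact key j j.2

variable (E G) in
/-- The right trivialization `J^n G ≃ G × 𝔤^n`. -/
noncomputable def jetEquiv (n : ℕ) : Jet E G n ≃ TrivJet E G n :=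
  Equiv.ofBijective (Quotient.lift (rightTriv n) fun c b h =>
    (sameJet_iff_rightTriv_eq n c b).1 h) <| by
    constructor
    · rintro ⟨c⟩ ⟨b⟩ h
      exact Quotient.sound ((sameJet_iff_rightTriv_eq n c b).2 h)
    · intro a
      obtain ⟨c, rfl⟩ := rightTriv_surjective n a
      exact ⟨jet n c, rfl⟩

theorem jetEquiv_jet (n : ℕ) (c : SmoothCurve E G) : jetEquiv E G n (jet n c) = rightTriv n c := rfl

end JetEquiv

section Chain

variable {E : Type*} [NormedAddCommGroup E] [NormedSpace ℝ E]

/-- `D_{x_{i_{ℓ-1}}} ⋯ D_{x_{i_1}} P y_{i_ℓ}` for a list `(i_1, …, i_ℓ)`. -/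
noncomputable def chain (D : E →L[ℝ] E →L[ℝ] E) (x y : ℕ → E) : List ℕ → (E →L[ℝ] E) → E
  | [], _ => 0
  | [j], P => P (y j)
  | i :: j :: l, P => chain D x y (j :: l) ((D (x i)).comp P)

variable (D : E →L[ℝ] E →L[ℝ] E)

theorem chain_cons (x y : ℕ → E) (i : ℕ) {l : List ℕ} (hl : l ≠ []) (P : E →L[ℝ] E) :
    chain D x y (i :: l) P = chain D x y l ((D (x i)).comp P) := by
  obtain ⟨j, l, rfl⟩ := List.exists_cons_of_ne_nil hl
  rfl

theorem chain_add (x y : ℕ → E) (l : List ℕ) (P Q : E →L[ℝ] E) :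
    chain D x y l (P + Q) = chain D x y l P + chain D x y l Q := by
  induction l generalizing P Q with
  | nil => simp [chain]
  | cons i l ih =>
    rcases eq_or_ne l [] with rfl | hl
    · simp [chain]
    · simp only [chain_cons D x y i hl, ContinuousLinearMap.comp_add, ih]

theorem chain_eq_foldl (x y : ℕ → E) {l : List ℕ} (hl : l ≠ []) (P : E →L[ℝ] E) :
    chain D x y l P = l.dropLast.foldl (fun z r => D (x r) z) (P (y (l.getLastD 0))) := by
  induction l generalizing P with
  | nil => exact absurd rfl hl
  | cons i l ih =>
    rcases eq_or_ne l [] with rfl | hl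
    · simp [chain]
    · obtain ⟨j, l, rfl⟩ := List.exists_cons_of_ne_nil hl
      rw [chain_cons D x y i hl, ih hl]
      simp

theorem chain_congr {x y x' y' : ℕ → E} {l : List ℕ} (hx : ∀ i ∈ l, x i = x' i)
    (hy : ∀ i ∈ l, y i = y' i) (P : E →L[ℝ] E) : chain D x y l P = chain D x' y' l P := by
  induction l generalizing P with
  | nil => rfl
  | cons i l ih =>
    rcases eq_or_ne l [] with rfl | hl
    · simp [chain, hy i]
    · rw [chain_cons D _ _ _ hl, chain_cons D _ _ _ hl, hx i (by simp),
        ih (fun j hj => hx j (by simp [hj])) fun j hj => hy j (by simp [hj])]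

theorem hasDerivAt_chain {x y : ℕ → ℝ → E} {t : ℝ}
    (hx : ∀ i, 1 ≤ i → HasDerivAt (x i) (x (i + 1) t) t)
    (hy : ∀ i, 1 ≤ i → HasDerivAt (y i) (y (i + 1) t) t) {l : List ℕ} (hl : ∀ i ∈ l, 1 ≤ i)
    {P : ℝ → E →L[ℝ] E} {P' : E →L[ℝ] E} (hP : HasDerivAt P P' t) :
    HasDerivAt (fun s => chain D (fun i => x i s) (fun i => y i s) l (P s))
      (chain D (fun i => x i t) (fun i => y i t) l P' + ∑ r ∈ Finset.range l.length,
        chain D (fun i => x i t) (fun i => y i t) (l.modify r Nat.succ) (P t)) t := by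
  induction l generalizing P P' with
  | nil => simpa [chain] using hasDerivAt_const t (0 : E)
  | cons i l ih =>
    have hi : 1 ≤ i := hl i (by simp)
    rcases eq_or_ne l [] with rfl | hl'
    · simpa [chain] using hP.clm_apply (hy i hi)
    · have hP2 : HasDerivAt (fun s => (D (x i s)).comp (P s))
          ((D (x (i + 1) t)).comp (P t) + (D (x i t)).comp P') t := by
        have h1 : HasDerivAt (fun s => D (x i s)) (D (x (i + 1) t)) t :=
          D.hasFDerivAt.comp_hasDerivAt t (hx i hi)
        simpa using h1.clm_comp hP
      have := ih (fun j hj => hl j (by simp [hj])) hP2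
      simp only [chain_cons D _ _ i hl']
      refine this.congr_deriv ?_
      rw [List.length_cons, Finset.sum_range_succ', chain_add]
      simp only [List.modify_succ_cons, List.modify_zero_cons, chain_cons D _ _ _ hl']
      have : ∀ r, l.modify r Nat.succ ≠ [] := fun r h => hl' (by simpa using h)
      simp only [chain_cons D _ _ i (this _)]
      abel

end Chain

section LogDerivMul

open Filter Topology

variable {E : Type*} [NormedAddCommGroup E] [NormedSpace ℝ E]
  {G : Type*} [TopologicalSpace G] [ChartedSpace E G] [Group G] [LieGroup 𝓘(ℝ, E) ∞ G]

theorem tderiv_mul_of_eq_one {EM : Type*} [NormedAddCommGroup EM] [NormedSpace ℝ EM]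
    {HM : Type*} [TopologicalSpace HM] {I : ModelWithCorners ℝ EM HM}
    {M : Type*} [TopologicalSpace M] [ChartedSpace HM M] {p q : M → G} {x : M}
    (hp : MDifferentiableAt I 𝓘(ℝ, E) p x) (hq : MDifferentiableAt I 𝓘(ℝ, E) q x)
    (hp1 : p x = 1) (hq1 : q x = 1) :
    tderiv I 𝓘(ℝ, E) (fun y => p y * q y) x = tderiv I 𝓘(ℝ, E) p x + tderiv I 𝓘(ℝ, E) q x := by
  have hG : IsManifold 𝓘(ℝ, E) 1 G := IsManifold.of_le (n := ∞) ENat.LEInfty.out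
  let μ : G × G → G := fun p => p.1 * p.2
  have hμ : MDifferentiableAt (𝓘(ℝ, E).prod 𝓘(ℝ, E)) 𝓘(ℝ, E) μ (1, 1) :=
    (contMDiff_mul 𝓘(ℝ, E) ∞).mdifferentiableAt (by simp)
  have h1 : tderiv (𝓘(ℝ, E).prod 𝓘(ℝ, E)) 𝓘(ℝ, E) μ (1, 1) =
      ContinuousLinearMap.fst ℝ E E + ContinuousLinearMap.snd ℝ E E := by
    refine ContinuousLinearMap.ext fun v => ?_
    have := mfderiv_prod_eq_add_apply (v := v) hμ
    refine this.trans ?_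
    have e1 : (fun z : G => μ (z, 1)) = id := by ext; simp [μ]
    have e2 : (fun z : G => μ (1, z)) = id := by ext; simp [μ]
    change tderiv 𝓘(ℝ, E) 𝓘(ℝ, E) (fun z : G => μ (z, 1)) 1 v.1 +
      tderiv 𝓘(ℝ, E) 𝓘(ℝ, E) (fun z : G => μ (1, z)) 1 v.2 = v.1 + v.2
    rw [e1, e2, tderiv_id]
    rfl
  have h2 : tderiv I (𝓘(ℝ, E).prod 𝓘(ℝ, E)) (fun y => (p y, q y)) x =
      (tderiv I 𝓘(ℝ, E) p x).prod (tderiv I 𝓘(ℝ, E) q x) := mfderiv_prodMk hp hq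
  have := tderiv_comp_of_eq (g := μ) (f := fun y => (p y, q y)) hμ (hp.prodMk hq)
    (Prod.ext hp1 hq1)
  refine this.trans ?_
  rw [h1, h2]
  ext v
  simp

theorem rightLogDeriv_mul (c b : SmoothCurve E G) (t : ℝ) :
    (rightLogDeriv (c * b : SmoothCurve E G) t : E) =
      rightLogDeriv c t + Ad E (c t) (rightLogDeriv b t) := by
  have hb : MDifferentiableAt 𝓘(ℝ, ℝ) 𝓘(ℝ, E) (fun s => b s * (b t)⁻¹) t :=
    (b.contMDiff.mul contMDiff_const).mdifferentiableAt (by simp)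
  have hc : MDifferentiableAt 𝓘(ℝ, ℝ) 𝓘(ℝ, E) (fun s => c s * (c t)⁻¹) t :=
    (c.contMDiff.mul contMDiff_const).mdifferentiableAt (by simp)
  have hconj : MDifferentiableAt 𝓘(ℝ, E) 𝓘(ℝ, E) (fun h : G => c t * h * (c t)⁻¹) 1 :=
    (contMDiff_conj (c t)).mdifferentiableAt (by simp)
  have e : (fun s => (c * b : SmoothCurve E G) s * ((c * b : SmoothCurve E G) t)⁻¹) =
      fun s => c s * (c t)⁻¹ * ((fun h : G => c t * h * (c t)⁻¹) ∘ fun s => b s * (b t)⁻¹) s := by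
    ext s
    simp only [ContMDiffMap.coe_mul, Pi.mul_apply, Function.comp_apply]
    group
  rw [rightLogDeriv_eq_tderiv, e, tderiv_mul_of_eq_one hc
    (MDifferentiableAt.comp_of_eq t hconj hb (by simp)) (by simp) (by simp),
    tderiv_comp_of_eq hconj hb (by simp)]
  rfl

theorem hasDerivAt_Ad (c : SmoothCurve E G) (t : ℝ) :
    HasDerivAt (fun s => Ad E (c s)) ((adL E G (rightLogDeriv c t)).comp (Ad E (c t))) t := by
  have hc : MDifferentiableAt 𝓘(ℝ, ℝ) 𝓘(ℝ, E) (fun s => c s * (c t)⁻¹) t :=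
    (c.contMDiff.mul contMDiff_const).mdifferentiableAt (by simp)
  have hAd : MDifferentiableAt 𝓘(ℝ, E) 𝓘(ℝ, E →L[ℝ] E) (Ad E : G → E →L[ℝ] E) 1 :=
    contMDiff_Ad.mdifferentiableAt (by simp)
  have hd : DifferentiableAt ℝ (fun s => Ad E (c s * (c t)⁻¹)) t :=
    (MDifferentiableAt.comp_of_eq t hAd hc (by simp)).differentiableAt
  have h1 : HasDerivAt (fun s => Ad E (c s * (c t)⁻¹)) (adL E G (rightLogDeriv c t)) t := by
    have := tderiv_comp_of_eq (g := (Ad E : G → E →L[ℝ] E)) hAd hc (by simp)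
    rw [tderiv_eq_fderiv] at this
    have h2 : deriv (fun s => Ad E (c s * (c t)⁻¹)) t = adL E G (rightLogDeriv c t) := by
      rw [← fderiv_apply_one_eq_deriv]
      exact DFunLike.congr_fun this 1
    rw [← h2]
    exact hd.hasDerivAt
  have h3 := h1.clm_comp (hasDerivAt_const t (Ad E (c t)))
  have e : (fun s => Ad E (c s)) = fun s => (Ad E (c s * (c t)⁻¹)).comp (Ad E (c t)) := by
    ext1 s
    rw [← Ad_mul, inv_mul_cancel_right]
  rw [e]
  simpa using h3

theorem iteratedDeriv_Ad_rightLogDeriv (c b : SmoothCurve E G) (m : ℕ) (t : ℝ) :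
    iteratedDeriv m (fun s => Ad E (c s) (rightLogDeriv b s)) t =
      ∑ p : OrderedFinpartition (m + 1), chain (adL E G)
        (fun i => iteratedDeriv (i - 1) (rightLogDeriv c) t)
        (fun i => iteratedDeriv (i - 1) (rightLogDeriv b) t) (List.ofFn p.partSize)
        (Ad E (c t)) := by
  induction m generalizing t with
  | zero =>
    have h1 : List.ofFn (default : OrderedFinpartition 1).partSize = [1] := rfl
    change _ = ∑ p : OrderedFinpartition 1, chain (adL E G) _ _ (List.ofFn p.partSize) _
    rw [Fintype.sum_unique, h1]
    simp [chain]
  | succ m ih =>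
    rw [iteratedDeriv_succ, funext ih]
    have hδ : ∀ (d : SmoothCurve E G) (i : ℕ), 1 ≤ i →
        HasDerivAt (iteratedDeriv (i - 1) (rightLogDeriv (d : ℝ → G) : ℝ → E))
          (iteratedDeriv (i + 1 - 1) (rightLogDeriv (d : ℝ → G)) t) t := by
      intro d i hi
      obtain ⟨j, rfl⟩ : ∃ j, i = j + 1 := ⟨i - 1, by omega⟩
      simp only [Nat.add_sub_cancel]
      rw [iteratedDeriv_succ]
      exact (((contDiff_rightLogDeriv d).differentiable_iteratedDeriv j
        (by exact_mod_cast ENat.natCast_lt_top j)) t).hasDerivAt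
    have hl : ∀ p : OrderedFinpartition (m + 1), ∀ i ∈ List.ofFn p.partSize, 1 ≤ i := by
      intro p i hi
      obtain ⟨a, rfl⟩ := List.mem_ofFn.1 hi
      exact p.partSize_pos a
    have hne : ∀ p : OrderedFinpartition (m + 1), List.ofFn p.partSize ≠ [] := fun p h => by
      have := p.length_pos (by omega)
      rw [List.ofFn_eq_nil_iff] at h
      omega
    rw [(HasDerivAt.fun_sum fun p _ => hasDerivAt_chain (adL E G) (hδ c) (hδ b) (hl p)
      (hasDerivAt_Ad c t)).deriv, sum_orderedFinpartition_succ (m + 1) fun l => chain (adL E G)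
        (fun i => iteratedDeriv (i - 1) (rightLogDeriv c) t)
        (fun i => iteratedDeriv (i - 1) (rightLogDeriv b) t) l (Ad E (c t))]
    refine Finset.sum_congr rfl fun p _ => ?_
    congr 1
    rw [chain_cons _ _ _ _ (hne p)]
    simp

end LogDerivMul

section JetGroup

open Filter Topology

variable {E : Type*} [NormedAddCommGroup E] [NormedSpace ℝ E]
  {G : Type*} [TopologicalSpace G] [ChartedSpace E G] [Group G]

omit [NormedSpace ℝ E] in
theorem jetComp_of_mem {n : ℕ} (x : Fin n → E) {i : ℕ} (h : 1 ≤ i ∧ i ≤ n) :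
    jetComp x i = x ⟨i - 1, by omega⟩ := dif_pos h

omit [NormedSpace ℝ E] in
theorem jetComp_zero_index {n : ℕ} (x : Fin n → E) : jetComp x 0 = 0 := dif_neg (by omega)

omit [NormedSpace ℝ E] in
theorem jetComp_zero (n i : ℕ) : jetComp (0 : Fin n → E) i = 0 := by
  unfold jetComp
  split_ifs <;> rfl

theorem jetComp_rightTriv {n : ℕ} (c : SmoothCurve E G) {i : ℕ} (h : 1 ≤ i ∧ i ≤ n) :
    jetComp (rightTriv n c).2 i = iteratedDeriv (i - 1) (rightLogDeriv (c : ℝ → G)) 0 :=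
  jetComp_of_mem _ h

theorem partitionNumber_singleton (i : ℕ) : partitionNumber [i] = 1 := by simp [partitionNumber]

theorem groupCocycle_eq_sum_composition (k : ℕ) (a b : TrivJet E G k) : groupCocycle k a b =
    ∑ i : Composition (k + 1) with i.length ≠ 1,
      partitionNumber i.blocks • cocycleTerm a b i.blocks := by
  have := sum_orderedFinpartition (k + 1)
    fun l => if l.length ≠ 1 then cocycleTerm a b l else 0
  simp only [List.length_ofFn, Composition.blocks_length, smul_ite, smul_zero] at this
  rw [groupCocycle, Finset.sum_filter, this, Finset.sum_filter]

theorem groupCocycle_eq_sum_sum (k : ℕ) (a b : TrivJet E G k) : groupCocycle k a b =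
    ∑ l ∈ Finset.Icc 2 (k + 1), ∑ i : Composition (k + 1) with i.length = l,
      partitionNumber i.blocks • cocycleTerm a b i.blocks := by
  rw [groupCocycle_eq_sum_composition, ← Finset.sum_fiberwise_of_maps_to
    (s := Finset.univ.filter fun i : Composition (k + 1) => i.length ≠ 1)
    (t := Finset.Icc 2 (k + 1)) (g := fun i => i.length)]
  · refine Finset.sum_congr rfl fun l hl => Finset.sum_congr ?_ fun _ _ => rfl
    rw [Finset.mem_Icc] at hl
    ext i
    simp only [Finset.mem_filter, Finset.mem_univ, true_and]
    constructor
    · exact fun h => h.2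
    · rintro rfl
      exact ⟨by omega, rfl⟩
  · intro i hi
    have := (Finset.mem_filter.1 hi).2
    have h1 := i.length_le
    have h2 := i.length_pos_of_pos (Nat.succ_pos k)
    rw [Finset.mem_Icc]
    omega

variable [LieGroup 𝓘(ℝ, E) ∞ G]

theorem cocycleTerm_eq_chain [CompleteSpace E] {k : ℕ} (a b : TrivJet E G k) (l : List ℕ) :
    cocycleTerm a b l = chain (adL E G) (jetComp a.2) (jetComp b.2) l (Ad E a.1) := by
  rcases eq_or_ne l [] with rfl | hl
  · simp [cocycleTerm, chain, jetComp_zero_index]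
  · rw [chain_eq_foldl _ _ _ hl, cocycleTerm]
    simp only [adL_apply]

theorem blocks_le_of_length_ne_one {k : ℕ} {i : Composition (k + 1)} (hi : i.length ≠ 1) {r : ℕ}
    (hr : r ∈ i.blocks) : r ≤ k := by
  have h1 := i.blocks_sum
  have h3 := i.blocks_length
  obtain ⟨l₁, l₂, h⟩ := List.append_of_mem hr
  have hpos : ∀ j ∈ i.blocks, 0 < j := fun j hj => i.blocks_pos hj
  have : 1 ≤ (l₁ ++ l₂).sum := by
    rcases hl : l₁ ++ l₂ with _ | ⟨j, l⟩
    · rw [List.append_eq_nil_iff] at hl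
      rw [h, hl.1, hl.2] at h3
      exact absurd h3.symm hi
    · have : j ∈ l₁ ++ l₂ := by rw [hl]; simp
      have := hpos j (by rw [h]; simp only [List.mem_append, List.mem_cons] at this ⊢; tauto)
      simp only [List.sum_cons]; omega
  rw [h] at h1
  simp only [List.sum_append, List.sum_cons] at h1 this
  omega

theorem iteratedDeriv_rightLogDeriv_mul [CompleteSpace E] (k : ℕ) (c b : SmoothCurve E G) :
    iteratedDeriv k (rightLogDeriv (c * b : SmoothCurve E G)) 0 =
      iteratedDeriv k (rightLogDeriv c) 0 + Ad E (c 0) (iteratedDeriv k (rightLogDeriv b) 0) +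
        groupCocycle k (rightTriv k c) (rightTriv k b) := by
  have hc := contDiff_rightLogDeriv c
  have hAd : ContDiff ℝ ∞ (fun s => Ad E (c s) (rightLogDeriv b s)) := by
    refine ContDiff.clm_apply ?_ (contDiff_rightLogDeriv b)
    exact (contMDiff_Ad.comp c.contMDiff).contDiff
  have e : (rightLogDeriv (c * b : SmoothCurve E G) : ℝ → E) =
      rightLogDeriv c + fun s => Ad E (c s) (rightLogDeriv b s) :=
    funext fun t => rightLogDeriv_mul c b t
  rw [e, iteratedDeriv_add (contDiffAt_natCast hc.contDiffAt)
    (contDiffAt_natCast hAd.contDiffAt), iteratedDeriv_Ad_rightLogDeriv, add_assoc]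
  congr 1
  rw [sum_orderedFinpartition (k + 1) fun l => chain (adL E G)
        (fun i => iteratedDeriv (i - 1) (rightLogDeriv c) 0)
        (fun i => iteratedDeriv (i - 1) (rightLogDeriv b) 0) l (Ad E (c 0)),
    groupCocycle_eq_sum_composition,
    ← Finset.sum_filter_add_sum_filter_not _ (fun i : Composition (k + 1) => i.length = 1)]
  congr 1
  · have : (Finset.univ.filter fun i : Composition (k + 1) => i.length = 1) =
        {Composition.single (k + 1) k.succ_pos} := by
      ext i
      rw [Finset.mem_singleton, Composition.eq_single_iff_length]
      simp
    rw [this, Finset.sum_singleton, Composition.single_blocks, partitionNumber_singleton]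
    simp [chain]
  · refine Finset.sum_congr rfl fun i hi => ?_
    have hi' := (Finset.mem_filter.1 hi).2
    rw [cocycleTerm_eq_chain]
    refine congrArg _ (chain_congr _ (fun r hr => ?_) (fun r hr => ?_) _)
    all_goals exact (jetComp_rightTriv _ ⟨i.blocks_pos hr, blocks_le_of_length_ne_one hi' hr⟩).symm

/-- The group structure on `G × 𝔤^n` transported from the jet group `J^n G`. -/
noncomputable abbrev trivJetGroup (n : ℕ) : Group (TrivJet E G n) := (jetEquiv E G n).symm.group

attribute [local instance] trivJetGroup

theorem rightTriv_mul (n : ℕ) (c b : SmoothCurve E G) :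
    rightTriv n (c * b) = rightTriv n c * rightTriv n b := by
  change _ = jetEquiv E G n ((jetEquiv E G n).symm (rightTriv n c) *
    (jetEquiv E G n).symm (rightTriv n b))
  rw [← jetEquiv_jet, ← jetEquiv_jet, ← jetEquiv_jet, Equiv.symm_apply_apply,
    Equiv.symm_apply_apply]
  rfl

theorem rightTriv_one (n : ℕ) : rightTriv n (1 : SmoothCurve E G) = 1 := rfl

omit [LieGroup 𝓘(ℝ, E) ∞ G] in
theorem truncate_rightTriv (k : ℕ) (c : SmoothCurve E G) :
    truncate k (rightTriv (k + 1) c) = rightTriv k c := rfl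

omit [LieGroup 𝓘(ℝ, E) ∞ G] in
theorem rightLogDeriv_one : (rightLogDeriv (1 : SmoothCurve E G) : ℝ → E) = 0 := by
  ext t
  have : (fun s : ℝ => (1 : SmoothCurve E G) s * ((1 : SmoothCurve E G) t)⁻¹) = fun _ => 1 := by
    ext s; simp
  rw [rightLogDeriv_eq_tderiv, this, tderiv_const]
  rfl

theorem trivJet_one (n : ℕ) : (1 : TrivJet E G n) = ((1 : G), (0 : Fin n → E)) := by
  rw [← rightTriv_one]
  refine Prod.ext rfl (funext fun j => ?_)
  simp only [rightTriv, rightLogDeriv_one]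
  simp

theorem trivJet_mul_fst (n : ℕ) (a b : TrivJet E G n) : (a * b).1 = a.1 * b.1 := by
  obtain ⟨c, rfl⟩ := rightTriv_surjective n a
  obtain ⟨d, rfl⟩ := rightTriv_surjective n b
  rw [← rightTriv_mul]
  rfl

theorem truncate_mul (k : ℕ) (a b : TrivJet E G (k + 1)) :
    truncate k (a * b) = truncate k a * truncate k b := by
  obtain ⟨c, rfl⟩ := rightTriv_surjective _ a
  obtain ⟨d, rfl⟩ := rightTriv_surjective _ b
  rw [← rightTriv_mul, truncate_rightTriv, truncate_rightTriv, truncate_rightTriv, rightTriv_mul]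

theorem trivJet_mul_last [CompleteSpace E] (k : ℕ) (a b : TrivJet E G (k + 1)) :
    (a * b).2 (Fin.last k) = a.2 (Fin.last k) + Ad E a.1 (b.2 (Fin.last k)) +
      groupCocycle k (truncate k a) (truncate k b) := by
  obtain ⟨c, rfl⟩ := rightTriv_surjective _ a
  obtain ⟨d, rfl⟩ := rightTriv_surjective _ b
  rw [← rightTriv_mul, truncate_rightTriv, truncate_rightTriv]
  exact iteratedDeriv_rightLogDeriv_mul k c d

theorem trivJet_ext {E G : Type*} {k : ℕ} {a b : TrivJet E G (k + 1)}
    (h : truncate k a = truncate k b)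
    (h' : a.2 (Fin.last k) = b.2 (Fin.last k)) : a = b := by
  obtain ⟨a, x⟩ := a
  obtain ⟨b, y⟩ := b
  simp only [truncate, Prod.mk.injEq] at h
  refine Prod.ext h.1 ?_
  change x = y
  rw [← Fin.snoc_init_self x, ← Fin.snoc_init_self y, h.2]
  exact congrArg _ h'

end JetGroup

section JetLieGroup

open Filter Topology

variable {E : Type*} [NormedAddCommGroup E] [NormedSpace ℝ E]
  {G : Type*} [TopologicalSpace G] [ChartedSpace E G]
  {EM : Type*} [NormedAddCommGroup EM] [NormedSpace ℝ EM] {HM : Type*} [TopologicalSpace HM]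
  {I : ModelWithCorners ℝ EM HM} {M : Type*} [TopologicalSpace M] [ChartedSpace HM M]

theorem contMDiff_trivJet_iff {n : ℕ} {f : M → TrivJet E G n} :
    ContMDiff I (trivJetModel E n) ∞ f ↔ ContMDiff I 𝓘(ℝ, E) ∞ (fun x => (f x).1) ∧
      ∀ j, ContMDiff I 𝓘(ℝ, E) ∞ (fun x => (f x).2 j) := by
  rw [contMDiff_prod_iff]
  refine and_congr Iff.rfl ?_
  exact contMDiff_pi_space

theorem contMDiff_trivJet_succ_iff {k : ℕ} {f : M → TrivJet E G (k + 1)} :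
    ContMDiff I (trivJetModel E (k + 1)) ∞ f ↔
      ContMDiff I (trivJetModel E k) ∞ (fun x => truncate k (f x)) ∧
      ContMDiff I 𝓘(ℝ, E) ∞ (fun x => (f x).2 (Fin.last k)) := by
  rw [contMDiff_trivJet_iff, contMDiff_trivJet_iff, Fin.forall_fin_succ', and_assoc]
  rfl

theorem contMDiff_truncate (k : ℕ) :
    ContMDiff (trivJetModel E (k + 1)) (trivJetModel E k) ∞
      (truncate k : TrivJet E G (k + 1) → _) :=
  (contMDiff_trivJet_succ_iff.1 contMDiff_id).1

theorem contMDiff_trivJet_last (k : ℕ) : ContMDiff (trivJetModel E (k + 1)) 𝓘(ℝ, E) ∞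
    (fun a : TrivJet E G (k + 1) => a.2 (Fin.last k)) :=
  (contMDiff_trivJet_succ_iff.1 contMDiff_id).2

omit [NormedSpace ℝ E] [TopologicalSpace G] [ChartedSpace E G] in
theorem truncate_zeroSection (k : ℕ) (a : TrivJet E G k) : truncate k (zeroSection k a) = a := by
  simp [truncate, zeroSection]

omit [NormedSpace ℝ E] [TopologicalSpace G] [ChartedSpace E G] in
theorem zeroSection_last (k : ℕ) (a : TrivJet E G k) : (zeroSection k a).2 (Fin.last k) = 0 := by
  simp [zeroSection]

theorem contMDiff_zeroSection (k : ℕ) :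
    ContMDiff (trivJetModel E k) (trivJetModel E (k + 1)) ∞
      (zeroSection k : TrivJet E G k → _) := by
  rw [contMDiff_trivJet_succ_iff]
  constructor
  · simp only [truncate_zeroSection]
    exact contMDiff_id
  · simp only [zeroSection_last]
    exact contMDiff_const

theorem contMDiff_trivJet_fst (n : ℕ) :
    ContMDiff (trivJetModel E n) 𝓘(ℝ, E) ∞ (fun a : TrivJet E G n => a.1) :=
  (contMDiff_trivJet_iff.1 contMDiff_id).1

theorem ContMDiff.jetComp {n : ℕ} {f : M → TrivJet E G n} (hf : ContMDiff I (trivJetModel E n) ∞ f)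
    (i : ℕ) : ContMDiff I 𝓘(ℝ, E) ∞ (fun x => jetComp (f x).2 i) := by
  by_cases h : 1 ≤ i ∧ i ≤ n
  · simp only [jetComp_of_mem _ h]
    exact (contMDiff_trivJet_iff.1 hf).2 _
  · simp only [_root_.jetComp, dif_neg h]
    exact contMDiff_const

theorem ContMDiff.chain (D : E →L[ℝ] E →L[ℝ] E) {x y : ℕ → M → E}
    (hx : ∀ i, ContMDiff I 𝓘(ℝ, E) ∞ (x i)) (hy : ∀ i, ContMDiff I 𝓘(ℝ, E) ∞ (y i)) (l : List ℕ)
    {P : M → E →L[ℝ] E} (hP : ContMDiff I 𝓘(ℝ, E →L[ℝ] E) ∞ P) : ContMDiff I 𝓘(ℝ, E) ∞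
      (fun m => chain D (fun i => x i m) (fun i => y i m) l (P m)) := by
  induction l generalizing P with
  | nil => exact contMDiff_const
  | cons i l ih =>
    rcases eq_or_ne l [] with rfl | hl
    · exact hP.clm_apply (hy i)
    · simp only [chain_cons D _ _ i hl]
      exact ih ((D.contMDiff.comp (hx i)).clm_comp hP)

variable [Group G]

omit [NormedSpace ℝ E] [TopologicalSpace G] [ChartedSpace E G] in
theorem truncate_topInclusion_eq (k : ℕ) (v : E) :
    truncate k (topInclusion G k v) = ((1 : G), (0 : Fin k → E)) := by
  simp [truncate, topInclusion]

omit [NormedSpace ℝ E] [TopologicalSpace G] [ChartedSpace E G] in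
theorem topInclusion_last (k : ℕ) (v : E) : (topInclusion G k v).2 (Fin.last k) = v := by
  simp [topInclusion]

theorem contMDiff_topInclusion (k : ℕ) :
    ContMDiff 𝓘(ℝ, E) (trivJetModel E (k + 1)) ∞ (topInclusion G k : E → _) := by
  rw [contMDiff_trivJet_succ_iff]
  constructor
  · simp only [truncate_topInclusion_eq]
    exact contMDiff_const
  · simp only [topInclusion_last]
    exact contMDiff_id

variable [LieGroup 𝓘(ℝ, E) ∞ G] [CompleteSpace E]

theorem ContMDiff.groupCocycle {k : ℕ} {a b : M → TrivJet E G k}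
    (ha : ContMDiff I (trivJetModel E k) ∞ a) (hb : ContMDiff I (trivJetModel E k) ∞ b) :
    ContMDiff I 𝓘(ℝ, E) ∞ (fun m => groupCocycle k (a m) (b m)) := by
  simp only [_root_.groupCocycle, cocycleTerm_eq_chain]
  exact contMDiff_finsetSum fun p _ => ContMDiff.chain (adL E G) ha.jetComp hb.jetComp _
    (contMDiff_Ad.comp ((contMDiff_trivJet_fst k).comp ha))

attribute [local instance] trivJetGroup

omit [CompleteSpace E] in
theorem trivJet_inv_fst {n : ℕ} (a : TrivJet E G n) : (a⁻¹).1 = a.1⁻¹ := by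
  have h := trivJet_mul_fst n a a⁻¹
  rw [mul_inv_cancel, trivJet_one] at h
  exact (inv_eq_of_mul_eq_one_right h.symm).symm

omit [CompleteSpace E] in
theorem truncate_one (k : ℕ) : truncate k (1 : TrivJet E G (k + 1)) = 1 := by
  rw [trivJet_one, trivJet_one]
  rfl

omit [CompleteSpace E] in
theorem truncate_inv {k : ℕ} (a : TrivJet E G (k + 1)) : truncate k a⁻¹ = (truncate k a)⁻¹ := by
  have h := truncate_mul k a a⁻¹
  rw [mul_inv_cancel, truncate_one] at h
  exact (inv_eq_of_mul_eq_one_right h.symm).symm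

theorem trivJet_inv_last {k : ℕ} (a : TrivJet E G (k + 1)) : (a⁻¹).2 (Fin.last k) =
    -Ad E (a.1⁻¹) (a.2 (Fin.last k) + groupCocycle k (truncate k a) (truncate k a)⁻¹) := by
  have h := trivJet_mul_last k a a⁻¹
  rw [mul_inv_cancel, trivJet_one, truncate_inv] at h
  have h2 := congrArg (Ad E a.1⁻¹) h
  have h3 : Ad E a.1⁻¹ (Ad E a.1 ((a⁻¹).2 (Fin.last k))) = (a⁻¹).2 (Fin.last k) := by
    rw [← ContinuousLinearMap.comp_apply, ← Ad_mul, inv_mul_cancel, Ad_one]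
    rfl
  simp only [Pi.zero_apply, map_zero, map_add, h3] at h2
  rw [map_add, eq_neg_iff_add_eq_zero, h2]
  abel

theorem contMDiff_trivJet_mul (n : ℕ) :
    ContMDiff ((trivJetModel E n).prod (trivJetModel E n)) (trivJetModel E n) ∞
      (fun p : TrivJet E G n × TrivJet E G n => p.1 * p.2) := by
  induction n with
  | zero =>
    rw [contMDiff_trivJet_iff]
    refine ⟨?_, fun j => j.elim0⟩
    simp only [trivJet_mul_fst]
    exact ((contMDiff_trivJet_fst 0).comp contMDiff_fst).mul
      ((contMDiff_trivJet_fst 0).comp contMDiff_snd)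
  | succ k ih =>
    have h1 := (contMDiff_truncate (E := E) (G := G) k).comp
      (contMDiff_fst (I := trivJetModel E (k + 1)) (J := trivJetModel E (k + 1))
        (N := TrivJet E G (k + 1)))
    have h2 := (contMDiff_truncate (E := E) (G := G) k).comp
      (contMDiff_snd (I := trivJetModel E (k + 1)) (J := trivJetModel E (k + 1))
        (M := TrivJet E G (k + 1)))
    rw [contMDiff_trivJet_succ_iff]
    constructor
    · simp only [truncate_mul]
      exact ih.comp (h1.prodMk h2)
    · simp only [trivJet_mul_last]
      refine (((contMDiff_trivJet_last k).comp contMDiff_fst).add ?_).add (h1.groupCocycle h2)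
      exact (contMDiff_Ad.comp ((contMDiff_trivJet_fst _).comp contMDiff_fst)).clm_apply
        ((contMDiff_trivJet_last k).comp contMDiff_snd)

theorem contMDiff_trivJet_inv (n : ℕ) :
    ContMDiff (trivJetModel E n) (trivJetModel E n) ∞ (fun a : TrivJet E G n => a⁻¹) := by
  induction n with
  | zero =>
    rw [contMDiff_trivJet_iff]
    refine ⟨?_, fun j => j.elim0⟩
    simp only [trivJet_inv_fst]
    exact (contMDiff_trivJet_fst 0).inv
  | succ k ih =>
    have h1 := contMDiff_truncate (E := E) (G := G) k
    rw [contMDiff_trivJet_succ_iff]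
    constructor
    · simp only [truncate_inv]
      exact ih.comp h1
    · simp only [trivJet_inv_last]
      refine ContMDiff.neg ?_
      exact (contMDiff_Ad.comp (contMDiff_trivJet_fst _).inv).clm_apply
        ((contMDiff_trivJet_last k).add (h1.groupCocycle (ih.comp h1)))

theorem trivJet_lieGroup (n : ℕ) : LieGroup (trivJetModel E n) ∞ (TrivJet E G n) := by
  have : IsManifold 𝓘(ℝ, E) ∞ G := inferInstance
  have : IsManifold (trivJetModel E n) ∞ (TrivJet E G n) := inferInstance
  exact { contMDiff_mul := contMDiff_trivJet_mul n, contMDiff_inv := contMDiff_trivJet_inv n }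

end JetLieGroup

section JetGroupExtension

open Filter Topology

variable {E : Type*} [NormedAddCommGroup E] [NormedSpace ℝ E]

theorem chain_zero (D : E →L[ℝ] E →L[ℝ] E) (x y : ℕ → E) (l : List ℕ) : chain D x y l 0 = 0 := by
  simpa using chain_add D x y l 0 0

theorem chain_zero_left (D : E →L[ℝ] E →L[ℝ] E) (y : ℕ → E) {l : List ℕ} (hl : l.length ≠ 1)
    (P : E →L[ℝ] E) : chain D (fun _ => 0) y l P = 0 := by
  match l, hl with
  | [], _ => rfl
  | i :: j :: l, _ => rw [chain, map_zero, ContinuousLinearMap.zero_comp, chain_zero]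

theorem chain_zero_right (D : E →L[ℝ] E →L[ℝ] E) (x : ℕ → E) (l : List ℕ)
    (P : E →L[ℝ] E) : chain D x (fun _ => 0) l P = 0 := by
  induction l generalizing P with
  | nil => rfl
  | cons i l ih =>
    rcases eq_or_ne l [] with rfl | hl
    · simp [chain]
    · rw [chain_cons D _ _ i hl, ih]

variable {G : Type*} [TopologicalSpace G] [ChartedSpace E G] [Group G] [LieGroup 𝓘(ℝ, E) ∞ G]
  [CompleteSpace E]

theorem groupCocycle_of_left_eq_zero {k : ℕ} {a : TrivJet E G k} (ha : a.2 = 0)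
    (b : TrivJet E G k) : groupCocycle k a b = 0 := by
  refine Finset.sum_eq_zero fun p hp => ?_
  rw [cocycleTerm_eq_chain, ha, funext (jetComp_zero k)]
  exact chain_zero_left _ _ (by simpa using hp) _

theorem groupCocycle_of_right_eq_zero {k : ℕ} (a : TrivJet E G k) {b : TrivJet E G k}
    (hb : b.2 = 0) : groupCocycle k a b = 0 := by
  refine Finset.sum_eq_zero fun p _ => ?_
  rw [cocycleTerm_eq_chain, hb, funext (jetComp_zero k)]
  exact chain_zero_right _ _ _ _

attribute [local instance] trivJetGroup

omit [CompleteSpace E] in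
theorem truncate_topInclusion (k : ℕ) (v : E) : truncate k (topInclusion G k v) = 1 := by
  rw [truncate_topInclusion_eq, trivJet_one]

theorem groupCocycle_one_left {k : ℕ} (b : TrivJet E G k) : groupCocycle k 1 b = 0 :=
  groupCocycle_of_left_eq_zero (by rw [trivJet_one]) b

theorem groupCocycle_one_right {k : ℕ} (a : TrivJet E G k) : groupCocycle k a 1 = 0 :=
  groupCocycle_of_right_eq_zero a (by rw [trivJet_one])

theorem topInclusion_mul {k : ℕ} (v : E) (a : TrivJet E G (k + 1)) :
    topInclusion G k v * a = (a.1, Fin.snoc (Fin.init a.2) (v + a.2 (Fin.last k))) := by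
  refine trivJet_ext ?_ ?_
  · rw [truncate_mul, truncate_topInclusion, one_mul]
    simp [truncate]
  · rw [trivJet_mul_last, truncate_topInclusion, groupCocycle_one_left, topInclusion_last,
      show (topInclusion G k v).1 = 1 from rfl, Ad_one]
    simp

theorem topInclusion_add (k : ℕ) (v w : E) :
    topInclusion G k (v + w) = topInclusion G k v * topInclusion G k w := by
  rw [topInclusion_mul, topInclusion_last]
  simp [topInclusion]

theorem topInclusion_mul_zeroSection {k : ℕ} (v : E) (a : TrivJet E G k) :
    topInclusion G k v * zeroSection k a = (a.1, Fin.snoc a.2 v) := by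
  rw [topInclusion_mul, zeroSection_last, add_zero]
  simp [zeroSection]

theorem mul_topInclusion {k : ℕ} (a : TrivJet E G (k + 1)) (v : E) :
    a * topInclusion G k v = topInclusion G k (Ad E a.1 v) * a := by
  rw [topInclusion_mul]
  refine trivJet_ext ?_ ?_
  · rw [truncate_mul, truncate_topInclusion, mul_one]
    simp [truncate]
  · rw [trivJet_mul_last, truncate_topInclusion, groupCocycle_one_right, topInclusion_last]
    simp [add_comm]

theorem zeroSection_mul_zeroSection (k : ℕ) (a b : TrivJet E G k) :
    zeroSection k a * zeroSection k b =
      topInclusion G k (groupCocycle k a b) * zeroSection k (a * b) := by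
  refine trivJet_ext ?_ ?_
  · rw [truncate_mul, truncate_mul, truncate_topInclusion, one_mul]
    simp only [truncate_zeroSection]
  · rw [topInclusion_mul_zeroSection, trivJet_mul_last]
    simp [zeroSection_last, truncate_zeroSection]

theorem groupCocycle_isCocycle (k : ℕ) (a b d : TrivJet E G k) :
    groupCocycle k a b + groupCocycle k (a * b) d =
      Ad E a.1 (groupCocycle k b d) + groupCocycle k a (b * d) := by
  have h := congrArg (fun x => x.2 (Fin.last k))
    (mul_assoc (zeroSection k a) (zeroSection k b) (zeroSection k d))
  have e : ∀ a b : TrivJet E G k, (zeroSection k a * zeroSection k b).2 (Fin.last k) =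
      groupCocycle k a b := by
    intro a b
    rw [zeroSection_mul_zeroSection, topInclusion_mul_zeroSection]
    simp
  simp only [trivJet_mul_last _ (_ * _), trivJet_mul_last _ (zeroSection k a), e, truncate_mul,
    truncate_zeroSection, zeroSection_last] at h
  simpa [zeroSection] using h

variable (E G) in
/-- The extension `𝔤 → J^{k+1} G → J^k G` given by the projection of jets. -/
noncomputable def jetGroupExtension (k : ℕ) :
    GroupExtension (Multiplicative E) (TrivJet E G (k + 1)) (TrivJet E G k) where
  inl :=
    { toFun := fun v => topInclusion G k v.toAdd
      map_one' := by
        refine trivJet_ext ((truncate_topInclusion k _).trans (truncate_one k).symm) ?_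
        rw [topInclusion_last, trivJet_one]
        rfl
      map_mul' := fun v w => topInclusion_add k v.toAdd w.toAdd }
  rightHom :=
    { toFun := truncate k
      map_one' := truncate_one k
      map_mul' := truncate_mul k }
  inl_injective := by
    intro v w h
    have := congrArg (fun x : TrivJet E G (k + 1) => x.2 (Fin.last k)) h
    simpa [topInclusion] using this
  range_inl_eq_ker_rightHom := by
    ext a
    rw [MonoidHom.mem_range, MonoidHom.mem_ker]
    constructor
    · rintro ⟨v, rfl⟩
      exact truncate_topInclusion k _
    · intro h
      refine ⟨Multiplicative.ofAdd (a.2 (Fin.last k)), trivJet_ext ?_ ?_⟩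
      · exact (truncate_topInclusion k _).trans h.symm
      · exact topInclusion_last k _
  rightHom_surjective := fun a => ⟨zeroSection k a, truncate_zeroSection k a⟩

variable (E G) in
theorem isAbelianLieGroupExtension_jetGroupExtension (k : ℕ) :
    IsAbelianLieGroupExtension (trivJetModel E (k + 1)) (trivJetModel E k)
      (jetGroupExtension E G k) (zeroSection k) (fun a => Ad E a.1) (groupCocycle k) where
  contMDiff_inl := contMDiff_topInclusion k
  contMDiff_rightHom := contMDiff_truncate k
  contMDiff_section := contMDiff_zeroSection k
  rightHom_section := truncate_zeroSection k
  trivialization := by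
    refine ⟨⟨⟨fun q => (q.1.1, Fin.snoc q.1.2 q.2), fun a => (truncate k a, a.2 (Fin.last k)),
      fun q => ?_, fun a => ?_⟩, ?_, ?_⟩, fun b v => (topInclusion_mul_zeroSection v b).symm⟩
    · simp [truncate]
    · simp [truncate]
    · rw [contMDiff_trivJet_succ_iff]
      constructor
      · simpa [truncate] using contMDiff_fst
      · simpa using contMDiff_snd
    · exact (contMDiff_truncate k).prodMk (contMDiff_trivJet_last k)
  action_one v := by
    rw [trivJet_one]
    change Ad E (1 : G) v = v
    rw [Ad_one]
    rfl
  action_mul a b v := by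
    rw [trivJet_mul_fst, Ad_mul]
    rfl
  contMDiff_action :=
    (contMDiff_Ad.comp ((contMDiff_trivJet_fst k).comp contMDiff_fst)).clm_apply contMDiff_snd
  conj_inl a v := by
    rw [mul_inv_eq_iff_eq_mul]
    exact mul_topInclusion a v
  contMDiff_cocycle := contMDiff_fst.groupCocycle contMDiff_snd
  cocycle := groupCocycle_isCocycle k
  section_mul := zeroSection_mul_zeroSection k

end JetGroupExtension

section DerivOfSum

variable {E : Type*} [NormedAddCommGroup E] [NormedSpace ℝ E] {H : Type*} [TopologicalSpace H]
  {I : ModelWithCorners ℝ E H} {M : Type*} [TopologicalSpace M] [ChartedSpace H M]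
  {F : Type*} [NormedAddCommGroup F] [NormedSpace ℝ F]
  {F' : Type*} [NormedAddCommGroup F'] [NormedSpace ℝ F']

theorem tderiv_add {f g : M → F} {x : M} (hf : MDifferentiableAt I 𝓘(ℝ, F) f x)
    (hg : MDifferentiableAt I 𝓘(ℝ, F) g x) : tderiv I 𝓘(ℝ, F) (fun y => f y + g y) x =
      tderiv I 𝓘(ℝ, F) f x + tderiv I 𝓘(ℝ, F) g x :=
  mfderiv_add hf hg

theorem tderiv_clm_comp (L : F →L[ℝ] F') {f : M → F} {x : M}
    (hf : MDifferentiableAt I 𝓘(ℝ, F) f x) :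
    tderiv I 𝓘(ℝ, F') (fun y => L (f y)) x = L.comp (tderiv I 𝓘(ℝ, F) f x) := by
  have h := tderiv_comp (I'' := 𝓘(ℝ, F')) (g := L) (L.differentiableAt.mdifferentiableAt) hf
  rwa [tderiv_eq_fderiv, L.fderiv] at h

theorem tderiv_sum {ι : Type} (s : Finset ι) {f : ι → M → F} {x : M}
    (hf : ∀ i ∈ s, MDifferentiableAt I 𝓘(ℝ, F) (f i) x) :
    tderiv I 𝓘(ℝ, F) (fun y => ∑ i ∈ s, f i y) x = ∑ i ∈ s, tderiv I 𝓘(ℝ, F) (f i) x := by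
  have h := (HasMFDerivAt.sum (t := s) (f := f) (f' := fun i => mfderiv I 𝓘(ℝ, F) (f i) x)
    fun i hi => (hf i hi).hasMFDerivAt).mfderiv
  have e : (∑ i ∈ s, f i) = fun y => ∑ i ∈ s, f i y := by
    ext y
    exact Finset.sum_apply y s f
  rw [e] at h
  exact h

theorem tderiv_nsmul (n : ℕ) {f : M → F} {x : M} (hf : MDifferentiableAt I 𝓘(ℝ, F) f x) :
    tderiv I 𝓘(ℝ, F) (fun y => n • f y) x = n • tderiv I 𝓘(ℝ, F) f x :=
  tderiv_clm_comp (n • ContinuousLinearMap.id ℝ F) hf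

theorem mdifferentiableAt_nsmul (n : ℕ) {f : M → F} {x : M}
    (hf : MDifferentiableAt I 𝓘(ℝ, F) f x) :
    MDifferentiableAt I 𝓘(ℝ, F) (fun y => n • f y) x :=
  MDifferentiableAt.comp x (g := n • ContinuousLinearMap.id ℝ F)
    (n • ContinuousLinearMap.id ℝ F).differentiableAt.mdifferentiableAt hf

end DerivOfSum

section JetTangent

open Filter Topology

variable {E : Type*} [NormedAddCommGroup E] [NormedSpace ℝ E]
  {G : Type*} [TopologicalSpace G] [ChartedSpace E G]
  {EM : Type*} [NormedAddCommGroup EM] [NormedSpace ℝ EM] {HM : Type*} [TopologicalSpace HM]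
  {I : ModelWithCorners ℝ EM HM} {M : Type*} [TopologicalSpace M] [ChartedSpace HM M]

theorem tderiv_trivJet_fst {n : ℕ} (a : TrivJet E G n) (X : E × (Fin n → E)) :
    tderiv (trivJetModel E n) 𝓘(ℝ, E) (fun a : TrivJet E G n => a.1) a X = X.1 := by
  have h : tderiv (trivJetModel E n) 𝓘(ℝ, E) (fun a : TrivJet E G n => a.1) a =
    ContinuousLinearMap.fst ℝ E (Fin n → E) := mfderiv_fst
  rw [h]
  rfl

theorem tderiv_trivJet_snd {n : ℕ} (a : TrivJet E G n) :
    tderiv (trivJetModel E n) 𝓘(ℝ, Fin n → E) (fun a : TrivJet E G n => a.2) a =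
    ContinuousLinearMap.snd ℝ E (Fin n → E) := mfderiv_snd

theorem tderiv_trivJet_comp_snd {n : ℕ} {F : Type*} [NormedAddCommGroup F] [NormedSpace ℝ F]
    (L : (Fin n → E) →L[ℝ] F) (a : TrivJet E G n) (X : E × (Fin n → E)) :
    tderiv (trivJetModel E n) 𝓘(ℝ, F) (fun a : TrivJet E G n => L a.2) a X = L X.2 := by
  rw [tderiv_clm_comp L mdifferentiableAt_snd, tderiv_trivJet_snd]
  rfl

theorem tderiv_trivJet_apply {n : ℕ} (a : TrivJet E G n) (j : Fin n) (X : E × (Fin n → E)) :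
    tderiv (trivJetModel E n) 𝓘(ℝ, E) (fun a : TrivJet E G n => a.2 j) a X = X.2 j :=
  tderiv_trivJet_comp_snd (ContinuousLinearMap.proj j) a X

theorem tderiv_jetComp {n : ℕ} (a : TrivJet E G n) (i : ℕ) (X : E × (Fin n → E)) :
    tderiv (trivJetModel E n) 𝓘(ℝ, E) (fun a : TrivJet E G n => jetComp a.2 i) a X =
      jetComp X.2 i := by
  by_cases h : 1 ≤ i ∧ i ≤ n
  · simp only [jetComp_of_mem _ h]
    exact tderiv_trivJet_apply _ _ _
  · simp only [jetComp, dif_neg h]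
    rw [tderiv_const]
    rfl

theorem tderiv_fst_eq {n : ℕ} {f : M → TrivJet E G n} {x : M}
    (hf : MDifferentiableAt I (trivJetModel E n) f x) (v : EM) :
    (tderiv I (trivJetModel E n) f x v).1 = tderiv I 𝓘(ℝ, E) (fun x => (f x).1) x v := by
  have h := tderiv_comp_apply (I'' := 𝓘(ℝ, E)) (g := fun a : TrivJet E G n => a.1)
    mdifferentiableAt_fst hf v
  rw [tderiv_trivJet_fst] at h
  exact h.symm

theorem tderiv_snd_eq {n : ℕ} {f : M → TrivJet E G n} {x : M}
    (hf : MDifferentiableAt I (trivJetModel E n) f x) (j : Fin n) (v : EM) :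
    (tderiv I (trivJetModel E n) f x v).2 j = tderiv I 𝓘(ℝ, E) (fun x => (f x).2 j) x v := by
  have h := tderiv_comp_apply (I'' := 𝓘(ℝ, E)) (g := fun a : TrivJet E G n => a.2 j)
    (((contMDiff_trivJet_iff.1 contMDiff_id).2 j).mdifferentiableAt (by simp)) hf v
  rw [tderiv_trivJet_apply] at h
  exact h.symm

theorem tderiv_truncate {k : ℕ} (a : TrivJet E G (k + 1)) (X : E × (Fin (k + 1) → E)) :
    tderiv (trivJetModel E (k + 1)) (trivJetModel E k) (truncate k) a X = (X.1, Fin.init X.2) := by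
  have h := (contMDiff_truncate (E := E) (G := G) k).mdifferentiableAt (x := a) (by simp)
  refine Prod.ext ?_ (funext fun j => ?_)
  · rw [tderiv_fst_eq h]
    exact tderiv_trivJet_fst a X
  · rw [tderiv_snd_eq h]
    exact tderiv_trivJet_apply a j.castSucc X

theorem tderiv_zeroSection {k : ℕ} (a : TrivJet E G k) (X : E × (Fin k → E)) :
    tderiv (trivJetModel E k) (trivJetModel E (k + 1)) (zeroSection k) a X =
      (X.1, Fin.snoc X.2 (0 : E)) := by
  have h := (contMDiff_zeroSection (E := E) (G := G) k).mdifferentiableAt (x := a) (by simp)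
  refine Prod.ext ?_ (funext fun j => ?_)
  · rw [tderiv_fst_eq h]
    exact tderiv_trivJet_fst a X
  · rw [tderiv_snd_eq h]
    refine Fin.lastCases ?_ (fun j => ?_) j
    · simp only [zeroSection_last, tderiv_const]
      simp
    · simp only [zeroSection, Fin.snoc_castSucc]
      exact tderiv_trivJet_apply a j X

theorem tderiv_topInclusion [Group G] {k : ℕ} (v w : E) :
    tderiv 𝓘(ℝ, E) (trivJetModel E (k + 1)) (topInclusion G k) v w =
      (0, Fin.snoc (0 : Fin k → E) w) := by
  have h := (contMDiff_topInclusion (E := E) (G := G) k).mdifferentiableAt (x := v) (by simp)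
  refine Prod.ext ?_ (funext fun j => ?_)
  · rw [tderiv_fst_eq h]
    simp only [topInclusion, tderiv_const]
    rfl
  · rw [tderiv_snd_eq h]
    refine Fin.lastCases ?_ (fun j => ?_) j
    · simp only [topInclusion_last]
      simp [tderiv_eq_fderiv]
    · simp only [topInclusion, Fin.snoc_castSucc, tderiv_const]
      simp

end JetTangent

section CocycleDeriv

open Filter Topology

variable {E : Type*} [NormedAddCommGroup E] [NormedSpace ℝ E]
  {EM : Type*} [NormedAddCommGroup EM] [NormedSpace ℝ EM] {HM : Type*} [TopologicalSpace HM]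
  {I : ModelWithCorners ℝ EM HM} {M : Type*} [TopologicalSpace M] [ChartedSpace HM M]
  [IsManifold I ∞ M] [I.Boundaryless]

theorem tderiv_clm_mul {A B : M → E →L[ℝ] E} {m : M} (hA : MDifferentiableAt I 𝓘(ℝ, E →L[ℝ] E) A m)
    (hB : MDifferentiableAt I 𝓘(ℝ, E →L[ℝ] E) B m) (X : EM) :
    tderiv I 𝓘(ℝ, E →L[ℝ] E) (fun p => (A p).comp (B p)) m X =
      (tderiv I 𝓘(ℝ, E →L[ℝ] E) A m X).comp (B m) +
        (A m).comp (tderiv I 𝓘(ℝ, E →L[ℝ] E) B m X) := by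
  let C := ContinuousLinearMap.compL ℝ E E E
  have hCA : MDifferentiableAt I 𝓘(ℝ, (E →L[ℝ] E) →L[ℝ] (E →L[ℝ] E)) (fun p => C (A p)) m :=
    MDifferentiableAt.comp m (g := C) C.differentiableAt.mdifferentiableAt hA
  have h := tderiv_clm_apply hCA hB X
  rw [tderiv_clm_comp C hA] at h
  exact h

variable (D : E →L[ℝ] E →L[ℝ] E) {x : ℕ → M → E} {m : M}

theorem tderiv_chain_of_eq_zero (hx : ∀ i, ContMDiff I 𝓘(ℝ, E) ∞ (x i)) (hx0 : ∀ i, x i m = 0)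
    (y : ℕ → E) (l : List ℕ) {Q : M → E →L[ℝ] E} (hQ : ContMDiff I 𝓘(ℝ, E →L[ℝ] E) ∞ Q)
    (hQ0 : Q m = 0) (X : EM) :
    tderiv I 𝓘(ℝ, E) (fun p => chain D (fun i => x i p) y l (Q p)) m X =
      chain D (fun _ => 0) y l (tderiv I 𝓘(ℝ, E →L[ℝ] E) Q m X) := by
  induction l generalizing Q with
  | nil =>
    simp only [chain, tderiv_const]
    rfl
  | cons i l ih =>
    have hDx : ContMDiff I 𝓘(ℝ, E →L[ℝ] E) ∞ (fun p => D (x i p)) := D.contMDiff.comp (hx i)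
    rcases eq_or_ne l [] with rfl | hl
    · exact tderiv_clm_apply_const (hQ.mdifferentiableAt (by simp)) _ _
    · simp only [chain_cons D _ _ i hl]
      rw [ih (hDx.clm_comp hQ) (by rw [hQ0, ContinuousLinearMap.comp_zero]),
        tderiv_clm_mul (hDx.mdifferentiableAt (by simp)) (hQ.mdifferentiableAt (by simp)), hQ0, hx0,
        ContinuousLinearMap.comp_zero, zero_add, map_zero]

theorem tderiv_chain_cons (hx : ∀ i, ContMDiff I 𝓘(ℝ, E) ∞ (x i)) (hx0 : ∀ i, x i m = 0)
    (y : ℕ → E) (i : ℕ) {l : List ℕ} (hl : l ≠ []) {Q : M → E →L[ℝ] E}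
    (hQ : ContMDiff I 𝓘(ℝ, E →L[ℝ] E) ∞ Q) (X : EM) :
    tderiv I 𝓘(ℝ, E) (fun p => chain D (fun i => x i p) y (i :: l) (Q p)) m X =
      chain D (fun _ => 0) y l ((D (tderiv I 𝓘(ℝ, E) (x i) m X)).comp (Q m)) := by
  have hDx : ContMDiff I 𝓘(ℝ, E →L[ℝ] E) ∞ (fun p => D (x i p)) := D.contMDiff.comp (hx i)
  simp only [chain_cons D _ _ i hl]
  rw [tderiv_chain_of_eq_zero D hx hx0 y l (hDx.clm_comp hQ)
    (by rw [hx0, map_zero, ContinuousLinearMap.zero_comp]),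
    tderiv_clm_mul (hDx.mdifferentiableAt (by simp)) (hQ.mdifferentiableAt (by simp)), hx0,
    map_zero, ContinuousLinearMap.zero_comp, add_zero,
    tderiv_clm_comp D ((hx i).mdifferentiableAt (by simp))]
  rfl

end CocycleDeriv

section ChainLinear

variable {E : Type*} [NormedAddCommGroup E] [NormedSpace ℝ E] (D : E →L[ℝ] E →L[ℝ] E)

theorem chain_add_right (x y y' : ℕ → E) (l : List ℕ) (P : E →L[ℝ] E) :
    chain D x (fun i => y i + y' i) l P = chain D x y l P + chain D x y' l P := by
  induction l generalizing P with
  | nil => simp [chain]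
  | cons i l ih =>
    rcases eq_or_ne l [] with rfl | hl
    · simp [chain]
    · simp only [chain_cons D _ _ i hl, ih]

theorem chain_smul_right (x y : ℕ → E) (c : ℝ) (l : List ℕ) (P : E →L[ℝ] E) :
    chain D x (fun i => c • y i) l P = c • chain D x y l P := by
  induction l generalizing P with
  | nil => simp [chain]
  | cons i l ih =>
    rcases eq_or_ne l [] with rfl | hl
    · simp [chain]
    · simp only [chain_cons D _ _ i hl, ih]

omit [NormedSpace ℝ E] in
theorem jetComp_add {n : ℕ} (x y : Fin n → E) (i : ℕ) :
    jetComp (x + y) i = jetComp x i + jetComp y i := by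
  unfold jetComp
  split_ifs <;> simp

theorem jetComp_smul {n : ℕ} (c : ℝ) (x : Fin n → E) (i : ℕ) :
    jetComp (c • x) i = c • jetComp x i := by
  unfold jetComp
  split_ifs <;> simp

end ChainLinear

section CompositionPairs

theorem partitionNumber_pair (i j : ℕ) : partitionNumber [i, j] = (i + j - 1).choose (j - 1) := by
  simp [partitionNumber]

theorem sum_composition_length_two {A : Type*} [AddCommMonoid A] (k : ℕ) (f : List ℕ → A) :
    ∑ i : Composition (k + 1) with i.length = 2, f i.blocks =
      ∑ i ∈ Finset.Icc 1 k, f [i, k + 1 - i] := by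
  symm
  refine Finset.sum_bij (fun i hi => ⟨[i, k + 1 - i], fun {j} hj => ?_, ?_⟩) ?_ ?_ ?_ ?_
  · rw [Finset.mem_Icc] at hi
    simp only [List.mem_cons, List.not_mem_nil, or_false] at hj
    omega
  · rw [Finset.mem_Icc] at hi
    simp only [List.sum_cons, List.sum_nil]
    omega
  · intro i hi
    simp [Composition.length]
  · intro i hi j hj h
    simpa using congrArg (fun c => c.blocks.head?) h
  · intro c hc
    have hc : c.blocks.length = 2 := (Finset.mem_filter.1 hc).2
    obtain ⟨i, j, h⟩ := List.length_eq_two.1 hc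
    have hi : 0 < i := c.blocks_pos (by simp [h])
    have hj : 0 < j := c.blocks_pos (by simp [h])
    have hs : i + j = k + 1 := by simpa [h] using c.blocks_sum
    refine ⟨i, Finset.mem_Icc.2 ⟨hi, by omega⟩, Composition.ext ?_⟩
    rw [h]
    simp only [List.cons.injEq, and_true, true_and]
    omega
  · intro i hi
    rfl

end CompositionPairs

section JetBracket

open Filter Topology

variable {E : Type*} [NormedAddCommGroup E] [NormedSpace ℝ E]
  {G : Type*} [TopologicalSpace G] [ChartedSpace E G] [Group G] [LieGroup 𝓘(ℝ, E) ∞ G]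
  [CompleteSpace E]

/-- The group cocycle as a linear map of its second argument. -/
noncomputable def groupCocycleRight {k : ℕ} (a : TrivJet E G k) : (Fin k → E) →L[ℝ] E where
  toFun y := groupCocycle k a (1, y)
  map_add' y y' := by
    simp only [groupCocycle, cocycleTerm_eq_chain, funext (jetComp_add y y'),
      ← Finset.sum_add_distrib]
    exact Finset.sum_congr rfl fun p _ => chain_add_right _ _ _ _ _ _
  map_smul' c y := by
    simp only [groupCocycle, cocycleTerm_eq_chain, funext (jetComp_smul c y), Finset.smul_sum]
    exact Finset.sum_congr rfl fun p _ => chain_smul_right _ _ _ _ _ _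
  cont := by
    refine ContMDiff.continuous (I := 𝓘(ℝ, Fin k → E)) (I' := 𝓘(ℝ, E)) (n := ∞) ?_
    exact contMDiff_const.groupCocycle (contMDiff_const.prodMk contMDiff_id)

theorem tderiv_groupCocycle_right {k : ℕ} (a b : TrivJet E G k) (Y : E × (Fin k → E)) :
    tderiv (trivJetModel E k) 𝓘(ℝ, E) (fun b => groupCocycle k a b) b Y =
      groupCocycle k a (1, Y.2) :=
  tderiv_trivJet_comp_snd (groupCocycleRight a) b Y

theorem tderiv_groupCocycle_left {k : ℕ} (y : Fin k → E) (X : E × (Fin k → E)) :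
    tderiv (trivJetModel E k) 𝓘(ℝ, E) (fun a => groupCocycle k a (1, y)) ((1 : G), 0) X =
      ∑ i ∈ Finset.Icc 1 k, k.choose i • adL E G (jetComp X.2 i) (jetComp y (k + 1 - i)) := by
  have hx : ∀ i, ContMDiff (trivJetModel E k) 𝓘(ℝ, E) ∞ (fun a : TrivJet E G k => jetComp a.2 i) :=
    contMDiff_id.jetComp
  have hQ : ContMDiff (trivJetModel E k) 𝓘(ℝ, E →L[ℝ] E) ∞ (fun a : TrivJet E G k => Ad E a.1) :=
    contMDiff_Ad.comp (contMDiff_trivJet_fst k)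
  have hterm : ∀ l : List ℕ, MDifferentiableAt (trivJetModel E k) 𝓘(ℝ, E) (fun a : TrivJet E G k =>
      chain (adL E G) (jetComp a.2) (jetComp y) l (Ad E a.1)) ((1 : G), 0) := fun l =>
    (ContMDiff.chain (adL E G) hx (y := fun i _ => jetComp y i) (fun i => contMDiff_const) l
      hQ).mdifferentiableAt (by simp)
  simp only [groupCocycle_eq_sum_composition, cocycleTerm_eq_chain]
  rw [tderiv_sum _ fun i _ => mdifferentiableAt_nsmul _ (hterm i.blocks),
    Finset.sum_congr rfl fun i _ => tderiv_nsmul _ (hterm i.blocks), sum_apply,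
    ← Finset.sum_subset (s₁ := Finset.univ.filter fun i : Composition (k + 1) => i.length = 2),
    sum_composition_length_two k fun l => (partitionNumber l • tderiv (trivJetModel E k) 𝓘(ℝ, E)
      (fun a : TrivJet E G k => chain (adL E G) (jetComp a.2) (jetComp y) l (Ad E a.1)) (1, 0)) X]
  · refine Finset.sum_congr rfl fun i hi => ?_
    rw [Finset.mem_Icc] at hi
    rw [partitionNumber_pair, show i + (k + 1 - i) - 1 = k by omega,
      show k + 1 - i - 1 = k - i by omega, Nat.choose_symm hi.2, smul_apply,
      tderiv_chain_cons (adL E G) hx (fun i => jetComp_zero k i) _ _ (by simp) hQ, tderiv_jetComp,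
      Ad_one]
    rfl
  · intro i hi
    have := (Finset.mem_filter.1 hi).2
    exact Finset.mem_filter.2 ⟨Finset.mem_univ _, by omega⟩
  · intro c hc hc2
    have hc : c.blocks.length ≠ 1 := (Finset.mem_filter.1 hc).2
    have hc2 : c.blocks.length ≠ 2 := fun h => hc2 (Finset.mem_filter.2 ⟨Finset.mem_univ _, h⟩)
    rw [smul_apply]
    match hb : c.blocks, hc, hc2 with
    | [], _, _ =>
      simp only [chain, tderiv_const]
      simp
    | i :: j :: m :: l, _, _ =>
      rw [tderiv_chain_cons (adL E G) hx (fun i => jetComp_zero k i) _ _ (by simp) hQ,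
        chain_zero_left _ _ (by simp), smul_zero]

theorem ad_skew (X Y : E) : ad G Y X = -ad G X Y :=
  (lie_skew (L := GroupLieAlgebra 𝓘(ℝ, E) G) Y X).symm

theorem sum_sub_sum_swap_eq_lieCocycle {k : ℕ} (X Y : E × (Fin k → E)) :
    (∑ i ∈ Finset.Icc 1 k, k.choose i • ad G (jetComp X.2 i) (jetComp Y.2 (k + 1 - i)) -
      ∑ i ∈ Finset.Icc 1 k, k.choose i • ad G (jetComp Y.2 i) (jetComp X.2 (k + 1 - i))) =
      lieCocycle G k X Y := by
  have h : ∑ i ∈ Finset.Icc 1 k, k.choose i • ad G (jetComp Y.2 i) (jetComp X.2 (k + 1 - i)) =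
      -∑ i ∈ Finset.Icc 1 k,
        k.choose (i - 1) • ad G (jetComp X.2 i) (jetComp Y.2 (k + 1 - i)) := by
    rw [← Finset.sum_neg_distrib]
    refine Finset.sum_nbij' (fun i => k + 1 - i) (fun i => k + 1 - i) ?_ ?_ ?_ ?_ ?_
    · intro i hi
      simp only [Finset.mem_Icc] at hi ⊢
      omega
    · intro i hi
      simp only [Finset.mem_Icc] at hi ⊢
      omega
    · intro i hi
      simp only [Finset.mem_Icc] at hi
      omega
    · intro i hi
      simp only [Finset.mem_Icc] at hi
      omega
    · intro i hi
      simp only [Finset.mem_Icc] at hi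
      rw [show k + 1 - i - 1 = k - i by omega, Nat.choose_symm hi.2,
        show k + 1 - (k + 1 - i) = i by omega, ad_skew, smul_neg]
  rw [h, sub_neg_eq_add, ← Finset.sum_add_distrib]
  refine Finset.sum_congr rfl fun i hi => ?_
  rw [Finset.mem_Icc] at hi
  obtain ⟨j, rfl⟩ : ∃ j, i = j + 1 := ⟨i - 1, by omega⟩
  rw [Nat.add_sub_cancel, ← add_smul, Nat.choose_succ_succ, add_comm]

attribute [local instance] trivJetGroup

theorem tderiv_tderiv_mul_last {k : ℕ} (X Y : E × (Fin (k + 1) → E)) :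
    tderiv (trivJetModel E (k + 1)) 𝓘(ℝ, E) (fun a : TrivJet E G (k + 1) =>
      tderiv (trivJetModel E (k + 1)) 𝓘(ℝ, E)
        (fun b : TrivJet E G (k + 1) => (a * b).2 (Fin.last k)) 1 Y) 1 X =
      ad G X.1 (Y.2 (Fin.last k)) + ∑ i ∈ Finset.Icc 1 k,
        k.choose i • ad G (jetComp (Fin.init X.2 : Fin k → E) i)
          (jetComp (Fin.init Y.2 : Fin k → E) (k + 1 - i)) := by
  have hlast := contMDiff_trivJet_last (E := E) (G := G) k
  have htr := contMDiff_truncate (E := E) (G := G) k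
  have hAd : ContMDiff (trivJetModel E (k + 1)) 𝓘(ℝ, E →L[ℝ] E) ∞
      (fun a : TrivJet E G (k + 1) => Ad E a.1) := contMDiff_Ad.comp (contMDiff_trivJet_fst _)
  have h1 : ∀ a : TrivJet E G (k + 1), tderiv (trivJetModel E (k + 1)) 𝓘(ℝ, E)
      (fun b : TrivJet E G (k + 1) => (a * b).2 (Fin.last k)) 1 Y =
        Ad E a.1 (Y.2 (Fin.last k)) + groupCocycle k (truncate k a) (1, Fin.init Y.2) := by
    intro a
    have hc : ContMDiff (trivJetModel E k) 𝓘(ℝ, E) ∞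
        (fun b : TrivJet E G k => groupCocycle k (truncate k a) b) :=
      contMDiff_const.groupCocycle contMDiff_id
    have h2 : ContMDiff (trivJetModel E (k + 1)) 𝓘(ℝ, E) ∞
        (fun b : TrivJet E G (k + 1) => Ad E a.1 (b.2 (Fin.last k))) :=
      (Ad E a.1).contMDiff.comp hlast
    have h3 := tderiv_comp_apply (hc.mdifferentiableAt (by simp))
      (htr.mdifferentiableAt (x := 1) (by simp)) Y
    rw [tderiv_groupCocycle_right, tderiv_truncate] at h3
    simp only [trivJet_mul_last]
    rw [tderiv_add (f := fun b : TrivJet E G (k + 1) => a.2 (Fin.last k) +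
        Ad E a.1 (b.2 (Fin.last k))) (g := fun b => groupCocycle k (truncate k a) (truncate k b))
      ((contMDiff_const.add h2).mdifferentiableAt (by simp))
      ((hc.comp htr).mdifferentiableAt (by simp)),
      tderiv_add mdifferentiableAt_const (h2.mdifferentiableAt (by simp)), tderiv_const, zero_add,
      tderiv_clm_comp _ (hlast.mdifferentiableAt (by simp)), add_apply,
      ContinuousLinearMap.comp_apply, tderiv_trivJet_apply]
    exact congrArg _ h3
  have hc : ContMDiff (trivJetModel E k) 𝓘(ℝ, E) ∞
      (fun a : TrivJet E G k => groupCocycle k a (1, Fin.init Y.2)) :=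
    contMDiff_id.groupCocycle contMDiff_const
  have h4 := tderiv_comp_apply (hc.mdifferentiableAt (by simp))
    (htr.mdifferentiableAt (x := 1) (by simp)) X
  rw [tderiv_truncate, truncate_one, trivJet_one k, tderiv_groupCocycle_left] at h4
  have h5 : tderiv (trivJetModel E (k + 1)) 𝓘(ℝ, E →L[ℝ] E)
      (fun a : TrivJet E G (k + 1) => Ad E a.1) 1 X = adL E G X.1 := by
    have := tderiv_comp_apply (f := fun a : TrivJet E G (k + 1) => a.1) (x := 1)
      (contMDiff_Ad.mdifferentiableAt (by simp))
      ((contMDiff_trivJet_fst _).mdifferentiableAt (by simp)) X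
    rw [tderiv_trivJet_fst, trivJet_one] at this
    rw [trivJet_one]
    exact this
  rw [funext h1, tderiv_add (f := fun a : TrivJet E G (k + 1) => Ad E a.1 (Y.2 (Fin.last k)))
    (g := fun a => groupCocycle k (truncate k a) (1, Fin.init Y.2))
    ((hAd.clm_apply contMDiff_const).mdifferentiableAt (by simp))
    ((hc.comp htr).mdifferentiableAt (by simp)), add_apply,
    tderiv_clm_apply_const (hAd.mdifferentiableAt (by simp)), h5, adL_apply]
  simp only [adL_apply] at h4
  exact congrArg _ h4

attribute [local instance] trivJet_lieGroup

theorem groupBracket_trivJet_last {k : ℕ} (X Y : E × (Fin (k + 1) → E)) :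
    (groupBracket (trivJetModel E (k + 1)) (TrivJet E G (k + 1)) X Y).2 (Fin.last k) =
      ad G X.1 (Y.2 (Fin.last k)) - ad G Y.1 (X.2 (Fin.last k)) +
        lieCocycle G k (X.1, Fin.init X.2) (Y.1, Fin.init Y.2) := by
  have h := tderiv_groupBracket (contMDiff_trivJet_last (E := E) (G := G) k).contMDiffAt X Y
  rw [tderiv_trivJet_apply, tderiv_tderiv_mul_last, tderiv_tderiv_mul_last] at h
  rw [h, ← sum_sub_sum_swap_eq_lieCocycle]
  abel

theorem tderiv_truncate_groupBracket {k : ℕ} (X Y : E × (Fin (k + 1) → E)) :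
    ((groupBracket (trivJetModel E (k + 1)) (TrivJet E G (k + 1)) X Y).1,
      Fin.init (groupBracket (trivJetModel E (k + 1)) (TrivJet E G (k + 1)) X Y).2) =
      groupBracket (trivJetModel E k) (TrivJet E G k) (X.1, Fin.init X.2) (Y.1, Fin.init Y.2) := by
  have h := tderiv_monoidHom_groupBracket (jetGroupExtension E G k).rightHom
    (contMDiff_truncate k) X Y
  change tderiv _ _ (truncate k) _ _ =
    groupBracket _ _ (tderiv _ _ (truncate k) _ _) (tderiv _ _ (truncate k) _ _) at h
  rwa [tderiv_truncate, tderiv_truncate, tderiv_truncate] at h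

end JetBracket

section AbelianExtension

variable {N L M : Type*} [LieRing N] [LieAlgebra ℝ N] [LieRing L] [LieAlgebra ℝ L] [LieRing M]
  [LieAlgebra ℝ M]

/-- An abelian extension of Lie algebras from the values of the bracket on a linear section: the
other properties are formal consequences. -/
theorem IsAbelianLieAlgebraExtension.of_bracket {ι : N →ₗ⁅ℝ⁆ L} {π : L →ₗ⁅ℝ⁆ M} {τ : M →ₗ[ℝ] L}
    {ρ : M → N → N} {σ : M → M → N} (hN : IsLieAbelian N) (hι : Function.Injective ι)
    (hexact : ∀ X, π X = 0 ↔ ∃ v, ι v = X) (hτ : ∀ X, π (τ X) = X)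
    (hρ : ∀ X v, ⁅τ X, ι v⁆ = ι (ρ X v))
    (hσ : ∀ X Y, ⁅τ X, τ Y⁆ = τ ⁅X, Y⁆ + ι (σ X Y)) :
    IsAbelianLieAlgebraExtension ι π τ ρ σ where
  isLieAbelian := hN
  isExtension :=
    { ker_eq_bot := by rwa [LieHom.ker_eq_bot]
      range_eq_top := by
        rw [LieHom.range_eq_top]
        exact fun X => ⟨τ X, hτ X⟩
      exact := by
        rw [LieHom.range_eq_ker_iff]
        exact hexact }
  proj_section := hτ
  action_linear X :=
    { map_add := fun v w => hι (by simp only [map_add, ← hρ, lie_add])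
      map_smul := fun c v => hι (by simp only [map_smul, ← hρ, lie_smul]) }
  linear_action v :=
    { map_add := fun X Y => hι (by simp only [map_add, ← hρ, add_lie])
      map_smul := fun c X => hι (by simp only [map_smul, ← hρ, smul_lie]) }
  action_bracket X Y v := by
    apply hι
    have h0 : ⁅ι (σ X Y), ι v⁆ = 0 := by rw [← LieHom.map_lie, hN.trivial, map_zero]
    have h1 : τ ⁅X, Y⁆ = ⁅τ X, τ Y⁆ - ι (σ X Y) := by rw [hσ, add_sub_cancel_right]
    rw [map_sub, ← hρ, ← hρ, ← hρ, ← hρ, ← hρ, h1, sub_lie, h0, sub_zero, lie_lie]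
  bracket_incl := hρ
  cocycle_linear_right X :=
    { map_add := fun Y Z => hι (by
        have h : ∀ Y, ι (σ X Y) = ⁅τ X, τ Y⁆ - τ ⁅X, Y⁆ := fun Y => by rw [hσ, add_sub_cancel_left]
        simp only [map_add, h, lie_add]
        abel)
      map_smul := fun c Y => hι (by
        have h : ∀ Y, ι (σ X Y) = ⁅τ X, τ Y⁆ - τ ⁅X, Y⁆ := fun Y => by rw [hσ, add_sub_cancel_left]
        simp only [map_smul, h, lie_smul, smul_sub]) }
  cocycle_linear_left Y :=
    { map_add := fun X Z => hι (by
        have h : ∀ X, ι (σ X Y) = ⁅τ X, τ Y⁆ - τ ⁅X, Y⁆ := fun X => by rw [hσ, add_sub_cancel_left]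
        simp only [map_add, h, add_lie]
        abel)
      map_smul := fun c X => hι (by
        have h : ∀ X, ι (σ X Y) = ⁅τ X, τ Y⁆ - τ ⁅X, Y⁆ := fun X => by rw [hσ, add_sub_cancel_left]
        simp only [map_smul, h, smul_lie, smul_sub]) }
  cocycle_self X := hι (by simpa using (hσ X X).symm)
  cocycle X Y Z := by
    apply hι
    have h : ∀ X Y, ι (σ X Y) = ⁅τ X, τ Y⁆ - τ ⁅X, Y⁆ := fun X Y => by
      rw [hσ, add_sub_cancel_left]
    have hj := lie_jacobi (τ X) (τ Y) (τ Z)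
    have hj2 := congrArg τ (lie_jacobi X Y Z)
    simp only [map_add, map_zero] at hj2
    have e : ∀ A B : L, ⁅A, B⁆ = -⁅B, A⁆ := fun A B => (lie_skew A B).symm
    have e2 : ∀ A B : M, ⁅A, B⁆ = -⁅B, A⁆ := fun A B => (lie_skew A B).symm
    simp only [map_add, ← hρ, h, lie_sub]
    rw [e (τ ⁅X, Y⁆), e (τ ⁅Y, Z⁆), e (τ ⁅Z, X⁆), e2 ⁅X, Y⁆, e2 ⁅Y, Z⁆, e2 ⁅Z, X⁆]
    simp only [map_neg]
    rw [← sub_eq_zero]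
    refine Eq.trans ?_ (congrArg₂ (· - ·) hj hj2 |>.trans (sub_zero 0))
    abel
  bracket_section := hσ

end AbelianExtension

section JetLieAlgebraExtension

theorem Prod.ext_of_init {E : Type*} {k : ℕ} {X Y : E × (Fin (k + 1) → E)}
    (h : ((X.1, Fin.init X.2) : E × (Fin k → E)) = (Y.1, Fin.init Y.2))
    (h' : X.2 (Fin.last k) = Y.2 (Fin.last k)) : X = Y := by
  simp only [Prod.mk.injEq] at h
  refine Prod.ext h.1 ?_
  rw [← Fin.snoc_init_self X.2, ← Fin.snoc_init_self Y.2, h.2, h']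

variable {E : Type*} [NormedAddCommGroup E] [NormedSpace ℝ E]

theorem isLieAbelian_addGroupLieAlgebra [CompleteSpace E] :
    IsLieAbelian (AddGroupLieAlgebra 𝓘(ℝ, E) E) := by
  have h : ∀ v : E, (addInvariantVectorField (I := 𝓘(ℝ, E)) (G := E) v : E → E) = fun _ => v := by
    intro v
    funext g
    change tderiv 𝓘(ℝ, E) 𝓘(ℝ, E) (fun x : E => g + x) 0 v = v
    rw [tderiv_eq_fderiv, fderiv_const_add, fderiv_fun_id]
    rfl
  have key : ∀ V W : Π x : E, TangentSpace 𝓘(ℝ, E) x, VectorField.mlieBracket 𝓘(ℝ, E) V W 0 =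
      VectorField.lieBracket ℝ (V : E → E) (W : E → E) 0 := by
    intro V W
    rw [← VectorField.mlieBracketWithin_univ, VectorField.mlieBracketWithin_eq_lieBracketWithin]
    exact congrFun (VectorField.lieBracketWithin_univ (𝕜 := ℝ) (V := (V : E → E))) 0
  refine ⟨fun v w => (key (addInvariantVectorField (I := 𝓘(ℝ, E)) (G := E) v)
    (addInvariantVectorField (I := 𝓘(ℝ, E)) (G := E) w)).trans ?_⟩
  refine (congrArg₂ (fun V W : E → E => VectorField.lieBracket ℝ V W 0) (h v) (h w)).trans ?_
  change fderiv ℝ (fun _ : E => (w : E)) 0 v - fderiv ℝ (fun _ : E => (v : E)) 0 w = 0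
  simp only [fderiv_fun_const]
  exact sub_self 0

variable {G : Type*} [TopologicalSpace G] [ChartedSpace E G] [Group G] [LieGroup 𝓘(ℝ, E) ∞ G]
  [CompleteSpace E]

attribute [local instance] trivJetGroup trivJet_lieGroup

theorem ad_zero_left (Y : E) : ad G 0 Y = 0 := by rw [← adL_apply]; simp

theorem ad_zero_right (X : E) : ad G X 0 = 0 := by rw [← adL_apply]; simp

theorem lieCocycle_zero_right {k : ℕ} (X : E × (Fin k → E)) {Y : E × (Fin k → E)} (hY : Y.2 = 0) :
    lieCocycle G k X Y = 0 :=
  Finset.sum_eq_zero fun i _ => by rw [hY, jetComp_zero, ad_zero_right, smul_zero]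

theorem groupBracket_zero_right {n : ℕ} (X : E × (Fin n → E)) :
    groupBracket (trivJetModel E n) (TrivJet E G n) X 0 = 0 :=
  lie_zero (L := GroupLieAlgebra (trivJetModel E n) (TrivJet E G n))
    (M := GroupLieAlgebra (trivJetModel E n) (TrivJet E G n)) X

theorem groupBracket_inclusion_inclusion {k : ℕ} (v w : E) :
    groupBracket (trivJetModel E (k + 1)) (TrivJet E G (k + 1))
      (0, Fin.snoc (0 : Fin k → E) v) (0, Fin.snoc (0 : Fin k → E) w) = 0 := by
  refine Prod.ext_of_init ?_ ?_
  · rw [tderiv_truncate_groupBracket]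
    simp only [Fin.init_snoc]
    exact groupBracket_zero_right _
  · rw [groupBracket_trivJet_last, lieCocycle_zero_right _ (by simp)]
    simp [ad_zero_left]

variable (E G) in
/-- The derivative of the inclusion `v ↦ (1, 0, …, 0, v)`. -/
noncomputable def jetLieInclusion (k : ℕ) : AddGroupLieAlgebra 𝓘(ℝ, E) E →ₗ⁅ℝ⁆
    GroupLieAlgebra (trivJetModel E (k + 1)) (TrivJet E G (k + 1)) where
  toFun v := tderiv 𝓘(ℝ, E) (trivJetModel E (k + 1)) (topInclusion (E := E) G k) 0 v
  map_add' v w :=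
    (tderiv 𝓘(ℝ, E) (trivJetModel E (k + 1)) (topInclusion (E := E) G k) 0).map_add v w
  map_smul' c v :=
    (tderiv 𝓘(ℝ, E) (trivJetModel E (k + 1)) (topInclusion (E := E) G k) 0).map_smul c v
  map_lie' {v w} := by
    refine (congrArg (tderiv 𝓘(ℝ, E) (trivJetModel E (k + 1)) (topInclusion (E := E) G k) 0)
      (isLieAbelian_addGroupLieAlgebra.trivial v w)).trans ((map_zero _).trans ?_)
    refine (groupBracket_inclusion_inclusion (E := E) (G := G) (k := k) v w).symm.trans ?_
    exact congrArg₂ (groupBracket (trivJetModel E (k + 1)) (TrivJet E G (k + 1)))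
      (tderiv_topInclusion (E := E) _ v).symm (tderiv_topInclusion (E := E) _ w).symm

variable (E G) in
/-- The derivative of the projection of jets. -/
noncomputable def jetLieProjection (k : ℕ) :
    GroupLieAlgebra (trivJetModel E (k + 1)) (TrivJet E G (k + 1)) →ₗ⁅ℝ⁆
      GroupLieAlgebra (trivJetModel E k) (TrivJet E G k) where
  toFun X := tderiv (trivJetModel E (k + 1)) (trivJetModel E k) (truncate k)
    (1 : TrivJet E G (k + 1)) X
  map_add' X Y :=
    (tderiv (trivJetModel E (k + 1)) (trivJetModel E k) (truncate k)
      (1 : TrivJet E G (k + 1))).map_add X Y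
  map_smul' c X :=
    (tderiv (trivJetModel E (k + 1)) (trivJetModel E k) (truncate k)
      (1 : TrivJet E G (k + 1))).map_smul c X
  map_lie' {X Y} := tderiv_monoidHom_groupBracket (jetGroupExtension E G k).rightHom
    (contMDiff_truncate k) X Y

variable (E G) in
/-- The derivative of the section `(g, x_1, …, x_k) ↦ (g, x_1, …, x_k, 0)`. -/
noncomputable def jetLieSection (k : ℕ) :
    GroupLieAlgebra (trivJetModel E k) (TrivJet E G k) →ₗ[ℝ]
      GroupLieAlgebra (trivJetModel E (k + 1)) (TrivJet E G (k + 1)) where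
  toFun X := tderiv (trivJetModel E k) (trivJetModel E (k + 1)) (zeroSection k)
    (1 : TrivJet E G k) X
  map_add' X Y :=
    (tderiv (trivJetModel E k) (trivJetModel E (k + 1)) (zeroSection k)
      (1 : TrivJet E G k)).map_add X Y
  map_smul' c X :=
    (tderiv (trivJetModel E k) (trivJetModel E (k + 1)) (zeroSection k)
      (1 : TrivJet E G k)).map_smul c X

theorem jetLieInclusion_apply {k : ℕ} (v : E) :
    jetLieInclusion E G k v = ((0, Fin.snoc (0 : Fin k → E) v) : E × (Fin (k + 1) → E)) :=
  tderiv_topInclusion 0 v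

theorem jetLieProjection_apply {k : ℕ} (X : E × (Fin (k + 1) → E)) :
    jetLieProjection E G k X = ((X.1, Fin.init X.2) : E × (Fin k → E)) :=
  tderiv_truncate 1 X

omit [CompleteSpace E] in
theorem jetLieSection_apply {k : ℕ} (X : E × (Fin k → E)) :
    jetLieSection E G k X = ((X.1, Fin.snoc X.2 (0 : E)) : E × (Fin (k + 1) → E)) :=
  tderiv_zeroSection 1 X

theorem groupBracket_section_inclusion {k : ℕ} (X : E × (Fin k → E)) (v : E) :
    groupBracket (trivJetModel E (k + 1)) (TrivJet E G (k + 1))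
      (X.1, Fin.snoc X.2 (0 : E)) (0, Fin.snoc (0 : Fin k → E) v) =
      (0, Fin.snoc (0 : Fin k → E) (ad G X.1 v)) := by
  refine Prod.ext_of_init ?_ ?_
  · rw [tderiv_truncate_groupBracket]
    simp only [Fin.init_snoc]
    exact groupBracket_zero_right _
  · rw [groupBracket_trivJet_last, lieCocycle_zero_right _ (by simp)]
    simp [ad_zero_left]

theorem groupBracket_section_section {k : ℕ} (X Y : E × (Fin k → E)) :
    groupBracket (trivJetModel E (k + 1)) (TrivJet E G (k + 1))
      (X.1, Fin.snoc X.2 (0 : E)) (Y.1, Fin.snoc Y.2 (0 : E)) =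
      ((groupBracket (trivJetModel E k) (TrivJet E G k) X Y).1,
        Fin.snoc (groupBracket (trivJetModel E k) (TrivJet E G k) X Y).2 (0 : E)) +
      (0, Fin.snoc (0 : Fin k → E) (lieCocycle G k X Y)) := by
  refine Prod.ext_of_init ?_ ?_
  · rw [tderiv_truncate_groupBracket]
    simp only [Fin.init_snoc, Prod.fst_add, Prod.snd_add, add_zero]
    refine Prod.ext rfl (funext fun j => ?_)
    simp [Fin.init]
  · rw [groupBracket_trivJet_last]
    simp [ad_zero_right]

variable (E G) in
theorem isAbelianLieAlgebraExtension_jet (k : ℕ) :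
    IsAbelianLieAlgebraExtension (jetLieInclusion E G k) (jetLieProjection E G k)
      (jetLieSection E G k) (fun X v => lieAction (E := E) G k X v)
      (fun X Y => lieCocycle (E := E) G k X Y) := by
  refine .of_bracket isLieAbelian_addGroupLieAlgebra ?_ ?_ ?_ ?_ ?_
  · intro v w h
    have h := congrArg (fun X : E × (Fin (k + 1) → E) => X.2 (Fin.last k))
      (((jetLieInclusion_apply (E := E) (G := G) (k := k) v).symm.trans h).trans
        (jetLieInclusion_apply (E := E) w))
    exact (Fin.snoc_last (α := fun _ => E) (v : E) 0).symm.trans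
      (h.trans (Fin.snoc_last (α := fun _ => E) (w : E) 0))
  · intro X
    constructor
    · intro h
      refine ⟨(X : E × (Fin (k + 1) → E)).2 (Fin.last k), ?_⟩
      refine (jetLieInclusion_apply (E := E) _).trans (Prod.ext_of_init ?_ ?_)
      · refine Eq.trans ?_ (h.symm.trans (jetLieProjection_apply X))
        simp only [Fin.init_snoc]
        rfl
      · simp
    · rintro ⟨v, rfl⟩
      refine (congrArg _ (jetLieInclusion_apply (E := E) v)).trans
        ((jetLieProjection_apply (E := E) _).trans ?_)
      exact Prod.ext rfl (Fin.init_snoc (α := fun _ => E) (v : E) (0 : Fin k → E))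
  · intro X
    refine (congrArg _ (jetLieSection_apply X)).trans ((jetLieProjection_apply _).trans ?_)
    simp only [Fin.init_snoc]
    rfl
  · intro X v
    refine Eq.trans ?_ ((groupBracket_section_inclusion (E := E) (G := G) X v).trans
      (jetLieInclusion_apply (E := E) _).symm)
    exact congrArg₂ (groupBracket (trivJetModel E (k + 1)) (TrivJet E G (k + 1)))
      (jetLieSection_apply X) (jetLieInclusion_apply (E := E) v)
  · intro X Y
    refine Eq.trans ?_ ((groupBracket_section_section (G := G) X Y).trans ?_)
    · exact congrArg₂ (groupBracket (trivJetModel E (k + 1)) (TrivJet E G (k + 1)))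
        (jetLieSection_apply X) (jetLieSection_apply Y)
    · exact congrArg₂ (fun A B : E × (Fin (k + 1) → E) => A + B)
        (jetLieSection_apply (G := G) _).symm (jetLieInclusion_apply (E := E) (G := G) _).symm

end JetLieAlgebraExtension

theorem proposition4p1 {E : Type*} [NormedAddCommGroup E] [NormedSpace ℝ E] [CompleteSpace E]
    {G : Type*} [TopologicalSpace G] [ChartedSpace E G] [Group G] [LieGroup 𝓘(ℝ, E) ∞ G] :
    -- the right trivialization is a bijection `J^n G ≃ G × 𝔤^n`
    ∃ e : ∀ n, Jet E G n ≃ TrivJet E G n,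
      (∀ n (c : SmoothCurve E G), e n (jet n c) = rightTriv n c) ∧
      -- `G × 𝔤^n` carries the group structure of `J^n G`
      letI : ∀ n, Group (TrivJet E G n) := fun n => (e n).symm.group
      ∃ _ : ∀ n, LieGroup (trivJetModel E n) ∞ (TrivJet E G n),
      ∀ k : ℕ,
        (∀ c : SmoothCurve E G, truncate k (e (k + 1) (jet (k + 1) c)) = e k (jet k c)) ∧
        -- the extension of Lie groups
        (∃ S : GroupExtension (Multiplicative E) (TrivJet E G (k + 1)) (TrivJet E G k),
          (∀ v : E, S.inl (Multiplicative.ofAdd v) = topInclusion G k v) ∧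
          (∀ a, S.rightHom a = truncate k a) ∧
          IsAbelianLieGroupExtension (trivJetModel E (k + 1)) (trivJetModel E k) S
            (zeroSection k) (fun a => Ad E a.1) (groupCocycle k)) ∧
        -- the second formula for the group cocycle
        (∀ a b : TrivJet E G k, groupCocycle k a b =
          ∑ l ∈ Finset.Icc 2 (k + 1), ∑ i : Composition (k + 1) with i.length = l,
            partitionNumber i.blocks • cocycleTerm a b i.blocks) ∧
        -- the extension of Lie algebras, obtained by differentiation
        ∃ (ι : AddGroupLieAlgebra 𝓘(ℝ, E) E →ₗ⁅ℝ⁆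
              GroupLieAlgebra (trivJetModel E (k + 1)) (TrivJet E G (k + 1)))
          (π : GroupLieAlgebra (trivJetModel E (k + 1)) (TrivJet E G (k + 1)) →ₗ⁅ℝ⁆
              GroupLieAlgebra (trivJetModel E k) (TrivJet E G k))
          (τ : GroupLieAlgebra (trivJetModel E k) (TrivJet E G k) →ₗ[ℝ]
              GroupLieAlgebra (trivJetModel E (k + 1)) (TrivJet E G (k + 1))),
          (∀ v, ι v = mfderiv 𝓘(ℝ, E) (trivJetModel E (k + 1)) (topInclusion G k) 0 v) ∧
          (∀ X, π X = mfderiv (trivJetModel E (k + 1)) (trivJetModel E k) (truncate k) 1 X) ∧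
          (∀ X, τ X = mfderiv (trivJetModel E k) (trivJetModel E (k + 1)) (zeroSection k) 1 X) ∧
          IsAbelianLieAlgebraExtension ι π τ
            (fun X v => lieAction (E := E) G k X v)
            (fun X Y => lieCocycle (E := E) G k X Y) := by
  refine ⟨jetEquiv E G, jetEquiv_jet, trivJet_lieGroup, fun k => ⟨truncate_rightTriv k,
    ⟨jetGroupExtension E G k, fun v => rfl, fun a => rfl,
      isAbelianLieGroupExtension_jetGroupExtension E G k⟩, groupCocycle_eq_sum_sum k,
    jetLieInclusion E G k, jetLieProjection E G k, jetLieSection E G k, fun v => rfl, fun X => rfl,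
    fun X => rfl, isAbelianLieAlgebraExtension_jet E G k⟩⟩
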